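/- **Setting.** Let $d\ge 5$, $l\ge 2$ be integers with $(d,l)\ne(5,2)$, and let $M=(d-1)l$ (so $M\ge 10$). Let $\overline{\mathbb P}=\mathbb P(1^{M+1},l)$ be the complex weighted projective space with homogeneous coordinates $x_0,\dots,x_M$ of weight $1$ and $\xi$ of weight $l$, and let $o^*=(0:\dots:0:1)$. Let $\mathcal F=\prod_{i=1}^d H^0(\mathbb P^M,\mathcal O(il))$ be the space of polynomials $F=\xi^d+A_1(x)\xi^{d-1}+\dots+A_d(x)$, where $A_i$ is homogeneous of degree $il$. Fix a point $o\in\overline{\mathbb P}$, $o\neq o^*$, and let $\mathcal F(o)\subset\mathcal F$ be the affine hyperplane of polynomials vanishing at $o$. Fix linear coordinates $x'_0,\dots,x'_M$ on $\mathbb P^M$ in which $o=(1:0:\dots:0:\beta)$, and put $z_i=x'_i/x'_0$ and $y=(\xi-\beta (x_0')^l)/(x_0')^l$. In the chart $x'_0\ne 0$ the hypersurface $V=\{F=0\}$ has an equation $f=y^d+a_1(z)y^{d-1}+\dots+a_d(z)=0$, with $\deg a_i\le il$. Let $a_{i,j}$ be the homogeneous component of $a_i$ of degree $j$; thus $a_{d,0}=0$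 for $F\in\mathcal F(o)$. **Regularity.** A polynomial $g=q_\mu+q_{\mu+1}+\cdots$ in $n$ variables, decomposed into homogeneous components with $\deg q_i=i$, $q_\mu\neq0$ and $\mu\ge1$, defines a hypersurface that is *$k$-regular* at the origin if $\mu\le k$ and $q_\mu,\dots,q_k$ is a regular sequence in $\mathcal O_{0,\mathbb A^n}$. (The zero polynomial, and a polynomial not vanishing at the origin, are not $k$-regular.) For a linear form $h(z)$, possibly zero, let $V_h\subset\mathbb A^M$ be the hypersurface $f(z,h(z))=0$. The polynomial $F\in\mathcal F(o)$ satisfies the *regularity condition* at $o$ if one of the following holds. * The linear form $a_{d-1,0}y+a_{d,1}(z)$ is not identically zero (that is, $o$ is a non-singular point of $V$), and (R1) $V_h$ is $\lceil 3dl/8\rceil$-regular for every linear form $h(z)$; and, if moreover $a_{d-1,0}=0$, (R1.2) for every linear form $h(z)$ linearly independent with $a_{d,1}(z)$, the restriction $V_0|_{\{h=0\}}\subset\{h=0\}\cong\mathbb A^{M-1}$ is $\lceil 3dl/8\rceil$-regular. * $a_{d-1,0}y+a_{d,1}(z)\equiv 0$ (that is, $o$ is a singular point of $V$), and (R2) the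 quadratic form $a_{d-2,0}y^2+a_{d-1,1}(z)y+a_{d,2}(z)$ has rank at least $7$ and $V_0$ is $\lceil dl/2\rceil$-regular. Let $\mathcal F_{\rm reg}(o)\subset\mathcal F(o)$ be the set of polynomials satisfying the regularity condition at $o$, and let $\mathcal F_{\rm non-reg}(o)=\overline{\mathcal F(o)\setminus\mathcal F_{\rm reg}(o)}$ be the Zariski closure of its complement. **Proposition 2.1.** For every such $d,l$, every point $o\ne o^*$ and every choice of coordinates as above, $$\operatorname{codim}\bigl(\mathcal F_{\rm non-reg}(o)\subset\mathcal F(o)\bigr)\ \ge\ \frac{(M-4)(M-5)}2+M+1 .$$ (The codimension of the empty set is $+\infty$.) -/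

import Mathlib

open MvPolynomial

noncomputable section

namespace FiniteCover

/-! ### The weighted projective space and the parameter space -/

/-- Nonzero vectors `(x_0, …, x_M, ξ)` of `ℂ^{M+2}`. -/
abbrev Rep (M : ℕ) : Type := {p : (Fin (M + 1) → ℂ) × ℂ // p ≠ 0}

/-- `(x, ξ) ∼ (t x, t ^ l ξ)` for `t ∈ ℂ^*`. -/
def weightedSetoid (M l : ℕ) : Setoid (Rep M) where
  r p q := ∃ t : ℂˣ, q.1.1 = (t : ℂ) • p.1.1 ∧ q.1.2 = (t : ℂ) ^ l * p.1.2
  iseqv :=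
    { refl := fun p => ⟨1, by simp, by simp⟩
      symm := by
        rintro p q ⟨t, h1, h2⟩
        refine ⟨t⁻¹, ?_, ?_⟩
        · rw [h1, smul_smul]; simp
        · rw [h2, ← mul_assoc, ← mul_pow]; simp
      trans := by
        rintro p q r ⟨t, h1, h2⟩ ⟨s, h3, h4⟩
        refine ⟨s * t, ?_, ?_⟩
        · rw [h3, h1, smul_smul]; simp
        · rw [h4, h2, ← mul_assoc, ← mul_pow]; simp }

/-- The weighted projective space `ℙ(1^{M+1}, l)` (its set of closed points). -/
def WeightedProj (M l : ℕ) : Type := Quotient (weightedSetoid M l)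

/-- The point with given homogeneous coordinates. -/
def WeightedProj.mk {M : ℕ} (l : ℕ) (p : Rep M) : WeightedProj M l :=
  Quotient.mk (weightedSetoid M l) p

/-- The point `o^* = (0 : … : 0 : 1)`. -/
def oStar (M l : ℕ) : WeightedProj M l :=
  WeightedProj.mk l ⟨(0, 1), fun h => one_ne_zero (congrArg Prod.snd h)⟩

/-- The parameter space `𝓕 = ∏_{i=1}^d H^0(ℙ^M, 𝒪(il))`; the `i`-th factor (`i : Fin d`) holds
the polynomial `A_{i+1}`, homogeneous of degree `(i+1) l`. -/
abbrev ParamSpace (M d l : ℕ) : Type :=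
  (i : Fin d) → homogeneousSubmodule (Fin (M + 1)) ℂ ((i.val + 1) * l)

/-- `F = ξ^d + A_1(x) ξ^{d-1} + … + A_d(x)`, as a polynomial in `ξ` with coefficients
in `ℂ[x_0, …, x_M]`. -/
def toPoly {M d l : ℕ} (A : ParamSpace M d l) : Polynomial (MvPolynomial (Fin (M + 1)) ℂ) :=
  Polynomial.X ^ d +
    ∑ i : Fin d, Polynomial.C (A i : MvPolynomial (Fin (M + 1)) ℂ) *
      Polynomial.X ^ (d - (i.val + 1))

/-- `𝓕(o)`: the members of `𝓕` vanishing at the point `o`. -/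
def vanishingAt {M l : ℕ} (d : ℕ) (o : WeightedProj M l) : Set (ParamSpace M d l) :=
  {A | ∀ p : Rep M, WeightedProj.mk l p = o →
    (toPoly A).eval₂ (MvPolynomial.eval p.1.1) p.1.2 = 0}

/-! ### Coordinates adapted to a point -/

/-- A linear change of the coordinates of `ℙ^M`, written `x = B x'`, such that in the coordinates
`(x'_0 : … : x'_M : ξ)` the point `o` is `(1 : 0 : … : 0 : β)`. -/
structure AdaptedCoordinates {M l : ℕ} (o : WeightedProj M l) where
  B : GL (Fin (M + 1)) ℂ
  β : ℂ
  ne_zero : ((fun i => B.val i 0, β) : (Fin (M + 1) → ℂ) × ℂ) ≠ 0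
  mk_eq : WeightedProj.mk l ⟨(fun i => B.val i 0, β), ne_zero⟩ = o

/-- The affine equation `f(z, y)` of `V = {F = 0}` in the chart `x'_0 ≠ 0`, where `z_i = x'_i/x'_0`
and `y = (ξ - β x'_0^l)/x'_0^l`; it is `F` with `x = B (1, z_1, …, z_M)` and `ξ = y + β`
substituted. It is a polynomial in `y` over `ℂ[z_1, …, z_M]`, and its coefficient
at `y^{d-i}` is `a_i(z)`. -/
def affineEq {M d l : ℕ} {o : WeightedProj M l} (c : AdaptedCoordinates o)
    (A : ParamSpace M d l) : Polynomial (MvPolynomial (Fin M) ℂ) :=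
  ((toPoly A).map
    (aeval (R := ℂ) fun j : Fin (M + 1) =>
      (C (c.B.val j 0) + ∑ i : Fin M, C (c.B.val j i.succ) * X i :
        MvPolynomial (Fin M) ℂ)).toRingHom).comp
    (Polynomial.X + Polynomial.C (C c.β))

/-- `a_{i,j}`: the homogeneous component of degree `j` of `a_i`, for `1 ≤ i ≤ d`. -/
def coeffPart {M : ℕ} (d : ℕ) (f : Polynomial (MvPolynomial (Fin M) ℂ)) (i j : ℕ) :
    MvPolynomial (Fin M) ℂ :=
  homogeneousComponent j (f.coeff (d - i))

/-! ### `k`-regularity -/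

/-- The maximal ideal of the origin in `ℂ[z_1, …, z_n]`. -/
def originIdeal (n : ℕ) : Ideal (MvPolynomial (Fin n) ℂ) :=
  RingHom.ker (constantCoeff : MvPolynomial (Fin n) ℂ →+* ℂ)

instance (n : ℕ) : (originIdeal n).IsPrime := by
  unfold originIdeal; exact RingHom.ker_isPrime _

/-- The local ring of affine space `𝔸^n` at the origin. -/
abbrev LocalRingAtOrigin (n : ℕ) : Type := Localization.AtPrime (originIdeal n)

/-- `{f = 0}` is `k`-regular at the origin: `f = q_μ + q_{μ+1} + …` with `q_i` homogeneous
of degree `i`, `q_μ ≠ 0`, `1 ≤ μ ≤ k`, and `q_μ, …, q_k` is a regular sequence in the local ring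
of the affine space at the origin. -/
def IsKRegular {n : ℕ} (f : MvPolynomial (Fin n) ℂ) (k : ℕ) : Prop :=
  ∃ μ : ℕ, 1 ≤ μ ∧ μ ≤ k ∧ (∀ i < μ, homogeneousComponent i f = 0) ∧
    homogeneousComponent μ f ≠ 0 ∧
    RingTheory.Sequence.IsRegular (LocalRingAtOrigin n)
      ((List.range' μ (k + 1 - μ)).map fun i =>
        algebraMap (MvPolynomial (Fin n) ℂ) (LocalRingAtOrigin n) (homogeneousComponent i f))

/-- The linear substitution `z = P t`. -/
def linSubst {m n : ℕ} (P : Matrix (Fin n) (Fin m) ℂ) :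
    MvPolynomial (Fin n) ℂ →ₐ[ℂ] MvPolynomial (Fin m) ℂ :=
  aeval fun i => ∑ j, C (P i j) * X j

/-- The restriction of `{f = 0} ⊂ 𝔸^n` to the hyperplane `{h = 0} ≅ 𝔸^{n-1}` is `k`-regular at
the origin. The hyperplane is parametrized linearly by `t ↦ P t`; since `k`-regularity is
invariant under linear changes of coordinates, it does not matter which `P` is used. -/
def IsKRegularOn {n : ℕ} (h f : MvPolynomial (Fin n) ℂ) (k : ℕ) : Prop :=
  ∃ P : Matrix (Fin n) (Fin (n - 1)) ℂ,
    P.rank = n - 1 ∧ linSubst P h = 0 ∧ IsKRegular (linSubst P f) k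

/-- The rank of a quadratic form `Q`: the rank of the matrix of its polar form
`Q(u + v) - Q(u) - Q(v)`. -/
def quadRank {σ : Type} [Fintype σ] [DecidableEq σ] (Q : MvPolynomial σ ℂ) : ℕ :=
  (Matrix.of fun i j : σ =>
    eval (Pi.single i 1 + Pi.single j 1 : σ → ℂ) Q
      - eval (Pi.single i 1) Q - eval (Pi.single j 1) Q).rank

/-! ### The regularity conditions at a point; `f` is the affine equation of `V` -/

/-- The linear form `a_{d-1,0} y + a_{d,1}(z)` is not identically zero. -/
def IsNonsingularAt {M : ℕ} (d : ℕ) (f : Polynomial (MvPolynomial (Fin M) ℂ)) : Prop :=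
  coeffPart d f (d - 1) 0 ≠ 0 ∨ coeffPart d f d 1 ≠ 0

/-- (R1): for every linear form `h(z)` (possibly zero), the hypersurface `V_h`, with equation
`f(z, h(z)) = 0`, is `⌈3dl/8⌉`-regular. -/
def CondR1 {M : ℕ} (d l : ℕ) (f : Polynomial (MvPolynomial (Fin M) ℂ)) : Prop :=
  ∀ h : MvPolynomial (Fin M) ℂ, h.IsHomogeneous 1 →
    IsKRegular (f.eval h) ⌈(3 * d * l : ℚ) / 8⌉₊

/-- (R1.2): for every linear form `h(z)` linearly independent with `a_{d,1}`, the hypersurface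
`V_0` restricted to `{h = 0}` is `⌈3dl/8⌉`-regular. -/
def CondR12 {M : ℕ} (d l : ℕ) (f : Polynomial (MvPolynomial (Fin M) ℂ)) : Prop :=
  ∀ h : MvPolynomial (Fin M) ℂ, h.IsHomogeneous 1 →
    LinearIndependent ℂ ![h, coeffPart d f d 1] →
      IsKRegularOn h (f.eval 0) ⌈(3 * d * l : ℚ) / 8⌉₊

/-- The quadratic form `a_{d-2,0} y^2 + a_{d-1,1}(z) y + a_{d,2}(z)` in the variables `z, y`
(`y` is the variable `none`). -/
def quadraticPart {M : ℕ} (d : ℕ) (f : Polynomial (MvPolynomial (Fin M) ℂ)) :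
    MvPolynomial (Option (Fin M)) ℂ :=
  rename some (coeffPart d f (d - 2) 0) * X none ^ 2
    + rename some (coeffPart d f (d - 1) 1) * X none
    + rename some (coeffPart d f d 2)

/-- (R2): the quadratic form has rank at least 7 and `V_0` is `⌈dl/2⌉`-regular. -/
def CondR2 {M : ℕ} (d l : ℕ) (f : Polynomial (MvPolynomial (Fin M) ℂ)) : Prop :=
  7 ≤ quadRank (quadraticPart d f) ∧ IsKRegular (f.eval 0) ⌈(d * l : ℚ) / 2⌉₊

/-- The regularity condition at the point: (R1) at a nonsingular point, together with (R1.2) if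
the point is of the second type (`a_{d-1,0} = 0`), and (R2) at a singular point. -/
def IsRegularAt {M : ℕ} (d l : ℕ) (f : Polynomial (MvPolynomial (Fin M) ℂ)) : Prop :=
  (IsNonsingularAt d f →
      CondR1 d l f ∧ (coeffPart d f (d - 1) 0 = 0 → CondR12 d l f)) ∧
    (¬ IsNonsingularAt d f → CondR2 d l f)

/-- `𝓕_reg(o)`: the members of `𝓕(o)` satisfying the regularity condition at `o`. -/
def regularAt {M l : ℕ} (d : ℕ) {o : WeightedProj M l} (c : AdaptedCoordinates o) :
    Set (ParamSpace M d l) :=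
  {A | A ∈ vanishingAt d o ∧ IsRegularAt d l (affineEq c A)}

/-! ### Zariski closure and codimension -/

/-- The ring of polynomial functions on a subset `X` of a complex vector space `W`: the algebra
of functions on `X` generated by the restrictions of the linear functionals (and the constants). For a
Zariski closed `X` in a finite-dimensional `W` this is the coordinate ring of `X`. -/
def coordRing {W : Type} [AddCommGroup W] [Module ℂ W] (X : Set W) : Subalgebra ℂ (X → ℂ) :=
  Algebra.adjoin ℂ (Set.range fun (φ : Module.Dual ℂ W) (x : X) => φ x.val)

/-- The ideal of polynomial functions on `X` vanishing at all points of `Y`. -/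
def idealOf {W : Type} [AddCommGroup W] [Module ℂ W] (X Y : Set W) : Ideal (coordRing X) where
  carrier := {f | ∀ x : X, x.val ∈ Y → f.val x = 0}
  add_mem' := by
    intro f g hf hg x hx
    simp [hf x hx, hg x hx]
  zero_mem' := by
    intro x _
    simp
  smul_mem' := by
    intro r f hf x hx
    simp [hf x hx]

/-- The Zariski closure of `Y` in `X`. -/
def zariskiClosure {W : Type} [AddCommGroup W] [Module ℂ W] (X Y : Set W) : Set W :=
  {x | ∃ hx : x ∈ X, ∀ f ∈ idealOf X Y, f.val ⟨x, hx⟩ = 0}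

/-- The codimension in `X` of a Zariski closed subset `Y ⊆ X`: the height of the ideal of `Y` in the
coordinate ring of `X` (it is `⊤` if `Y` is empty). -/
def codim {W : Type} [AddCommGroup W] [Module ℂ W] (X Y : Set W) : ℕ∞ :=
  (idealOf X Y).height

/-- `𝓕_non-reg(o)`: the Zariski closure of `𝓕(o) \ 𝓕_reg(o)`. -/
def nonRegularAt {M l : ℕ} (d : ℕ) {o : WeightedProj M l} (c : AdaptedCoordinates o) :
    Set (ParamSpace M d l) :=
  zariskiClosure (vanishingAt d o) (vanishingAt d o \ regularAt d c)

end FiniteCover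

end

open MvPolynomial

noncomputable section

namespace FiniteCover

/-! ### Regular sequences in local rings whose maximal ideal is generated by a regular sequence -/

section LocalAlgebra

open RingTheory.Sequence IsLocalRing

universe u

/-! The codimension is the height of the ideal of the non-regular set, and a prime containing a
finite intersection of ideals contains one of them. So it suffices to cover the non-regular
polynomials by finitely many loci and to bound the height for each (`le_codim_zariskiClosure`,
`exists_mem_locus_of_not_isRegularAt`). The coordinates are the coefficients of the affine equation
other than its constant term.

Heights are bounded without incidence varieties or constructible sets. For a locus `Y`, the ring of
all functions `Y → ℂ` is von Neumann regular, and its residue fields `K` serve as fields of generic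
points. They are algebraically closed, and finitely many functions that vanish in `K` vanish
together at some point of `Y`. Any pointwise choice, such as a bad linear form `h` or a bad
hyperplane, is already a function on `Y` and hence gives elements of `K`. If in every such `K` the
`N` coordinates are algebraic over `N - c` elements, the height is at least `c`
(`le_height_of_generic`).

A system of parameters in a regular local ring is a regular sequence. Hence, if `k`-regularity
fails, then in `n` variables, after restriction to a hyperplane that kills the linear part (none is
needed at a singular point), the components `q_2, …, q_k` fail to cut out dimension `n + 1 - k`.
This dimension condition is expressed as finiteness over `n + 1 - k` linear forms with complex
coefficients, which are constant along the family.

Let `j` be the first degree at which the condition fails. The zero set of `q_2, …, q_{j-1}` is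
finite over affine space of dimension `n + 2 - j`, and the part of it on which `q_j` vanishes still
projects onto that space. A point of this part over a complex point is algebraic over the
coefficients of `q_2, …, q_{j-1}`, so it gives a linear equation on the coefficients of `q_j` with
known coefficients. These equations have rank at least the number of monomials of degree `j` in `n +
2 - j` variables, which is `C(n+1, j) ≥ C(n+1, 2)` (`exists_determined_component`). Adding the
vanishing linear part and subtracting the parameters of `h` and of the hyperplane bounds the three
loci of non-regular sections.

The remaining locus consists of the singular points whose quadratic form has rank at most 6. A
symmetric matrix is determined by rows spanning its row space, which gives `C(M-4, 2)` conditions on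
a form in `M + 1` variables, besides the `M + 1` vanishing linear coefficients. This sum is exactly
the asserted number; the other bounds are at least as large. -/

theorem isWeaklyRegular_append_iff_quotient {A : Type u} [CommRing A] (rs₁ rs₂ : List A) :
    IsWeaklyRegular A (rs₁ ++ rs₂) ↔ IsWeaklyRegular A rs₁ ∧
      IsWeaklyRegular (A ⧸ Ideal.ofList rs₁) (rs₂.map (Ideal.Quotient.mk (Ideal.ofList rs₁))) := by
  rw [isWeaklyRegular_append_iff]
  refine and_congr_right fun _ => ?_
  have e : (A ⧸ (Ideal.ofList rs₁ • ⊤ : Submodule A A)) ≃ₗ[A] A ⧸ Ideal.ofList rs₁ :=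
    Submodule.quotEquivOfEq _ _ (by simp)
  rw [e.isWeaklyRegular_congr]
  exact (isWeaklyRegular_map_algebraMap_iff (S := A ⧸ Ideal.ofList rs₁) (A ⧸ Ideal.ofList rs₁)
    rs₂).symm

theorem isWeaklyRegular_concat_iff {A : Type u} [CommRing A] (rs : List A) (r : A) :
    IsWeaklyRegular A (rs ++ [r]) ↔ IsWeaklyRegular A rs ∧
      IsSMulRegular (A ⧸ Ideal.ofList rs) (Ideal.Quotient.mk (Ideal.ofList rs) r) := by
  rw [isWeaklyRegular_append_iff_quotient, List.map_singleton, isWeaklyRegular_singleton_iff]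

/-- If every coefficient of a representation of `y` by the `xs` were a non-unit, `y` would lie in
the square of the maximal ideal. A unit coefficient allows `y` to replace the corresponding
generator. -/
theorem exists_perm_cons_of_notMem_sq {A : Type u} [CommRing A] [IsLocalRing A] (xs : List A)
    (hxs : ∀ x ∈ xs, x ∈ maximalIdeal A) (y : A) (hy : y ∈ Ideal.ofList xs)
    (hy2 : y ∉ maximalIdeal A ^ 2) :
    ∃ (x : A) (xs' : List A) (c : A), xs.Perm (x :: xs') ∧ IsUnit c ∧
      y - c * x ∈ Ideal.ofList xs' := by
  induction xs generalizing y with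
  | nil =>
    exfalso
    rw [Ideal.ofList_nil, Ideal.mem_bot] at hy
    exact hy2 (hy ▸ zero_mem _)
  | cons a l ih =>
    rw [Ideal.ofList_cons, Submodule.mem_sup] at hy
    obtain ⟨s, hs, w, hw, rfl⟩ := hy
    obtain ⟨c, rfl⟩ := Ideal.mem_span_singleton'.mp hs
    by_cases hc : IsUnit c
    · exact ⟨a, l, c, List.Perm.refl _, hc, by simpa using hw⟩
    · have hca : c * a ∈ maximalIdeal A ^ 2 := by
        rw [pow_two]
        exact Ideal.mul_mem_mul ((mem_maximalIdeal c).mpr hc) (hxs a (by simp))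
      have hw2 : w ∉ maximalIdeal A ^ 2 := fun h => hy2 (add_mem hca h)
      obtain ⟨x, l', c', hperm, hc', hmem⟩ := ih (fun x hx => hxs x (by simp [hx])) w hw hw2
      refine ⟨x, a :: l', c', (hperm.cons a).trans (List.Perm.swap _ _ _), hc', ?_⟩
      rw [Ideal.ofList_cons, add_sub_assoc]
      exact add_mem (Ideal.mem_sup_left hs) (Ideal.mem_sup_right hmem)

theorem length_le_height_of_isWeaklyRegular {A : Type u} [CommRing A] [IsLocalRing A]
    [IsNoetherianRing A] (xs : List A) (h : IsWeaklyRegular A xs)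
    (hxs : ∀ x ∈ xs, x ∈ maximalIdeal A) : (xs.length : ℕ∞) ≤ (maximalIdeal A).height := by
  have hreg : IsRegular A xs :=
    (isRegular_iff_isWeaklyRegular_of_subset_maximalIdeal hxs).mpr h
  have h1 := ringKrullDim_add_length_eq_ringKrullDim_of_isRegular xs hreg
  rw [← maximalIdeal_height_eq_ringKrullDim (R := A)] at h1
  have hne : Ideal.ofList xs ≠ ⊤ := by
    intro ht
    have : Ideal.ofList xs ≤ maximalIdeal A := Ideal.span_le.mpr hxs
    exact (maximalIdeal.isMaximal A).ne_top (top_le_iff.mp (ht ▸ this))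
  have : Nontrivial (A ⧸ Ideal.ofList xs) := Ideal.Quotient.nontrivial_iff.mpr hne
  have h0 : (0 : WithBot ℕ∞) ≤ ringKrullDim (A ⧸ Ideal.ofList xs) :=
    ringKrullDim_nonneg_of_nontrivial
  have h2 : ((xs.length : ℕ∞) : WithBot ℕ∞) ≤ ((maximalIdeal A).height : WithBot ℕ∞) := by
    rw [← h1]
    calc ((xs.length : ℕ∞) : WithBot ℕ∞) = 0 + (xs.length : WithBot ℕ∞) := by simp
      _ ≤ _ := by gcongr
  exact_mod_cast h2

theorem height_le_length_of_mem_minimalPrimes {A : Type u} [CommRing A] [IsNoetherianRing A]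
    (gs : List A) (P : Ideal A) (hP : P ∈ (Ideal.ofList gs).minimalPrimes) :
    P.height ≤ gs.length := by
  classical
  have h : Ideal.ofList gs = Ideal.span (gs.toFinset : Set A) := by
    simp [Ideal.ofList]
  rw [h] at hP
  refine (Ideal.height_le_card_of_mem_minimalPrimes_span_finset hP).trans ?_
  exact_mod_cast gs.toFinset_card_le

/-- For a minimal prime `P` of `I` the maximal ideal is minimal over `P + (g)`, so by Krull it has
height at most one in `A/P`. A prime `Q` strictly between would have height zero there, hence equal
`P`, although `y ∈ Q` and `y ∉ P`. -/
theorem maximalIdeal_le_radical_of_notMem_minimalPrimes {A : Type u} [CommRing A] [IsLocalRing A]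
    [IsNoetherianRing A] (I : Ideal A) (g y : A)
    (hgm : g ∈ maximalIdeal A) (hg : maximalIdeal A ≤ (I ⊔ Ideal.span {g}).radical)
    (hy : ∀ P ∈ I.minimalPrimes, y ∉ P) :
    maximalIdeal A ≤ (I ⊔ Ideal.span {y}).radical := by
  rw [Ideal.radical_eq_sInf]
  refine le_sInf ?_
  rintro Q ⟨hQ, hQp⟩
  have hIQ : I ≤ Q := le_sup_left.trans hQ
  have hyQ : y ∈ Q := hQ (Ideal.mem_sup_right (Ideal.mem_span_singleton_self y))
  obtain ⟨P, hP, hPQ⟩ := Ideal.exists_minimalPrimes_le hIQ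
  have hPp : P.IsPrime := hP.1.1
  have hyP := hy P hP
  by_contra hne
  have hQm : Q < maximalIdeal A :=
    lt_of_le_of_ne (le_maximalIdeal hQp.ne_top) (fun h => hne h.ge)
  by_cases hgP : g ∈ P
  · have h1 : (I ⊔ Ideal.span {g}).radical ≤ P :=
      hPp.radical_le_iff.mpr (sup_le hP.1.2 ((Ideal.span_singleton_le_iff_mem _).mpr hgP))
    exact hne ((hg.trans h1).trans hPQ)
  have hIm : I ≤ maximalIdeal A := hIQ.trans hQm.le
  have hmin : maximalIdeal A ∈ (P ⊔ Ideal.span {g}).minimalPrimes := by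
    refine ⟨⟨(maximalIdeal.isMaximal A).isPrime, sup_le (hPQ.trans hQm.le)
      ((Ideal.span_singleton_le_iff_mem _).mpr hgm)⟩, ?_⟩
    rintro Q' ⟨hQ'p, hQ'⟩ -
    exact hg.trans (hQ'p.radical_le_iff.mpr ((sup_le_sup_right hP.1.2 _).trans hQ'))
  have hht := Ideal.map_height_le_one_of_mem_minimalPrimes hmin
  have hker : RingHom.ker (Ideal.Quotient.mk P) = P := Ideal.mk_ker
  have hsurj : Function.Surjective (Ideal.Quotient.mk P) := Ideal.Quotient.mk_surjective
  have hp1 : ((maximalIdeal A).map (Ideal.Quotient.mk P)).IsPrime :=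
    Ideal.map_isPrime_of_surjective hsurj (hker.trans_le (hPQ.trans hQm.le))
  have hp2 : (Q.map (Ideal.Quotient.mk P)).IsPrime :=
    Ideal.map_isPrime_of_surjective hsurj (hker.trans_le hPQ)
  have hlt : Q.map (Ideal.Quotient.mk P) < (maximalIdeal A).map (Ideal.Quotient.mk P) := by
    refine lt_of_le_not_ge (Ideal.map_mono hQm.le) fun h => ?_
    have h' := Ideal.comap_mono (f := Ideal.Quotient.mk P) h
    rw [Ideal.comap_map_of_surjective _ hsurj, Ideal.comap_map_of_surjective _ hsurj,
      ← RingHom.ker_eq_comap_bot, hker, sup_eq_left.mpr hPQ,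
      sup_eq_left.mpr (hPQ.trans hQm.le)] at h'
    exact hne h'
  have h0 := (Ideal.height_le_iff (n := 1)).mp (by exact_mod_cast hht) _ hp2 hlt
  have h0' : (Q.map (Ideal.Quotient.mk P)).height = 0 := by
    simpa [Order.lt_one_iff] using h0
  rw [Ideal.height_eq_zero_iff_eq_bot, Ideal.map_eq_bot_iff_le_ker, hker] at h0'
  exact hyP (h0' hyQ)

/-- A system of parameters in a regular local ring is a regular sequence; regularity of the ring
enters as generation of the maximal ideal by a regular sequence `xs`. The induction divides by an
element `y` that is both part of a regular system of parameters and a parameter modulo all but the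
last of the `gs`, and then exchanges `y` for that last element. -/
theorem isWeaklyRegular_of_maximalIdeal_le_radical (n : ℕ) :
    ∀ (A : Type u) [CommRing A] [IsLocalRing A] [IsNoetherianRing A] (xs gs : List A),
      xs.length = n → gs.length = n → IsWeaklyRegular A xs → Ideal.ofList xs = maximalIdeal A →
      (∀ g ∈ gs, g ∈ maximalIdeal A) → maximalIdeal A ≤ (Ideal.ofList gs).radical →
      IsWeaklyRegular A gs := by
  induction n with
  | zero =>
    intro A _ _ _ xs gs _ hgs _ _ _ _
    rw [List.length_eq_zero_iff.mp hgs]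
    exact IsWeaklyRegular.nil A A
  | succ n ih =>
    intro A _ _ _ xs gs hxl hgl hx hxm hgm hrad
    have hxsm : ∀ x ∈ xs, x ∈ maximalIdeal A := fun x h => hxm ▸ Ideal.subset_span h
    obtain ⟨gs', g, rfl⟩ : ∃ gs' g, gs = gs' ++ [g] := by
      have hne : gs ≠ [] := by rintro rfl; simp at hgl
      exact ⟨gs.dropLast, gs.getLast hne, (List.dropLast_append_getLast hne).symm⟩
    have hgl' : gs'.length = n := by simpa using hgl
    have hht : ((n + 1 : ℕ) : ℕ∞) ≤ (maximalIdeal A).height :=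
      hxl ▸ length_le_height_of_isWeaklyRegular xs hx hxsm
    have hfin := Ideal.finite_minimalPrimes_of_isNoetherianRing A (Ideal.ofList gs')
    -- Prime avoidance, with the square of the maximal ideal as the possibly non-prime member.
    -- Otherwise the maximal ideal would be zero by Nakayama, or minimal over `n` elements, and its
    -- height is at least `n + 1`.
    obtain ⟨y, hym, hy2, hyP⟩ : ∃ y ∈ maximalIdeal A, y ∉ maximalIdeal A ^ 2 ∧
        ∀ P ∈ (Ideal.ofList gs').minimalPrimes, y ∉ P := by
      by_contra hcon
      push Not at hcon
      have hsub : (maximalIdeal A : Set A) ⊆ ⋃ i ∈ (insert (maximalIdeal A ^ 2)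
          (Ideal.ofList gs').minimalPrimes : Set (Ideal A)), (id i : Ideal A) := by
        intro y hy
        by_cases h2 : y ∈ maximalIdeal A ^ 2
        · exact Set.mem_biUnion (Set.mem_insert _ _) h2
        · obtain ⟨P, hP, hyP⟩ := hcon y hy h2
          exact Set.mem_biUnion (Set.mem_insert_of_mem _ hP) hyP
      obtain ⟨P, hP, hle⟩ := (Ideal.subset_union_prime_finite (hfin.insert _) (f := id)
        (maximalIdeal A ^ 2) (maximalIdeal A ^ 2)
        (fun P hP h1 _ => (hP.resolve_left h1).1.1)).mp hsub
      rcases hP with rfl | hP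
      · have hbot : maximalIdeal A = ⊥ := by
          refine Submodule.eq_bot_of_le_smul_of_le_jacobson_bot (maximalIdeal A) _
            (IsNoetherian.noetherian _) ?_ (maximalIdeal_le_jacobson _)
          rw [smul_eq_mul, ← pow_two]; exact hle
        rw [hbot, Ideal.height_bot] at hht
        simp at hht
      · have hPm : P = maximalIdeal A :=
          le_antisymm (le_maximalIdeal hP.1.1.ne_top) hle
        have h1 := height_le_length_of_mem_minimalPrimes gs' P hP
        rw [hPm, hgl'] at h1
        have h2 : ((n + 1 : ℕ) : ℕ∞) ≤ (n : ℕ∞) := hht.trans h1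
        exact absurd (by exact_mod_cast h2) (Nat.not_succ_le_self n)
    obtain ⟨x, xs', c, hperm, hc, hyc⟩ :=
      exists_perm_cons_of_notMem_sq xs hxsm y (hxm ▸ hym) hy2
    have hxm' : ∀ z ∈ xs', z ∈ maximalIdeal A :=
      fun z hz => hxsm z (hperm.mem_iff.mpr (List.mem_cons_of_mem _ hz))
    have h1 : IsWeaklyRegular A (xs' ++ [x]) :=
      isWeaklyRegular_of_perm_of_subset_maximalIdeal hx
        (hperm.trans (List.perm_append_singleton x xs').symm) hxsm
    rw [isWeaklyRegular_concat_iff] at h1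
    have hyx : Ideal.Quotient.mk (Ideal.ofList xs') y = Ideal.Quotient.mk _ (c * x) :=
      Ideal.Quotient.eq.mpr hyc
    -- Modulo `xs'` the element `y` is a unit times `x`. Since order is irrelevant in a Noetherian
    -- local ring, `y` can then be moved to the front.
    have h2 : IsWeaklyRegular A (xs' ++ [y]) := by
      rw [isWeaklyRegular_concat_iff, hyx, map_mul]
      refine ⟨h1.1, IsSMulRegular.mul ?_ h1.2⟩
      exact (hc.map _).isSMulRegular _
    have h3 : IsWeaklyRegular A ([y] ++ xs') :=
      isWeaklyRegular_of_perm_of_subset_maximalIdeal h2 List.perm_append_comm (by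
        intro r hr
        rcases List.mem_append.mp hr with hr | hr
        · exact hxm' r hr
        · rw [List.mem_singleton.mp hr]; exact hym)
    rw [isWeaklyRegular_append_iff_quotient] at h3
    have hJ : Ideal.ofList [y] ≤ maximalIdeal A := by
      rw [Ideal.ofList_singleton]; exact (Ideal.span_singleton_le_iff_mem _).mpr hym
    have : Nontrivial (A ⧸ Ideal.ofList [y]) := Ideal.Quotient.nontrivial_iff.mpr
      (fun h => (maximalIdeal.isMaximal A).ne_top (top_le_iff.mp (h ▸ hJ)))
    have hsurj : Function.Surjective (Ideal.Quotient.mk (Ideal.ofList [y])) :=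
      Ideal.Quotient.mk_surjective
    have : IsLocalRing (A ⧸ Ideal.ofList [y]) := IsLocalRing.of_surjective' _ hsurj
    have hmap : (maximalIdeal A).map (Ideal.Quotient.mk (Ideal.ofList [y])) =
        maximalIdeal (A ⧸ Ideal.ofList [y]) :=
      map_maximalIdeal_of_surjective _ hsurj
    have hmxs : Ideal.ofList (xs'.map (Ideal.Quotient.mk (Ideal.ofList [y]))) =
        maximalIdeal (A ⧸ Ideal.ofList [y]) := by
      rw [← Ideal.map_ofList, ← hmap]
      refine le_antisymm (Ideal.map_mono (Ideal.span_le.mpr hxm')) ?_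
      rw [← hxm, Ideal.map_le_iff_le_comap]
      refine Ideal.span_le.mpr fun z hz => ?_
      rcases List.mem_cons.mp (hperm.mem_iff.mp hz) with rfl | hz
      · obtain ⟨u, rfl⟩ := hc
        have : (z : A) = ↑u⁻¹ * y - ↑u⁻¹ * (y - u * z) := by
          rw [mul_sub, sub_sub_cancel, ← mul_assoc]; simp
        rw [SetLike.mem_coe, Ideal.mem_comap, this, map_sub]
        refine sub_mem ?_ (Ideal.mem_map_of_mem _ (Ideal.mul_mem_left _ _ hyc))
        rw [map_mul, Ideal.Quotient.eq_zero_iff_mem.mpr (Ideal.subset_span (by simp) :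
          y ∈ Ideal.ofList [y]), mul_zero]
        exact zero_mem _
      · exact Ideal.mem_map_of_mem _ (Ideal.subset_span hz)
    have hrad' := maximalIdeal_le_radical_of_notMem_minimalPrimes (Ideal.ofList gs') g y
      (hgm g (by simp)) (by simpa using hrad) hyP
    have h4 := ih (A ⧸ Ideal.ofList [y]) (xs'.map (Ideal.Quotient.mk _))
      (gs'.map (Ideal.Quotient.mk _)) (by have := hperm.length_eq; simp at this ⊢; omega)
      (by simpa using hgl') h3.2 hmxs (by
        intro r hr
        obtain ⟨s, hs, rfl⟩ := List.mem_map.mp hr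
        rw [← hmap]
        exact Ideal.mem_map_of_mem _ (hgm s (by simp [hs]))) (by
        rw [← hmap, ← Ideal.map_ofList, Ideal.map_le_iff_le_comap]
        intro r hr
        obtain ⟨k, hk⟩ := hrad' hr
        refine ⟨k, ?_⟩
        have := Ideal.mem_map_of_mem (Ideal.Quotient.mk (Ideal.ofList [y])) hk
        rw [map_pow, Ideal.map_sup] at this
        have hy0 : (Ideal.span {y}).map (Ideal.Quotient.mk (Ideal.ofList [y])) = ⊥ := by
          rw [Ideal.map_span, Set.image_singleton, Ideal.Quotient.eq_zero_iff_mem.mpr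
            (Ideal.subset_span (by simp) : y ∈ Ideal.ofList [y])]
          simp
        rwa [hy0, sup_bot_eq] at this)
    have h5 : IsWeaklyRegular A ([y] ++ gs') := by
      rw [isWeaklyRegular_append_iff_quotient]
      exact ⟨h3.1, h4⟩
    have h6 : IsWeaklyRegular A (gs' ++ [y]) :=
      isWeaklyRegular_of_perm_of_subset_maximalIdeal h5 List.perm_append_comm (by
        intro r hr
        rcases List.mem_append.mp hr with hr | hr
        · rw [List.mem_singleton.mp hr]; exact hym
        · exact hgm r (by simp [hr]))
    -- Modulo `gs'` some power of `y` is a multiple of `g`; as `y` is regular there, so is `g`.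
    rw [isWeaklyRegular_concat_iff] at h6 ⊢
    refine ⟨h6.1, ?_⟩
    obtain ⟨k, hk⟩ := hrad hym
    rw [Ideal.ofList_append, Ideal.ofList_singleton, Submodule.mem_sup] at hk
    obtain ⟨w, hw, s, hs, hws⟩ := hk
    obtain ⟨b, rfl⟩ := Ideal.mem_span_singleton'.mp hs
    have h7 : Ideal.Quotient.mk (Ideal.ofList gs') y ^ k =
        Ideal.Quotient.mk _ b * Ideal.Quotient.mk _ g := by
      rw [← map_pow, ← hws, map_add, Ideal.Quotient.eq_zero_iff_mem.mpr hw, zero_add, map_mul]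
    exact IsSMulRegular.of_mul (h7 ▸ h6.2.pow k)

theorem originIdeal_eq_span (n : ℕ) :
    originIdeal n = Ideal.ofList (List.ofFn (X : Fin n → MvPolynomial (Fin n) ℂ)) := by
  have h : Ideal.ofList (List.ofFn X) =
      Ideal.span (X '' (Set.univ : Set (Fin n)) : Set (MvPolynomial (Fin n) ℂ)) := by
    simp [Ideal.ofList, List.mem_ofFn, Set.range]
  rw [h]
  ext p
  rw [mem_ideal_span_X_image, originIdeal, RingHom.mem_ker]
  constructor
  · intro hp m hm
    by_contra hcon
    push Not at hcon
    have : m = 0 := Finsupp.ext fun i => hcon i (Set.mem_univ _)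
    rw [mem_support_iff, this] at hm
    exact hm hp
  · intro hp
    by_contra hcon
    obtain ⟨i, -, hi⟩ := hp 0 (mem_support_iff.mpr hcon)
    exact hi rfl

theorem isWeaklyRegular_X (n : ℕ) :
    IsWeaklyRegular (MvPolynomial (Fin n) ℂ) (List.ofFn X : List (MvPolynomial (Fin n) ℂ)) := by
  refine ⟨fun i hi => ?_⟩
  have hin : i < n := by simpa using hi
  have hspan : (Ideal.ofList ((List.ofFn (X : Fin n → MvPolynomial (Fin n) ℂ)).take i) • ⊤ :
      Submodule (MvPolynomial (Fin n) ℂ) (MvPolynomial (Fin n) ℂ)) =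
      Ideal.span (X '' {j : Fin n | j.val < i}) := by
    rw [smul_eq_mul, Ideal.mul_top]
    refine congrArg Ideal.span (Set.ext fun p => ?_)
    constructor
    · intro hp
      obtain ⟨j, hj, rfl⟩ := List.mem_iff_getElem.mp hp
      rw [List.length_take, List.length_ofFn] at hj
      exact ⟨⟨j, by omega⟩, by simp; omega, by simp⟩
    · rintro ⟨j, hj, rfl⟩
      refine List.mem_iff_getElem.mpr ⟨j.val, ?_, ?_⟩
      · rw [List.length_take, List.length_ofFn]
        exact lt_min hj j.2
      · rw [List.getElem_take, List.getElem_ofFn]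
  rw [hspan, isSMulRegular_quotient_iff_mem_of_smul_mem]
  intro p hp
  rw [List.getElem_ofFn, smul_eq_mul] at hp
  rw [mem_ideal_span_X_image] at hp ⊢
  intro m hm
  obtain ⟨j, hj, hmj⟩ := hp (Finsupp.single ⟨i, hin⟩ 1 + m) (by
    rw [mem_support_iff, add_comm, mul_comm]
    rw [coeff_mul_X]
    exact mem_support_iff.mp hm)
  refine ⟨j, hj, ?_⟩
  have hne : (⟨i, hin⟩ : Fin n) ≠ j := by
    rintro rfl
    exact lt_irrefl _ (show i < i from hj)
  simpa [Finsupp.single_apply, hne] using hmj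

/-- A monic equation for `X i` modulo `J` factors as a power of `X i` times a polynomial with
nonzero constant term. The second factor is a unit at the origin. -/
theorem X_mem_radical_of_isIntegral {n : ℕ} (J : Ideal (MvPolynomial (Fin n) ℂ)) (i : Fin n)
    (h : IsIntegral ℂ (Ideal.Quotient.mk J (X i))) :
    algebraMap (MvPolynomial (Fin n) ℂ) (LocalRingAtOrigin n) (X i) ∈
      (J.map (algebraMap _ (LocalRingAtOrigin n))).radical := by
  obtain ⟨p, hp, hp0⟩ := h
  have hmem : Polynomial.aeval (X i : MvPolynomial (Fin n) ℂ) p ∈ J := by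
    rw [← Ideal.Quotient.eq_zero_iff_mem, ← hp0]
    exact (Polynomial.hom_eval₂ p _ (Ideal.Quotient.mk J) (X i))
  obtain ⟨q, hq, hq0⟩ := Polynomial.exists_eq_pow_rootMultiplicity_mul_and_not_dvd p hp.ne_zero 0
  rw [Polynomial.dvd_iff_isRoot, Polynomial.IsRoot] at hq0
  refine ⟨p.rootMultiplicity 0, ?_⟩
  have hunit : IsUnit (algebraMap _ (LocalRingAtOrigin n)
      (Polynomial.aeval (X i : MvPolynomial (Fin n) ℂ) q)) := by
    refine IsLocalization.map_units (M := (originIdeal n).primeCompl) _ ⟨_, ?_⟩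
    intro hcon
    apply hq0
    have h1 : constantCoeff (Polynomial.aeval (X i : MvPolynomial (Fin n) ℂ) q) = 0 := hcon
    rw [Polynomial.aeval_def, Polynomial.hom_eval₂] at h1
    simpa [Polynomial.eval₂_eq_eval_map, RingHom.comp_assoc, Polynomial.coeff_zero_eq_eval_zero]
      using h1
  have h2 := Ideal.mem_map_of_mem (algebraMap _ (LocalRingAtOrigin n)) hmem
  rw [hq] at h2
  simp only [map_zero, sub_zero, map_mul, map_pow, Polynomial.aeval_X] at h2
  exact (Ideal.mul_unit_mem_iff_mem _ hunit).mp h2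

/-- A sequence of polynomials vanishing at the origin that can be extended to a sequence of
length `n` with finite common zero locus is regular in the local ring at the origin. -/
theorem isRegular_of_isIntegral {n : ℕ} (L L' : List (MvPolynomial (Fin n) ℂ))
    (hlen : (L ++ L').length = n) (hL : ∀ p ∈ L ++ L', constantCoeff p = 0)
    (hint : ∀ i, IsIntegral ℂ (Ideal.Quotient.mk (Ideal.ofList (L ++ L')) (X i))) :
    IsRegular (LocalRingAtOrigin n) (L.map (algebraMap _ (LocalRingAtOrigin n))) := by
  have : IsNoetherianRing (LocalRingAtOrigin n) :=
    IsLocalization.isNoetherianRing (originIdeal n).primeCompl _ inferInstance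
  have hmax : (originIdeal n).map (algebraMap _ (LocalRingAtOrigin n)) =
      maximalIdeal (LocalRingAtOrigin n) := Localization.AtPrime.map_eq_maximalIdeal
  have hmem : ∀ g ∈ (L ++ L').map (algebraMap _ (LocalRingAtOrigin n)),
      g ∈ maximalIdeal (LocalRingAtOrigin n) := by
    intro g hg
    obtain ⟨p, hp, rfl⟩ := List.mem_map.mp hg
    rw [← hmax]
    exact Ideal.mem_map_of_mem _ (hL p hp)
  have key := isWeaklyRegular_of_maximalIdeal_le_radical n (LocalRingAtOrigin n)
    ((List.ofFn X).map (algebraMap _ (LocalRingAtOrigin n)))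
    ((L ++ L').map (algebraMap _ (LocalRingAtOrigin n))) (by simp)
    (by simpa using hlen)
    ((isWeaklyRegular_X n).of_isLocalization (LocalRingAtOrigin n) (originIdeal n).primeCompl)
    (by rw [← Ideal.map_ofList, ← originIdeal_eq_span, hmax]) hmem
    (by
      have h : maximalIdeal (LocalRingAtOrigin n) = Ideal.ofList ((List.ofFn X).map
          (algebraMap (MvPolynomial (Fin n) ℂ) (LocalRingAtOrigin n))) := by
        rw [← hmax, ← Ideal.map_ofList]
        exact congrArg (Ideal.map _) (originIdeal_eq_span n)
      rw [h]
      refine Ideal.span_le.mpr fun g hg => ?_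
      obtain ⟨p, hp, rfl⟩ := List.mem_map.mp hg
      obtain ⟨i, rfl⟩ := (List.mem_ofFn' _ _).mp hp
      rw [SetLike.mem_coe, ← Ideal.map_ofList]
      exact X_mem_radical_of_isIntegral _ i (hint i))
  rw [List.map_append, isWeaklyRegular_append_iff] at key
  exact (isRegular_iff_isWeaklyRegular_of_subset_maximalIdeal (fun g hg => hmem g (by
    rw [List.map_append]; exact List.mem_append_left _ hg))).mpr key.1

end LocalAlgebra

/-! ### Heights of ideals through generic points -/

section Height

/-- Going down for the flat extension `R → R[X]`. -/
theorem height_le_height_map_C {R : Type*} [CommRing R] [IsNoetherianRing R]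
    (p : Ideal R) [hp : p.IsPrime] :
    p.height ≤ (p.map (Polynomial.C : R →+* Polynomial R)).height := by
  have h1 : (p.map (Polynomial.C : R →+* Polynomial R)).IsPrime := Ideal.isPrime_map_C_of_isPrime
  have : (p.map (Polynomial.C : R →+* Polynomial R)).LiesOver p := ⟨by
    ext r
    rw [Ideal.mem_under, Polynomial.algebraMap_eq, Ideal.mem_map_C_iff]
    constructor
    · intro h n
      rw [Polynomial.coeff_C]
      split_ifs
      · exact h
      · exact zero_mem _
    · intro h
      simpa using h 0⟩
  rw [Ideal.height_eq_height_add_of_liesOver_of_hasGoingDown p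
    (p.map (Polynomial.C : R →+* Polynomial R))]
  exact le_self_add

/-- The inequality of the dimension formula for a prime of a polynomial ring, by adding one variable
at a time. With `p` the contraction of `P`, either `P = p[X]` and the new variable is transcendental
over the previous image, or `P` strictly contains `p[X]` and the height goes up. -/
theorem exists_algebraicIndependent_add_height {k : Type} [Field k] (N : ℕ) :
    ∀ (D : Type) [CommRing D] [IsDomain D] [Algebra k D] (θ : MvPolynomial (Fin N) k →ₐ[k] D),
      ∃ (ι : Type) (_ : Fintype ι) (f : ι → MvPolynomial (Fin N) k),
        AlgebraicIndependent k (fun i => θ (f i)) ∧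
          (N : ℕ∞) ≤ Fintype.card ι + (RingHom.ker θ).height := by
  induction N with
  | zero =>
    intro D _ _ _ θ
    exact ⟨Empty, inferInstance, Empty.elim, by
      rw [algebraicIndependent_empty_type_iff]
      exact FaithfulSMul.algebraMap_injective k D, by simp⟩
  | succ N ih =>
    intro D _ _ _ θ
    set e := finSuccEquiv k N with he
    let θ' : Polynomial (MvPolynomial (Fin N) k) →ₐ[k] D := θ.comp e.symm
    let θ₁ : MvPolynomial (Fin N) k →ₐ[k] D := θ'.comp Polynomial.CAlgHom
    have hht : (RingHom.ker θ').height = (RingHom.ker θ).height :=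
      RingEquiv.height_comap (e.symm.toRingEquiv) (RingHom.ker θ)
    obtain ⟨ι, _, f, hf, hN⟩ := ih D θ₁
    have hp : (RingHom.ker θ₁).IsPrime := RingHom.ker_isPrime _
    have hP : (RingHom.ker θ').IsPrime := RingHom.ker_isPrime _
    have hpC : ((RingHom.ker θ₁).map
        (Polynomial.C : _ →+* Polynomial (MvPolynomial (Fin N) k))).IsPrime :=
      Ideal.isPrime_map_C_of_isPrime
    have hpht := height_le_height_map_C (RingHom.ker θ₁)
    have hle : (RingHom.ker θ₁).map Polynomial.C ≤ RingHom.ker θ' :=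
      Ideal.map_le_iff_le_comap.mpr fun a ha => ha
    rw [← hht]
    by_cases heq : RingHom.ker θ' = (RingHom.ker θ₁).map Polynomial.C
    · refine ⟨Unit ⊕ ι, inferInstance,
        Sum.elim (fun _ => e.symm Polynomial.X) (fun i => e.symm (Polynomial.C (f i))), ?_, ?_⟩
      -- A relation over the image of `θ₁` lifts to an element of `ker θ' = p[X]`. All its
      -- coefficients are then in `ker θ₁`, so the relation is trivial.
      · have htr : Transcendental θ₁.range (θ' Polynomial.X) := by
          rw [transcendental_iff]
          intro Q hQ
          obtain ⟨Q', rfl⟩ := Polynomial.map_surjective (θ₁.rangeRestrict : MvPolynomial (Fin N) k →+* θ₁.range)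
            (AlgHom.rangeRestrict_surjective θ₁) Q
          have h1 : θ' Q' = 0 := by
            rw [← hQ, Polynomial.aeval_def, Polynomial.eval₂_map]
            conv_lhs => rw [← Polynomial.eval₂_C_X (p := Q')]
            exact Polynomial.hom_eval₂ Q' Polynomial.C (θ' : _ →+* D) Polynomial.X
          have h2 : Q' ∈ RingHom.ker θ' := h1
          rw [heq, Ideal.mem_map_C_iff] at h2
          ext n
          rw [Polynomial.coeff_map, Polynomial.coeff_zero]
          exact h2 n
        have h1 : AlgebraicIndependent θ₁.range (fun _ : Unit => θ' Polynomial.X) := by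
          rw [algebraicIndependent_unique_type_iff]
          exact htr
        have h2 := hf.sumElim_of_tower (S := θ₁.range) (by
          rintro _ ⟨i, rfl⟩
          exact ⟨⟨θ₁ (f i), ⟨f i, rfl⟩⟩, rfl⟩) h1
        convert! h2 using 1
        ext1 i
        rcases i with i | i <;> rfl
      · rw [heq]
        simp only [Fintype.card_sum, Fintype.card_unit, Nat.cast_add, Nat.cast_one]
        calc (N : ℕ∞) + 1 ≤ (Fintype.card ι + (RingHom.ker θ₁).height) + 1 := by gcongr
          _ = 1 + Fintype.card ι + (RingHom.ker θ₁).height := by ring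
          _ ≤ _ := by gcongr
    · refine ⟨ι, inferInstance, fun i => e.symm (Polynomial.C (f i)), hf, ?_⟩
      have hlt : (RingHom.ker θ₁).map Polynomial.C < RingHom.ker θ' :=
        lt_of_le_of_ne hle (fun h => heq h.symm)
      have h3 := Ideal.height_add_one_le_of_lt_of_isPrime hlt
      push_cast
      calc (N : ℕ∞) + 1 ≤ (Fintype.card ι + (RingHom.ker θ₁).height) + 1 := by gcongr
        _ = Fintype.card ι + ((RingHom.ker θ₁).height + 1) := by ring
        _ ≤ Fintype.card ι + (((RingHom.ker θ₁).map Polynomial.C).height + 1) := by gcongr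
        _ ≤ _ := by gcongr

/-- The exchange property for algebraic independence, in the form of ranks in the associated
matroid. -/
theorem card_le_of_isAlgebraic_adjoin {k K ι : Type} [Field k] [Field K] [Algebra k K] [Fintype ι]
    (v : ι → K) (hv : AlgebraicIndependent k v) (T : Finset K)
    (h : ∀ i, IsAlgebraic (Algebra.adjoin k (T : Set K)) (v i)) :
    Fintype.card ι ≤ T.card := by
  have hind : (AlgebraicIndependent.matroid k K).Indep (Set.range v) := by
    rw [AlgebraicIndependent.matroid_indep_iff]
    exact hv.to_subtype_range
  have hsub : Set.range v ⊆ (AlgebraicIndependent.matroid k K).closure T := by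
    rw [AlgebraicIndependent.matroid_closure_eq]
    rintro _ ⟨i, rfl⟩
    exact h i
  have h1 := hind.encard_le_eRk_of_subset hsub
  rw [Matroid.eRk_closure_eq] at h1
  have h2 := h1.trans (Matroid.eRk_le_encard _ _)
  rw [Set.encard_coe_eq_coe_finsetCard, ← Set.image_univ,
    hv.injective.injOn.encard_image] at h2
  simpa using h2

/-- The pointwise inverse, with value zero at the zeros of `a`, satisfies `a * (1 - a⁻¹ * a) = 0`.
-/
theorem isMaximal_of_isPrime_pi (Y : Type) (p : Ideal (Y → ℂ)) [p.IsPrime] : p.IsMaximal := by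
  classical
  rw [Ideal.isMaximal_iff]
  refine ⟨fun h => Ideal.IsPrime.ne_top ‹_› ((Ideal.eq_top_iff_one p).mpr h), ?_⟩
  intro J a hpJ hap haJ
  have h1 : a * (1 - a⁻¹ * a) ∈ p := by
    have : a * (1 - a⁻¹ * a) = 0 := by
      ext y
      by_cases h : a y = 0 <;> simp [h]
    rw [this]
    exact zero_mem _
  have h2 := hpJ ((Ideal.IsPrime.mem_or_mem ‹_› h1).resolve_left hap)
  have h3 := J.add_mem h2 (J.mul_mem_left a⁻¹ haJ)
  simpa using h3

/-- `F` is algebraically closed in the extension `K`. -/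
def IsRelAlgClosed {k K : Type} [Field k] [Field K] [Algebra k K] (F : IntermediateField k K) :
    Prop :=
  ∀ a : K, IsAlgebraic F a → a ∈ F

/-- The algebraic closure in `K` of the subfield generated by a set. -/
def relAlgClosure {k K : Type} [Field k] [Field K] [Algebra k K] (S : Set K) :
    IntermediateField k K :=
  (algebraicClosure (IntermediateField.adjoin k S) K).restrictScalars k

theorem isRelAlgClosed_relAlgClosure {k K : Type} [Field k] [Field K] [Algebra k K] (S : Set K) :
    IsRelAlgClosed (relAlgClosure (k := k) S) := by
  intro a ha
  let F₀ := IntermediateField.adjoin k S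
  have h : IsAlgebraic (algebraicClosure F₀ K) a := ha
  exact mem_algebraicClosure_iff.mpr (h.restrictScalars F₀)

theorem subset_relAlgClosure {k K : Type} [Field k] [Field K] [Algebra k K] (S : Set K) :
    S ⊆ relAlgClosure (k := k) S := fun a ha =>
  (algebraicClosure (IntermediateField.adjoin k S) K).algebraMap_mem
    ⟨a, IntermediateField.subset_adjoin k S ha⟩

theorem relAlgClosure_le {k K : Type} [Field k] [Field K] [Algebra k K] {S : Set K}
    {F : IntermediateField k K} (hF : IsRelAlgClosed F) (hS : S ⊆ F) : relAlgClosure S ≤ F := by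
  intro a ha
  have hle : IntermediateField.adjoin k S ≤ F := IntermediateField.adjoin_le_iff.mpr hS
  have h : IsAlgebraic (IntermediateField.adjoin k S) a := mem_algebraicClosure_iff.mp ha
  refine hF a ?_
  obtain ⟨p, hp, hpa⟩ := h
  refine ⟨p.map (IntermediateField.inclusion hle), ?_, ?_⟩
  · exact (Polynomial.map_ne_zero_iff (IntermediateField.inclusion hle).injective).mpr hp
  · rw [Polynomial.aeval_def, Polynomial.eval₂_map]
    exact hpa

/-- A lower bound for the height of the ideal of a set `Y` of points through the generic points
of `Y`, that is, the residue fields of the ring of all functions on `Y`. -/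
theorem le_height_of_generic {A : Type} [CommRing A] [Algebra ℂ A] {σ : Type} [Fintype σ]
    (e : MvPolynomial σ ℂ ≃ₐ[ℂ] A) (Y : Type) (ev : Y → A →ₐ[ℂ] ℂ) (I : Ideal A)
    (hI : ∀ a, (∀ y, ev y a = 0) → a ∈ I) (c : ℕ)
    (h : ∀ (K : Type) [Field K] [Algebra ℂ K] (φ : (Y → ℂ) →ₐ[ℂ] K), Function.Surjective φ →
      ∃ T : Finset K, T.card + c ≤ Fintype.card σ ∧
        ∀ F : IntermediateField ℂ K, IsRelAlgClosed F → (T : Set K) ⊆ F →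
          ∀ s, (φ fun y => ev y (e (X s))) ∈ F) :
    (c : ℕ∞) ≤ I.height := by
  rw [Ideal.height_eq_inf_minimalPrimes]
  refine le_iInf₂ fun P hP => ?_
  have hPp : P.IsPrime := hP.1.1
  let r : MvPolynomial (Fin (Fintype.card σ)) ℂ ≃ₐ[ℂ] A :=
    (renameEquiv ℂ (Fintype.equivFin σ).symm).trans e
  obtain ⟨ι, _, f, hf, hN⟩ := exists_algebraicIndependent_add_height (Fintype.card σ) (A ⧸ P)
    ((Ideal.Quotient.mkₐ ℂ P).comp r)
  have hker : (RingHom.ker ((Ideal.Quotient.mkₐ ℂ P).comp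
      (r : MvPolynomial (Fin (Fintype.card σ)) ℂ →ₐ[ℂ] A))).height = P.height := by
    rw [← RingEquiv.height_comap r.toRingEquiv P]
    congr 1
    ext a
    exact Ideal.Quotient.eq_zero_iff_mem
  rw [hker] at hN
  let evA : A →ₐ[ℂ] (Y → ℂ) := AlgHom.pi ev
  let Ψ : MvPolynomial ι ℂ →ₐ[ℂ] (Y → ℂ) := evA.comp (aeval fun i => r (f i))
  -- A nonzero polynomial in the `f i` is not in `P`, hence not in `I`, hence not identically zero
  -- on `Y`. A prime of `Y → ℂ` disjoint from all these functions gives a residue field in which the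
  -- `f i` stay algebraically independent.
  let S : Submonoid (Y → ℂ) := (nonZeroDivisors (MvPolynomial ι ℂ)).map Ψ
  have hΨ : ∀ G, Ψ G = 0 → G = 0 := by
    intro G hG
    refine hf.eq_zero_of_aeval_eq_zero G ?_
    have h1 : aeval (fun i => r (f i)) G ∈ P := hP.1.2 (hI _ fun y => congrFun hG y)
    have h2 := Ideal.Quotient.eq_zero_iff_mem.mpr h1
    rw [← h2]
    exact (comp_aeval_apply (fun i => r (f i)) (Ideal.Quotient.mkₐ ℂ P) G).symm
  have hdisj : Disjoint ((⊥ : Ideal (Y → ℂ)) : Set (Y → ℂ)) S := by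
    rw [Set.disjoint_left]
    rintro a ha ⟨G, hG, rfl⟩
    exact nonZeroDivisors.ne_zero hG (hΨ G ha)
  obtain ⟨p, hp, -, hpS⟩ := Ideal.exists_le_prime_disjoint _ S hdisj
  have hpm := isMaximal_of_isPrime_pi Y p
  let _ : Field ((Y → ℂ) ⧸ p) := Ideal.Quotient.field p
  obtain ⟨T, hT, hTalg⟩ := h ((Y → ℂ) ⧸ p) (Ideal.Quotient.mkₐ ℂ p)
    (Ideal.Quotient.mkₐ_surjective ℂ p)
  have hind : AlgebraicIndependent ℂ fun i => Ideal.Quotient.mkₐ ℂ p (evA (r (f i))) := by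
    rw [algebraicIndependent_iff]
    intro G hG
    by_contra hG0
    have h1 : Ψ G ∈ p := by
      rw [← Ideal.Quotient.eq_zero_iff_mem, ← hG]
      exact (comp_aeval_apply (fun i => r (f i)) ((Ideal.Quotient.mkₐ ℂ p).comp evA) G)
    exact Set.disjoint_left.mp hpS h1 ⟨G, mem_nonZeroDivisors_of_ne_zero hG0, rfl⟩
  have hcard : Fintype.card ι ≤ T.card := by
    refine card_le_of_isAlgebraic_adjoin _ hind T fun i => ?_
    have h1 := hTalg _ (isRelAlgClosed_relAlgClosure (k := ℂ) (T : Set ((Y → ℂ) ⧸ p)))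
      (subset_relAlgClosure _)
    have h2 : ∀ g : MvPolynomial σ ℂ, Ideal.Quotient.mkₐ ℂ p (evA (e g)) ∈
        relAlgClosure (k := ℂ) (T : Set ((Y → ℂ) ⧸ p)) := by
      intro g
      induction g using MvPolynomial.induction_on with
      | C a =>
        have : e (C a) = algebraMap ℂ A a := e.commutes a
        rw [this, AlgHom.commutes, AlgHom.commutes]
        exact IntermediateField.algebraMap_mem _ a
      | add g g' hg hg' => simp only [map_add]; exact add_mem hg hg'
      | mul_X g s hg => simp only [map_mul]; exact mul_mem hg (h1 s)
    have h3 := h2 (renameEquiv ℂ (Fintype.equivFin σ).symm (f i))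
    have h4 : IsAlgebraic (IntermediateField.adjoin ℂ (T : Set ((Y → ℂ) ⧸ p)))
        (Ideal.Quotient.mkₐ ℂ p (evA (r (f i)))) := mem_algebraicClosure_iff.mp h3
    exact IntermediateField.isAlgebraic_adjoin_iff.mp h4
  have h1 : (T.card : ℕ∞) + c ≤ T.card + P.height :=
    calc (T.card : ℕ∞) + c ≤ Fintype.card σ := by exact_mod_cast hT
      _ ≤ Fintype.card ι + P.height := hN
      _ ≤ _ := by gcongr
  exact (ENat.add_le_add_iff_left (ENat.natCast_ne_top _)).mp h1

end Height

/-! ### Linear Noether normalisation -/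

section Noether

variable {K : Type} [Field K] [Algebra ℂ K] {n r : ℕ}

/-- Substitution of complex linear forms in `n` variables for the variables. -/
def linAeval (K : Type) [CommRing K] [Algebra ℂ K] {n r : ℕ} (ℓ : Fin r → Fin n → ℂ) :
    MvPolynomial (Fin r) K →ₐ[K] MvPolynomial (Fin n) K :=
  aeval fun s => ∑ i, C (algebraMap ℂ K (ℓ s i)) * X i

theorem linAeval_X (ℓ : Fin r → Fin n → ℂ) (s : Fin r) :
    linAeval K ℓ (X s) = ∑ i, C (algebraMap ℂ K (ℓ s i)) * X i := by
  simp [linAeval]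

theorem eval_linAeval (ℓ : Fin r → Fin n → ℂ) (p : Fin n → K) (g : MvPolynomial (Fin r) K) :
    eval p (linAeval K ℓ g) = eval (fun s => ∑ i, algebraMap ℂ K (ℓ s i) * p i) g := by
  have h : (eval p).comp (linAeval K ℓ).toRingHom =
      eval (fun s => ∑ i, algebraMap ℂ K (ℓ s i) * p i) := by
    ext s
    · simp [linAeval]
    · simp [linAeval]
  exact congrArg (fun f : MvPolynomial (Fin r) K →+* K => f g) h

/-- The variables are integral over `r` complex linear forms modulo the ideal `Q`. -/
def IsFiniteOverLin (Q : Ideal (MvPolynomial (Fin n) K)) (r : ℕ) : Prop :=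
  ∃ ℓ : Fin r → Fin n → ℂ, ∀ i,
    ((Ideal.Quotient.mk Q).comp (linAeval K ℓ).toRingHom).IsIntegralElem (Ideal.Quotient.mk Q (X i))

theorem isIntegralElem_mono {ℓ : Fin r → Fin n → ℂ} {Q Q' : Ideal (MvPolynomial (Fin n) K)}
    (hQ : Q ≤ Q') {x : MvPolynomial (Fin n) K}
    (h : ((Ideal.Quotient.mk Q).comp (linAeval K ℓ).toRingHom).IsIntegralElem
      (Ideal.Quotient.mk Q x)) :
    ((Ideal.Quotient.mk Q').comp (linAeval K ℓ).toRingHom).IsIntegralElem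
      (Ideal.Quotient.mk Q' x) :=
  h.map (Ideal.Quotient.factor hQ)

omit [Algebra ℂ K] in
theorem natDegree_le_and_coeff_aeval (c : Fin r → K) (g : MvPolynomial (Fin (r + 1)) K) (D : ℕ)
    (hD : g.totalDegree ≤ D) :
    (aeval (Fin.cons Polynomial.X fun s => Polynomial.C (X s) + Polynomial.C (C (c s)) *
      Polynomial.X : Fin (r + 1) → Polynomial (MvPolynomial (Fin r) K)) g).natDegree ≤ D ∧
    (aeval (Fin.cons Polynomial.X fun s => Polynomial.C (X s) + Polynomial.C (C (c s)) *
      Polynomial.X : Fin (r + 1) → Polynomial (MvPolynomial (Fin r) K)) g).coeff D =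
      C (eval (Fin.cons 1 c : Fin (r + 1) → K) (homogeneousComponent D g)) := by
  classical
  set w : Fin (r + 1) → Polynomial (MvPolynomial (Fin r) K) :=
    Fin.cons Polynomial.X fun s => Polynomial.C (X s) + Polynomial.C (C (c s)) * Polynomial.X
    with hw
  have hw1 : ∀ s, (w s).natDegree ≤ 1 ∧
      (w s).coeff 1 = C ((Fin.cons 1 c : Fin (r + 1) → K) s) := by
    intro s
    refine Fin.cases ?_ (fun s => ?_) s
    · simp [hw]
    · simp only [hw, Fin.cons_succ]
      constructor
      · rw [add_comm]; exact Polynomial.natDegree_linear_le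
      · simp [Polynomial.coeff_C]
  -- Each `w s` is at most linear in the new variable with leading coefficient the `s`-th entry of
  -- `(1, c)`, so a monomial contributes its value at that point in its top degree.
  have hprod : ∀ (m : Fin (r + 1) →₀ ℕ) (S : Finset (Fin (r + 1))),
      (∏ s ∈ S, w s ^ m s).natDegree ≤ ∑ s ∈ S, m s ∧
      (∏ s ∈ S, w s ^ m s).coeff (∑ s ∈ S, m s) =
        C (∏ s ∈ S, (Fin.cons 1 c : Fin (r + 1) → K) s ^ m s) := by
    intro m S
    induction S using Finset.induction_on with
    | empty => simp
    | insert a S ha ih =>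
      rw [Finset.prod_insert ha, Finset.sum_insert ha, Finset.prod_insert ha]
      have h1 : (w a ^ m a).natDegree ≤ m a := by
        simpa using Polynomial.natDegree_pow_le_of_le (m a) (hw1 a).1
      have h2 : (w a ^ m a).coeff (m a) = C ((Fin.cons 1 c : Fin (r + 1) → K) a ^ m a) := by
        have := Polynomial.coeff_pow_of_natDegree_le (m := m a) (hw1 a).1
        rw [mul_one] at this
        rw [this, (hw1 a).2, map_pow]
      exact ⟨Polynomial.natDegree_mul_le_of_le h1 ih.1, by
        rw [Polynomial.coeff_mul_add_eq_of_natDegree_le h1 ih.1, h2, ih.2, map_mul]⟩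
  have hmon : ∀ m ∈ g.support,
      (aeval w (monomial m (coeff m g))).natDegree ≤ D ∧
      (aeval w (monomial m (coeff m g))).coeff D =
        if m.degree = D then C (coeff m g *
          ∏ s, (Fin.cons 1 c : Fin (r + 1) → K) s ^ m s) else 0 := by
    intro m hm
    have hmD : ∑ s, m s ≤ D := by
      refine le_trans ?_ hD
      have := le_totalDegree hm
      rwa [Finsupp.sum_fintype _ _ (fun _ => rfl)] at this
    have hdeg : m.degree = ∑ s, m s := Finsupp.degree_eq_sum m
    rw [aeval_monomial, Finsupp.prod_fintype _ _ (fun _ => pow_zero _)]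
    have hC : algebraMap K (Polynomial (MvPolynomial (Fin r) K)) (coeff m g) =
        Polynomial.C (C (coeff m g)) := rfl
    rw [hC]
    have h := hprod m Finset.univ
    refine ⟨(Polynomial.natDegree_C_mul_le _ _).trans (h.1.trans hmD), ?_⟩
    rw [Polynomial.coeff_C_mul, hdeg]
    split_ifs with heq
    · rw [← heq, h.2, map_mul]
    · rw [Polynomial.coeff_eq_zero_of_natDegree_lt (lt_of_le_of_lt h.1 (lt_of_le_of_ne hmD heq)),
        mul_zero]
  conv => 
    enter [1]
    rw [g.as_sum]
  conv => 
    enter [2, 1]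
    rw [g.as_sum]
  rw [map_sum]
  refine ⟨Polynomial.natDegree_sum_le_of_forall_le _ _ fun m hm => (hmon m hm).1, ?_⟩
  rw [Polynomial.finsetSum_coeff, Finset.sum_congr rfl fun m hm => (hmon m hm).2,
    homogeneousComponent_apply, map_sum, map_sum, Finset.sum_filter]
  refine Finset.sum_congr rfl fun m _ => ?_
  split_ifs
  · rw [eval_monomial, Finsupp.prod_fintype _ _ (fun _ => pow_zero _)]
  · rfl

/-- Because `ℂ` is infinite, generic choices over `K` can be made with complex values. This is what
keeps all linear projections constant along a family. -/
theorem exists_eval_ne_zero {σ : Type} [Finite σ] (g : MvPolynomial σ K) (hg : g ≠ 0) :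
    ∃ c : σ → ℂ, eval (fun s => algebraMap ℂ K (c s)) g ≠ 0 := by
  by_contra hcon
  push Not at hcon
  apply hg
  refine funext_set (fun _ => Set.range (algebraMap ℂ K))
    (fun _ => Set.infinite_range_of_injective (algebraMap ℂ K).injective) fun x hx => ?_
  rw [map_zero]
  choose c hc using fun s => hx s (Set.mem_univ s)
  have : x = fun s => algebraMap ℂ K (c s) := funext fun s => (hc s).symm
  rw [this]
  exact hcon c

/-- The exponents of the monomials of degree `j` in `n` variables. -/
def mon (n j : ℕ) : Finset (Fin n →₀ ℕ) := Finset.univ.finsuppAntidiag j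

theorem mem_mon {n j : ℕ} {m : Fin n →₀ ℕ} : m ∈ mon n j ↔ m.degree = j := by
  simp [mon, Finset.mem_finsuppAntidiag, Finsupp.degree_eq_sum]

theorem eval_eq_sum_mon {R : Type} [CommRing R] {g : MvPolynomial (Fin n) R} {j : ℕ}
    (hg : g.IsHomogeneous j) (p : Fin n → R) :
    eval p g = ∑ m ∈ mon n j, coeff m g * ∏ i, p i ^ m i := by
  rw [eval_eq']
  refine Finset.sum_subset (fun m hm => mem_mon.mpr ?_) fun m _ hm => ?_
  · have := hg (mem_support_iff.mp hm)
    rw [Finsupp.degree_eq_weight_one (R := ℕ)]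
    exact this
  · rw [notMem_support_iff.mp hm, zero_mul]

omit [Algebra ℂ K] in
theorem eval_smul_of_isHomogeneous {g : MvPolynomial (Fin n) K} {j : ℕ}
    (hg : g.IsHomogeneous j) (a : K) (p : Fin n → K) :
    eval (a • p) g = a ^ j * eval p g := by
  rw [eval_eq_sum_mon hg, eval_eq_sum_mon hg, Finset.mul_sum]
  refine Finset.sum_congr rfl fun m hm => ?_
  have h : ∏ i, (a • p) i ^ m i = a ^ j * ∏ i, p i ^ m i := by
    simp only [Pi.smul_apply, smul_eq_mul, mul_pow, Finset.prod_mul_distrib,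
      Finset.prod_pow_eq_pow_sum]
    rw [← Finsupp.degree_eq_sum, mem_mon.mp hm]
  rw [h]
  ring

theorem exists_cons_one_eval_ne_zero (g : MvPolynomial (Fin (r + 1)) K) (hg : g ≠ 0) (D : ℕ)
    (hgD : g.IsHomogeneous D) :
    ∃ c : Fin r → ℂ, eval (Fin.cons 1 fun s => algebraMap ℂ K (c s) : Fin (r + 1) → K) g ≠ 0 := by
  -- The factor `X 0` forces `c 0 ≠ 0`, so homogeneity allows rescaling the first entry to 1.
  obtain ⟨c, hc⟩ := exists_eval_ne_zero (g * X 0) (mul_ne_zero hg (X_ne_zero _))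
  rw [map_mul, eval_X] at hc
  have hc0 : c 0 ≠ 0 := by
    intro h
    rw [h, map_zero, mul_zero] at hc
    exact hc rfl
  refine ⟨fun s => c s.succ / c 0, fun h => left_ne_zero_of_mul hc ?_⟩
  have h1 : (fun s => algebraMap ℂ K (c s)) = algebraMap ℂ K (c 0) •
      (Fin.cons 1 fun s => algebraMap ℂ K (c s.succ / c 0) : Fin (r + 1) → K) := by
    ext s
    refine Fin.cases ?_ (fun s => ?_) s
    · simp
    · simp only [Pi.smul_apply, Fin.cons_succ, smul_eq_mul]
      rw [← map_mul, mul_div_cancel₀ _ hc0]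
  rw [h1, eval_smul_of_isHomogeneous hgD, h, mul_zero]

/-- A nonzero relation between the linear forms allows one of them to be eliminated. -/
theorem isFiniteOverLin_of_relation {Q : Ideal (MvPolynomial (Fin n) K)}
    {ℓ : Fin (r + 1) → Fin n → ℂ}
    (hint : ∀ i, ((Ideal.Quotient.mk Q).comp (linAeval K ℓ).toRingHom).IsIntegralElem
      (Ideal.Quotient.mk Q (X i)))
    {g : MvPolynomial (Fin (r + 1)) K} (hg : g ≠ 0) (hmem : linAeval K ℓ g ∈ Q) :
    IsFiniteOverLin Q r := by
  have htop : homogeneousComponent g.totalDegree g ≠ 0 := by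
    intro h
    obtain ⟨m, hm, hmD⟩ := Finset.exists_mem_eq_sup g.support
      (support_nonempty.mpr hg) (fun m => m.sum fun _ e => e)
    have hmd : m.degree = g.totalDegree := by
      rw [totalDegree, hmD, Finsupp.degree_apply]; rfl
    have h2 := congrArg (coeff m) h
    rw [coeff_homogeneousComponent, if_pos hmd, coeff_zero] at h2
    exact (mem_support_iff.mp hm) h2
  obtain ⟨c, hc⟩ := exists_cons_one_eval_ne_zero _ htop _ (homogeneousComponent_isHomogeneous _ _)
  set u := eval (Fin.cons 1 fun s => algebraMap ℂ K (c s) : Fin (r + 1) → K)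
    (homogeneousComponent g.totalDegree g) with hu
  have hP := natDegree_le_and_coeff_aeval (fun s => algebraMap ℂ K (c s)) g _ le_rfl
  set w : Fin (r + 1) → Polynomial (MvPolynomial (Fin r) K) :=
    Fin.cons Polynomial.X fun s => Polynomial.C (X s) +
      Polynomial.C (C (algebraMap ℂ K (c s))) * Polynomial.X with hw
  set P := aeval w g with hPdef
  -- After this generic shear the relation `g` becomes a polynomial in the eliminated form `ℓ 0`
  -- whose leading coefficient is the nonzero constant `u`. Hence `ℓ 0` is integral over the `ℓ'`.
  let ℓ' : Fin r → Fin n → ℂ := fun s i => ℓ s.succ i - c s * ℓ 0 i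
  refine ⟨ℓ', ?_⟩
  set f := (Ideal.Quotient.mk Q).comp (linAeval K ℓ).toRingHom with hf
  set f' := (Ideal.Quotient.mk Q).comp (linAeval K ℓ').toRingHom with hf'
  have hlin : ∀ s, linAeval K ℓ' (X s) =
      linAeval K ℓ (X s.succ) - C (algebraMap ℂ K (c s)) * linAeval K ℓ (X 0) := by
    intro s
    simp only [linAeval_X, ℓ', Finset.mul_sum, ← Finset.sum_sub_distrib]
    refine Finset.sum_congr rfl fun i _ => ?_
    rw [map_sub, map_mul, C_sub, C_mul]
    ring
  have heval : (Polynomial.eval₂RingHom f' (f (X 0))).comp (aeval w).toRingHom = f := by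
    ext s
    · simp [hf, hf', linAeval]
    · refine Fin.cases ?_ (fun s => ?_) s
      · simp [hw]
      · have := hlin s
        simp only [hw, RingHom.comp_apply, AlgHom.toRingHom_eq_coe, RingHom.coe_coe, aeval_X,
          Fin.cons_succ, Polynomial.coe_eval₂RingHom, Polynomial.eval₂_add, Polynomial.eval₂_mul,
          Polynomial.eval₂_C, Polynomial.eval₂_X, hf, hf', this]
        simp [linAeval]
  have h0 : f'.IsIntegralElem (f (X 0)) := by
    refine ⟨Polynomial.C (C u⁻¹) * P, ?_, ?_⟩
    · refine Polynomial.monic_of_natDegree_le_of_coeff_eq_one g.totalDegree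
        ((Polynomial.natDegree_C_mul_le _ _).trans hP.1) ?_
      rw [Polynomial.coeff_C_mul, hP.2, ← C_mul, inv_mul_cancel₀ hc, C_1]
    · have h1 : Polynomial.eval₂ f' (f (X 0)) P = f g := congrArg (fun φ => φ g) heval
      rw [Polynomial.eval₂_mul, h1]
      have : f g = 0 := Ideal.Quotient.eq_zero_iff_mem.mpr hmem
      rw [this, mul_zero]
  have hC : ∀ a, f (C a) = f' (C a) := by
    intro a
    simp [hf, hf', linAeval]
  have hall : ∀ p, f'.IsIntegralElem (f p) := by
    intro p
    induction p using MvPolynomial.induction_on with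
    | C a => rw [hC]; exact f'.isIntegralElem_map
    | add p q hp hq => rw [map_add]; exact hp.add f' hq
    | mul_X p s hp =>
      rw [map_mul]
      refine hp.mul f' ?_
      refine Fin.cases h0 (fun s => ?_) s
      have h1 : f (X s.succ) = f' (X s) + f' (C (algebraMap ℂ K (c s))) * f (X 0) := by
        rw [← hC]
        have := hlin s
        simp only [hf, hf', RingHom.comp_apply, AlgHom.toRingHom_eq_coe, RingHom.coe_coe, this]
        simp [linAeval]
      rw [h1]
      exact (f'.isIntegralElem_map).add f' ((f'.isIntegralElem_map).mul f' h0)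
  intro i
  let := f'.toAlgebra
  let g' : MvPolynomial (Fin (r + 1)) K →+*
      integralClosure (MvPolynomial (Fin r) K) (MvPolynomial (Fin n) K ⧸ Q) :=
    f.codRestrict _ hall
  have h2 : IsIntegral (integralClosure (MvPolynomial (Fin r) K) (MvPolynomial (Fin n) K ⧸ Q))
      (Ideal.Quotient.mk Q (X i)) := by
    obtain ⟨p, hp, hp'⟩ := hint i
    refine ⟨p.map g', hp.map _, ?_⟩
    rw [Polynomial.eval₂_map]
    exact hp'
  exact isIntegral_trans (R := MvPolynomial (Fin r) K) _ h2

theorem isIntegralElem_of_forall_X {Q : Ideal (MvPolynomial (Fin n) K)} {ℓ : Fin r → Fin n → ℂ}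
    (hint : ∀ i, ((Ideal.Quotient.mk Q).comp (linAeval K ℓ).toRingHom).IsIntegralElem
      (Ideal.Quotient.mk Q (X i))) (x : MvPolynomial (Fin n) K ⧸ Q) :
    ((Ideal.Quotient.mk Q).comp (linAeval K ℓ).toRingHom).IsIntegralElem x := by
  obtain ⟨x, rfl⟩ := Ideal.Quotient.mk_surjective x
  induction x using MvPolynomial.induction_on with
  | C a =>
    have : Ideal.Quotient.mk Q (C a) =
        ((Ideal.Quotient.mk Q).comp (linAeval K ℓ).toRingHom) (C a) := by simp [linAeval]
    rw [this]
    exact RingHom.isIntegralElem_map _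
  | add p q hp hq => rw [map_add]; exact hp.add _ hq
  | mul_X p s hp => rw [map_mul]; exact hp.mul _ (hint s)

/-- A finite dominant linear projection is surjective on points. -/
theorem exists_zero_over [IsAlgClosed K] {Q : Ideal (MvPolynomial (Fin n) K)}
    {ℓ : Fin r → Fin n → ℂ}
    (hint : ∀ i, ((Ideal.Quotient.mk Q).comp (linAeval K ℓ).toRingHom).IsIntegralElem
      (Ideal.Quotient.mk Q (X i)))
    (hinj : ∀ g, linAeval K ℓ g ∈ Q → g = 0) (e : Fin r → K) :
    ∃ p : Fin n → K, (∀ f ∈ Q, eval p f = 0) ∧ ∀ s, ∑ i, algebraMap ℂ K (ℓ s i) * p i = e s := by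
  set f := (Ideal.Quotient.mk Q).comp (linAeval K ℓ).toRingHom with hf
  let := f.toAlgebra
  have : Algebra.IsIntegral (MvPolynomial (Fin r) K) (MvPolynomial (Fin n) K ⧸ Q) :=
    ⟨fun x => isIntegralElem_of_forall_X hint x⟩
  let 𝔪 : Ideal (MvPolynomial (Fin r) K) := vanishingIdeal K {e}
  have h𝔪 : 𝔪.IsMaximal := isMaximal_iff_eq_vanishingIdeal_singleton.mpr ⟨e, rfl⟩
  -- Lying over gives a maximal ideal above the point `e`; the Nullstellensatz turns it into a point
  -- `p`.
  obtain ⟨𝔫, h𝔫, hcomap⟩ := Ideal.exists_ideal_over_maximal_of_isIntegral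
    (S := MvPolynomial (Fin n) K ⧸ Q) 𝔪 (by
      intro g hg
      have : g = 0 := hinj g (Ideal.Quotient.eq_zero_iff_mem.mp hg)
      rw [this]
      exact zero_mem _)
  have hmax : (𝔫.comap (Ideal.Quotient.mk Q)).IsMaximal :=
    Ideal.comap_isMaximal_of_surjective _ Ideal.Quotient.mk_surjective
  obtain ⟨p, hp⟩ := isMaximal_iff_eq_vanishingIdeal_singleton.mp hmax
  have hmemp : ∀ g, g ∈ 𝔫.comap (Ideal.Quotient.mk Q) → eval p g = 0 := by
    intro g hg
    rw [hp, mem_vanishingIdeal_singleton_iff] at hg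
    simpa using hg
  refine ⟨p, fun g hg => hmemp g ?_, fun s => ?_⟩
  · rw [Ideal.mem_comap, Ideal.Quotient.eq_zero_iff_mem.mpr hg]
    exact zero_mem _
  · have h1 : (X s - C (e s) : MvPolynomial (Fin r) K) ∈ 𝔪 := by
      rw [mem_vanishingIdeal_singleton_iff]
      simp
    rw [← hcomap] at h1
    have h2 := hmemp (linAeval K ℓ (X s - C (e s))) h1
    rw [eval_linAeval] at h2
    simpa [sub_eq_zero] using h2

end Noether

/-! ### Points over relatively algebraically closed subfields -/

section Retraction

variable {K : Type} [Field K] [Algebra ℂ K] {n r : ℕ}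

/-- The additive map `∑ c_m X^m ↦ ∑ π(c_m) p^m`. -/
def twistedEval (π : K →+ K) (p : Fin n → K) : MvPolynomial (Fin n) K →+ K :=
  (Finsupp.liftAddHom fun m : Fin n →₀ ℕ =>
    (AddMonoidHom.mulRight (∏ i, p i ^ m i)).comp π).comp
    (basisMonomials (Fin n) K).repr.toLinearMap.toAddMonoidHom

omit [Algebra ℂ K] in
theorem twistedEval_monomial (π : K →+ K) (p : Fin n → K) (m : Fin n →₀ ℕ) (c : K) :
    twistedEval π p (monomial m c) = π c * ∏ i, p i ^ m i := by
  have h : (basisMonomials (Fin n) K).repr (monomial m c) = Finsupp.single m c := by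
    have h1 : (monomial m 1 : MvPolynomial (Fin n) K) = basisMonomials (Fin n) K m := by simp
    rw [← mul_one c, ← smul_eq_mul, ← smul_monomial, map_smul, h1, Module.Basis.repr_self]
    simp
  simp [twistedEval, h]

/-- Since `π` is only `F`-linear, `twistedEval` is not multiplicative, but it is linear over
polynomials with coefficients in `F`. In particular it kills the ideal generated by such polynomials
vanishing at `p`. -/
theorem twistedEval_mul (F : IntermediateField ℂ K) (π : K →ₗ[F] K) (p : Fin n → K)
    (g : MvPolynomial (Fin n) K) (h : MvPolynomial (Fin n) F) :
    twistedEval π.toAddMonoidHom p (g * MvPolynomial.map (algebraMap F K) h) =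
      twistedEval π.toAddMonoidHom p g * eval p (MvPolynomial.map (algebraMap F K) h) := by
  induction g using MvPolynomial.induction_on' with
  | monomial m c =>
    induction h using MvPolynomial.induction_on' with
    | monomial m' a =>
      rw [map_monomial, monomial_mul, twistedEval_monomial, twistedEval_monomial, eval_monomial,
        Finsupp.prod_fintype _ _ (fun _ => pow_zero _)]
      have : π.toAddMonoidHom (c * algebraMap F K a) =
          algebraMap F K a * π.toAddMonoidHom c := by
        rw [mul_comm, ← Algebra.smul_def]
        change π (a • c) = _
        rw [map_smul, Algebra.smul_def]
        rfl
      rw [this]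
      simp only [Finsupp.add_apply, pow_add, Finset.prod_mul_distrib]
      ring
    | add h h' ih ih' => rw [map_add, mul_add, map_add, ih, ih', map_add, mul_add]
  | add g g' ih ih' => rw [add_mul, map_add, ih, ih', map_add, add_mul]

/-- A zero of polynomials with coefficients in a relatively algebraically closed field `F` has
coordinates in `F` if its image under a finite linear projection has. -/
theorem zero_mem_of_isRelAlgClosed {F : IntermediateField ℂ K} (hF : IsRelAlgClosed F)
    {B : Set (MvPolynomial (Fin n) K)}
    (hB : ∀ b ∈ B, b ∈ (MvPolynomial.map (σ := Fin n) (algebraMap F K)).range)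
    {ℓ : Fin r → Fin n → ℂ}
    (hint : ∀ i, ((Ideal.Quotient.mk (Ideal.span B)).comp (linAeval K ℓ).toRingHom).IsIntegralElem
      (Ideal.Quotient.mk (Ideal.span B) (X i)))
    {p : Fin n → K} (hp : ∀ b ∈ B, eval p b = 0)
    (he : ∀ s, ∑ i, algebraMap ℂ K (ℓ s i) * p i ∈ F) (i : Fin n) : p i ∈ F := by
  classical
  -- The integral equations are given with coefficients in `K` and have to be brought down to `F`.
  -- An `F`-linear retraction of `K` onto `F`, applied to all coefficients, does this.
  obtain ⟨π₀, hπ₀⟩ := (Algebra.linearMap F K).exists_leftInverse_of_injective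
    (LinearMap.ker_eq_bot.mpr (algebraMap F K).injective)
  let π : K →ₗ[F] K := (Algebra.linearMap F K).comp π₀
  have hπF : ∀ a, π a ∈ F := fun a => (π₀ a).2
  have hπ1 : π 1 = 1 := by
    have := congrArg (Algebra.linearMap F K) (LinearMap.congr_fun hπ₀ 1)
    simpa [π] using this
  set Λ := twistedEval π.toAddMonoidHom p with hΛ
  have hspan : ∀ g ∈ Ideal.span B, Λ g = 0 := by
    intro g hg
    induction hg using Submodule.span_induction with
    | mem b hb =>
      obtain ⟨b', rfl⟩ := hB b hb
      have := twistedEval_mul F π p 1 b'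
      rw [one_mul, hp _ hb, mul_zero] at this
      exact this
    | zero => exact map_zero _
    | add x y _ _ hx hy => rw [map_add, hx, hy, add_zero]
    | smul a x hx ih =>
      clear ih
      rw [smul_eq_mul]
      induction hx using Submodule.span_induction generalizing a with
      | mem b hb =>
        obtain ⟨b', rfl⟩ := hB b hb
        rw [hΛ, twistedEval_mul, hp _ hb, mul_zero]
      | zero => rw [mul_zero, map_zero]
      | add x y _ _ hx hy => rw [mul_add, map_add, hx, hy, add_zero]
      | smul c x _ ih => rw [smul_eq_mul, ← mul_assoc]; exact ih _
  -- The forms `ℓ` have complex coefficients and values in `F` at `p`, so only the coefficients of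
  -- `P` are changed by the retraction and the result is a scalar in `F`.
  have hlin : ∀ P : MvPolynomial (Fin r) K, ∃ a ∈ F, ∀ u : MvPolynomial (Fin n) F,
      Λ (linAeval K ℓ P * MvPolynomial.map (algebraMap F K) u) =
        a * eval p (MvPolynomial.map (algebraMap F K) u) := by
    intro P
    induction P using MvPolynomial.induction_on' with
    | monomial m c =>
      let v : MvPolynomial (Fin n) F :=
        ∏ s, (∑ i, C (algebraMap ℂ F (ℓ s i)) * X i) ^ m s
      have hv : linAeval K ℓ (monomial m c) =
          monomial 0 c * MvPolynomial.map (algebraMap F K) v := by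
        simp only [linAeval, aeval_monomial, Finsupp.prod_fintype _ _ (fun _ => pow_zero _), v,
          map_prod, map_pow, map_sum, map_mul, map_C, map_X,
          ← IsScalarTower.algebraMap_apply ℂ F K]
        rfl
      refine ⟨π c * ∏ s, (∑ i, algebraMap ℂ K (ℓ s i) * p i) ^ m s,
        mul_mem (hπF c) (prod_mem fun s _ => pow_mem (he s) _), fun u => ?_⟩
      rw [hv, mul_assoc, ← map_mul, hΛ, twistedEval_mul, twistedEval_monomial, map_mul, map_mul,
        ← mul_assoc]
      congr 1
      have : eval p (MvPolynomial.map (algebraMap F K) v) =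
          ∏ s, (∑ i, algebraMap ℂ K (ℓ s i) * p i) ^ m s := by
        simp only [v, map_prod, map_pow, map_sum, map_mul, map_C, map_X, eval_C, eval_X,
          ← IsScalarTower.algebraMap_apply ℂ F K]
      rw [this]
      simp
    | add P P' hP hP' =>
      obtain ⟨a, ha, hP⟩ := hP
      obtain ⟨a', ha', hP'⟩ := hP'
      exact ⟨a + a', add_mem ha ha', fun u => by
        rw [map_add, add_mul, map_add, hP, hP', add_mul]⟩
  obtain ⟨P, hPm, hP⟩ := hint i
  choose a haF ha using hlin
  have hmem : Polynomial.eval₂ (linAeval K ℓ).toRingHom (X i) P ∈ Ideal.span B := by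
    rw [← Ideal.Quotient.eq_zero_iff_mem, Polynomial.hom_eval₂]
    exact hP
  have h0 := hspan _ hmem
  rw [Polynomial.eval₂_eq_sum_range, map_sum] at h0
  have hterm : ∀ k, Λ ((linAeval K ℓ).toRingHom (P.coeff k) * X i ^ k) =
      a (P.coeff k) * p i ^ k := by
    intro k
    have := ha (P.coeff k) (X i ^ k)
    simpa using this
  simp only [hterm] at h0
  -- The retraction fixes 1, so the transported equation for `p i` remains monic.
  have h1 : a (P.coeff P.natDegree) = 1 := by
    have h3 := ha 1 1
    rw [map_one (linAeval K ℓ), map_one (MvPolynomial.map (algebraMap F K)), mul_one,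
      map_one (eval p), mul_one] at h3
    rw [hPm.coeff_natDegree, ← h3]
    have h2 := twistedEval_monomial π.toAddMonoidHom p 0 1
    simpa [hπ1] using h2
  rw [Finset.sum_range_succ, h1, one_mul] at h0
  apply hF
  have hint : IsIntegral F (p i) := by
    refine ⟨Polynomial.X ^ P.natDegree +
      ∑ k ∈ Finset.range P.natDegree, Polynomial.C (⟨a (P.coeff k), haF _⟩ : F) * Polynomial.X ^ k,
      Polynomial.monic_X_pow_add ?_, ?_⟩
    · refine (Polynomial.degree_sum_le _ _).trans_lt ?_
      rw [Finset.sup_lt_iff (by simp [bot_lt_iff_ne_bot])]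
      intro k hk
      exact (Polynomial.degree_C_mul_X_pow_le _ _).trans_lt
        (by exact_mod_cast Finset.mem_range.mp hk)
    · rw [Polynomial.eval₂_add, Polynomial.eval₂_pow, Polynomial.eval₂_X,
        Polynomial.eval₂_finsetSum, add_comm]
      simpa using h0
  exact hint.isAlgebraic

end Retraction

/-! ### Solutions of linear systems -/

section LinearSystem

variable {K : Type} [Field K] [Algebra ℂ K]

/-- The solutions of a linear system of rank at least `c` in `τ` unknowns are determined by
`|τ| - c` of the unknowns. -/
theorem exists_finset_forall_mem {τ : Type} [Fintype τ] [DecidableEq τ]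
    (F₀ : IntermediateField ℂ K) (E : Set (τ → F₀)) (c : ℕ)
    (hc : c ≤ Module.finrank F₀ (Submodule.span F₀ E)) :
    ∃ D : Finset τ, D.card + c ≤ Fintype.card τ ∧
      ∀ v : τ → K, (∀ a ∈ E, ∑ i, (a i : K) * v i = 0) →
        ∀ F : IntermediateField ℂ K, F₀ ≤ F → (∀ i ∈ D, v i ∈ F) → ∀ i, v i ∈ F := by
  set W := Submodule.span F₀ E with hW
  -- The free unknowns are those whose unit vectors form a basis of the quotient by the span of the
  -- equations.
  let b : τ → (τ → F₀) ⧸ W := fun i => W.mkQ (Pi.single i 1)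
  obtain ⟨κ, e, he, hspan, hli⟩ := exists_linearIndependent' F₀ b
  have : Finite κ := Finite.of_injective e he
  have := Fintype.ofFinite κ
  have hb : Submodule.span F₀ (Set.range b) = ⊤ := by
    have h1 : Set.range b = W.mkQ '' Set.range fun i : τ => (Pi.single i 1 : τ → F₀) := by
      rw [← Set.range_comp]; rfl
    rw [h1, Submodule.span_image]
    have := (Pi.basisFun F₀ τ).span_eq
    have h2 : (⇑(Pi.basisFun F₀ τ)) = fun i : τ => (Pi.single i 1 : τ → F₀) := by
      ext i; simp
    rw [h2] at this
    rw [this, Submodule.map_top]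
    simp
  refine ⟨Finset.univ.image e, ?_, ?_⟩
  · rw [Finset.card_image_of_injective _ he, Finset.card_univ]
    have h1 := hli.fintype_card_le_finrank
    have h2 := W.finrank_quotient_add_finrank
    rw [Module.finrank_fintype_fun_eq_card] at h2
    omega
  · intro v hv F hF hvF i
    have hvF' : ∀ j, v (e j) ∈ F := fun j => hvF _ (Finset.mem_image_of_mem _ (Finset.mem_univ _))
    have hi : b i ∈ Submodule.span F₀ (Set.range (b ∘ e)) := by
      rw [hspan, hb]; trivial
    obtain ⟨μ, hμ⟩ := (Submodule.mem_span_range_iff_exists_fun F₀).mp hi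
    have hmem : (Pi.single i 1 - ∑ j, μ j • Pi.single (e j) 1 : τ → F₀) ∈ W := by
      rw [← Submodule.ker_mkQ W, LinearMap.mem_ker, map_sub, map_sum, sub_eq_zero]
      simp only [map_smul]
      exact hμ.symm
    let φ : (τ → F₀) →ₗ[F₀] K :=
      ∑ i, (LinearMap.toSpanSingleton F₀ K (v i)).comp (LinearMap.proj i)
    have hφ : ∀ a, φ a = ∑ i, (a i : K) * v i := by
      intro a
      simp [φ, Algebra.smul_def]
    have hker : W ≤ LinearMap.ker φ := by
      rw [hW, Submodule.span_le]
      intro a ha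
      rw [SetLike.mem_coe, LinearMap.mem_ker, hφ]
      exact hv a ha
    have h0 : φ (Pi.single i 1 - ∑ j, μ j • Pi.single (e j) 1) = 0 := hker hmem
    have hs : ∀ j, φ (Pi.single j 1) = v j := by
      intro j
      rw [hφ, Finset.sum_eq_single j]
      · simp
      · intro k _ hk; simp [hk]
      · simp
    rw [map_sub, map_sum, hs, sub_eq_zero] at h0
    rw [h0]
    refine sum_mem fun j _ => ?_
    rw [map_smul, hs, Algebra.smul_def]
    exact mul_mem (hF (μ j).2) (hvF' j)

end LinearSystem

/-! ### Linear conditions on the first component that fails to drop the dimension. -/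

section Determined

variable {K : Type} [Field K] [Algebra ℂ K] {n r : ℕ}

/-- The vectors of degree `j` monomials at points that project onto all of `ℂ^r` span a space
of dimension at least the number of monomials of degree `j` in `r` variables. -/
theorem card_mon_le_finrank_span (ℓ : Fin r → Fin n → ℂ) (j : ℕ) (Z : Set (Fin n → K))
    (hZ : ∀ e : Fin r → ℂ, ∃ p ∈ Z, ∀ s, ∑ i, algebraMap ℂ K (ℓ s i) * p i = algebraMap ℂ K (e s)) :
    (mon r j).card ≤ Module.finrank K (Submodule.span K
      ((fun p (m : mon n j) => ∏ i, p i ^ m.1 i) '' Z)) := by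
  classical
  set E := (fun (p : Fin n → K) (m : mon n j) => ∏ i, p i ^ m.1 i) '' Z with hE
  let L : (mon r j → K) →ₗ[K] MvPolynomial (Fin r) K :=
    ∑ m' : mon r j, (monomial m'.1).comp (LinearMap.proj m')
  have hL : ∀ γ, L γ = ∑ m' : mon r j, monomial m'.1 (γ m') := fun γ => by simp [L]
  have hLh : ∀ γ, (L γ).IsHomogeneous j := fun γ => by
    rw [hL]
    refine IsHomogeneous.sum _ _ _ fun m' _ => isHomogeneous_monomial _ (mem_mon.mp m'.2)
  have hLc : ∀ γ m', coeff m'.1 (L γ) = γ m' := fun γ m' => by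
    rw [hL, coeff_sum, Finset.sum_eq_single m']
    · simp
    · intro b _ hb
      rw [coeff_monomial, if_neg fun h => hb (Subtype.ext h)]
    · simp
  let Φ : MvPolynomial (Fin n) K →ₗ[K] Module.Dual K (mon n j → K) :=
    LinearMap.mk₂ K (fun g a => ∑ m : mon n j, coeff m.1 g * a m)
      (fun g g' a => by simp [add_mul, Finset.sum_add_distrib])
      (fun c g a => by simp [Finset.mul_sum, mul_assoc])
      (fun g a a' => by simp [mul_add, Finset.sum_add_distrib])
      (fun c g a => by
        simp only [Pi.smul_apply, smul_eq_mul, Finset.mul_sum]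
        exact Finset.sum_congr rfl fun _ _ => by ring)
  -- Forms of degree `j` in `r` variables, pulled back along the projection, are functionals on the
  -- span of the monomial vectors. This is faithful: a nonzero form is nonzero at some complex
  -- point, and `Z` has a point above it.
  let Θ : (mon r j → K) →ₗ[K] Module.Dual K (Submodule.span K E) :=
    ((Submodule.span K E).subtype.dualMap.comp Φ).comp ((linAeval K ℓ).toLinearMap.comp L)
  have hΘ : ∀ γ (p) (hp : p ∈ Z), Θ γ ⟨_, Submodule.subset_span (Set.mem_image_of_mem _ hp)⟩ =
      eval p (linAeval K ℓ (L γ)) := by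
    intro γ p hp
    have hh : (linAeval K ℓ (L γ)).IsHomogeneous j := by
      have := (hLh γ).aeval (fun s => ∑ i, C (algebraMap ℂ K (ℓ s i)) * X i : Fin r → _)
        (n := 1) (fun s => IsHomogeneous.sum _ _ _ fun i _ => by
          simpa using (isHomogeneous_C (Fin n) (algebraMap ℂ K (ℓ s i))).mul (isHomogeneous_X K i))
      rwa [one_mul] at this
    rw [eval_eq_sum_mon hh, ← Finset.sum_coe_sort]
    rfl
  have hinj : Function.Injective Θ := by
    rw [← LinearMap.ker_eq_bot, LinearMap.ker_eq_bot']
    intro γ hγ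
    have h0 : L γ = 0 := by
      by_contra hne
      obtain ⟨e, he⟩ := exists_eval_ne_zero _ hne
      obtain ⟨p, hp, hpe⟩ := hZ e
      apply he
      have := hΘ γ p hp
      rw [hγ, eval_linAeval] at this
      simp only [hpe] at this
      exact this.symm
    ext m'
    rw [← hLc γ m', h0]
    simp
  have h1 := LinearMap.finrank_le_finrank_of_injective hinj
  rw [Module.finrank_fintype_fun_eq_card, Subspace.dual_finrank_eq, Fintype.card_coe] at h1
  exact h1

/-- The members of a family with index between `2` and `k`. -/
def truncation (q : ℕ → MvPolynomial (Fin n) K) (k : ℕ) : Set (MvPolynomial (Fin n) K) :=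
  {f | ∃ i, 2 ≤ i ∧ i ≤ k ∧ f = q i}

omit [Algebra ℂ K] in
theorem truncation_mono (q : ℕ → MvPolynomial (Fin n) K) {k k' : ℕ} (h : k ≤ k') :
    truncation q k ⊆ truncation q k' :=
  fun _ ⟨i, h2, hi, hf⟩ => ⟨i, h2, hi.trans h, hf⟩

theorem isFiniteOverLin_bot : IsFiniteOverLin (⊥ : Ideal (MvPolynomial (Fin n) K)) n := by
  classical
  refine ⟨fun s => Pi.single s 1, fun i => ?_⟩
  have h : linAeval K (fun s : Fin n => (Pi.single s 1 : Fin n → ℂ)) (X i) = X i := by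
    rw [linAeval_X, Finset.sum_eq_single i]
    · simp
    · intro b _ hb; simp [hb]
    · simp
  have h2 := RingHom.isIntegralElem_map ((Ideal.Quotient.mk (⊥ : Ideal (MvPolynomial (Fin n) K))).comp
    (linAeval K (fun s : Fin n => (Pi.single s 1 : Fin n → ℂ))).toRingHom) (x := X i)
  have h3 : ((Ideal.Quotient.mk (⊥ : Ideal (MvPolynomial (Fin n) K))).comp
    (linAeval K (fun s : Fin n => (Pi.single s 1 : Fin n → ℂ))).toRingHom) (X i) =
      Ideal.Quotient.mk _ (X i) := by
    rw [RingHom.comp_apply, AlgHom.toRingHom_eq_coe, RingHom.coe_coe, h]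
  rwa [h3] at h2

/-- If homogeneous polynomials `q_2, …, q_k` do not cut out a subscheme of the expected dimension,
then all coefficients of some `q_j` are algebraic over those of `q_2, …, q_{j-1}` and a few
coefficients of `q_j`. -/
theorem exists_determined_component [IsAlgClosed K] (q : ℕ → MvPolynomial (Fin n) K)
    (hq : ∀ i, (q i).IsHomogeneous i) {k : ℕ} (hk1 : 1 ≤ k) (hk : k ≤ n + 1)
    (hnot : ¬ IsFiniteOverLin (Ideal.span (truncation q k)) (n + 1 - k)) :
    ∃ j, 2 ≤ j ∧ j ≤ k ∧ ∃ D ⊆ mon n j, D.card + (mon (n + 2 - j) j).card ≤ (mon n j).card ∧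
      ∀ F : IntermediateField ℂ K, IsRelAlgClosed F →
        (∀ i, 2 ≤ i → i < j → ∀ m, coeff m (q i) ∈ F) → (∀ m ∈ D, coeff m (q j) ∈ F) →
          ∀ m, coeff m (q j) ∈ F := by
  classical
  -- The expected dimension for `q_2, …, q_j` is `n - (j - 1)`. The first failure has `j ≥ 2`,
  -- because for `j = 1` there are no equations.
  have hex : ∃ j, 1 ≤ j ∧ ¬ IsFiniteOverLin (Ideal.span (truncation q j)) (n + 1 - j) :=
    ⟨k, hk1, hnot⟩
  obtain ⟨hj1, hj⟩ := Nat.find_spec hex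
  have hjk : Nat.find hex ≤ k := Nat.find_min' hex ⟨hk1, hnot⟩
  have hmin : ∀ i < Nat.find hex, ¬ (1 ≤ i ∧ ¬ IsFiniteOverLin (Ideal.span (truncation q i))
    (n + 1 - i)) := fun i hi => Nat.find_min hex hi
  generalize Nat.find hex = j at hj1 hj hjk hmin
  have hj2 : 2 ≤ j := by
    rcases Nat.lt_or_ge j 2 with h | h
    · exfalso
      obtain rfl : j = 1 := by omega
      apply hj
      have : truncation q 1 = ∅ := Set.eq_empty_of_forall_notMem fun f ⟨i, h2, hi, _⟩ => by omega
      rw [this, Ideal.span_empty]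
      exact isFiniteOverLin_bot
    · exact h
  have hprev : IsFiniteOverLin (Ideal.span (truncation q (j - 1))) (n + 1 - j + 1) := by
    have := hmin (j - 1) (by omega)
    push Not at this
    have := this (by omega)
    rwa [show n + 1 - (j - 1) = n + 1 - j + 1 by omega] at this
  obtain ⟨ℓ, hℓ⟩ := hprev
  have hint := fun i => isIntegralElem_mono
    (Ideal.span_mono (truncation_mono q (Nat.sub_le j 1))) (hℓ i)
  -- If the forms satisfied a relation on the zero set of `q_2, …, q_j`, one form could be
  -- eliminated, against the choice of `j`. So this zero set projects onto the whole affine space.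
  have hinj : ∀ g, linAeval K ℓ g ∈ Ideal.span (truncation q j) → g = 0 := by
    intro g hg
    by_contra hne
    exact hj (isFiniteOverLin_of_relation hint hne hg)
  let F₀ : IntermediateField ℂ K :=
    relAlgClosure (k := ℂ) {x | ∃ i m, 2 ≤ i ∧ i < j ∧ x = coeff m (q i)}
  let Z : Set (Fin n → F₀) :=
    {p | ∀ f ∈ Ideal.span (truncation q j), eval (fun i => (p i : K)) f = 0}
  have hZ : ∀ e : Fin (n + 1 - j + 1) → ℂ, ∃ p ∈ Z,
      ∀ s, ∑ i, algebraMap ℂ F₀ (ℓ s i) * p i = algebraMap ℂ F₀ (e s) := by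
    intro e
    obtain ⟨p, hp, hpe⟩ := exists_zero_over hint hinj fun s => algebraMap ℂ K (e s)
    -- Only `q_2, …, q_{j-1}` are used here, and they are already finite over `ℓ`. Thus the linear
    -- equations imposed by `p` on the coefficients of `q_j` have coefficients that do not involve
    -- `q_j`.
    have hpF : ∀ i, p i ∈ F₀ := by
      refine zero_mem_of_isRelAlgClosed (isRelAlgClosed_relAlgClosure _) ?_ hℓ (fun b hb => ?_)
        (fun s => ?_)
      · rintro b ⟨i, hi2, hij, rfl⟩
        change q i ∈ Set.range _
        rw [mem_range_map_iff_coeffs_subset]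
        intro x hx
        obtain ⟨m, _, rfl⟩ := mem_coeffs_iff.mp hx
        exact ⟨⟨_, subset_relAlgClosure _ ⟨i, m, hi2, by omega, rfl⟩⟩, rfl⟩
      · exact hp b (Ideal.subset_span (truncation_mono q (Nat.sub_le j 1) hb))
      · rw [hpe]; exact F₀.algebraMap_mem _
    refine ⟨fun i => ⟨p i, hpF i⟩, hp, fun s => Subtype.ext ?_⟩
    have := hpe s
    simpa using this
  have hrank := card_mon_le_finrank_span ℓ j Z hZ
  obtain ⟨D, hD, hDF⟩ := exists_finset_forall_mem F₀ _ _ hrank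
  refine ⟨j, hj2, hjk, D.map (Function.Embedding.subtype _), ?_, ?_, ?_⟩
  · intro m hm
    obtain ⟨m', _, rfl⟩ := Finset.mem_map.mp hm
    exact m'.2
  · rw [Finset.card_map, show n + 2 - j = n + 1 - j + 1 by omega]
    rwa [Fintype.card_coe] at hD
  · intro F hF hFi hFD m
    by_cases hm : m ∈ mon n j
    · refine hDF (fun m => coeff m.1 (q j)) ?_ F (relAlgClosure_le hF ?_) ?_ ⟨m, hm⟩
      · rintro _ ⟨p, hp, rfl⟩
        have := hp (q j) (Ideal.subset_span ⟨j, hj2, le_rfl, rfl⟩)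
        rw [eval_eq_sum_mon (hq j), ← Finset.sum_coe_sort] at this
        rw [← this]
        refine Finset.sum_congr rfl fun m _ => ?_
        simp [mul_comm]
      · rintro _ ⟨i, m, hi2, hij, rfl⟩
        exact hFi i hi2 hij m
      · intro m' hm'
        exact hFD _ (Finset.mem_map_of_mem _ hm')
    · rw [(hq j).coeff_eq_zero (fun h => hm (mem_mon.mpr h))]
      exact F.zero_mem

end Determined

/-! ### Specialisation of function-valued polynomials -/

section Specialisation

variable {Y K : Type} [Field K] [Algebra ℂ K] {n r : ℕ}

/-- Without a common zero the sum of the squared absolute values would be invertible, yet it is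
killed by `φ`. -/
theorem exists_common_zero (φ : (Y → ℂ) →ₐ[ℂ] K) (S : Finset (Y → ℂ)) (hS : ∀ s ∈ S, φ s = 0) :
    ∃ y, ∀ s ∈ S, s y = 0 := by
  by_contra hcon
  push Not at hcon
  let u : Y → ℂ := ∑ s ∈ S, s * star s
  have hu : ∀ y, u y ≠ 0 := by
    intro y
    obtain ⟨s, hs, hsy⟩ := hcon y
    have h1 : u y = ((∑ s ∈ S, Complex.normSq (s y) : ℝ) : ℂ) := by
      simp [u, Complex.mul_conj]
    rw [h1, Complex.ofReal_ne_zero]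
    exact (Finset.sum_pos' (f := fun s : Y → ℂ => Complex.normSq (s y))
      (fun s _ => Complex.normSq_nonneg _)
      ⟨s, hs, Complex.normSq_pos.mpr hsy⟩).ne'
  have h1 : u * u⁻¹ = 1 := funext fun y => mul_inv_cancel₀ (hu y)
  have h2 : φ u = 0 := by
    simp only [u, map_sum, map_mul]
    exact Finset.sum_eq_zero fun s hs => by rw [hS s hs, zero_mul]
  have h3 := congrArg φ h1
  rw [map_mul, h2, zero_mul, map_one] at h3
  exact zero_ne_one h3

/-- A monic polynomial over `K` lifts to a monic one over functions, and roots chosen point by point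
form a function. -/
theorem isAlgClosed_of_surjective (φ : (Y → ℂ) →ₐ[ℂ] K) (hφ : Function.Surjective φ) :
    IsAlgClosed K := by
  refine IsAlgClosed.of_exists_root K fun p hp hirr => ?_
  obtain ⟨P, hP, hdeg, hmon⟩ := Polynomial.lifts_and_natDegree_eq_and_monic
    (f := (φ : (Y → ℂ) →+* K)) ((Polynomial.lifts_iff_coeff_lifts _).mpr fun k => hφ _) hp
  have hroot : ∀ y, ∃ z, (P.map (Pi.evalRingHom (fun _ => ℂ) y)).eval z = 0 := by
    intro y
    refine IsAlgClosed.exists_root _ ?_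
    have h := hmon.degree_map (Pi.evalRingHom (fun _ => ℂ) y)
    have : Nontrivial (Y → ℂ) := ⟨0, 1, fun h => zero_ne_one (congrFun h y)⟩
    rw [h, Polynomial.degree_eq_natDegree hmon.ne_zero, hdeg]
    exact_mod_cast hirr.natDegree_pos.ne'
  choose z hz using hroot
  have hPz : P.eval z = 0 := by
    ext y
    have h1 := hz y
    rw [Polynomial.eval_map] at h1
    exact (Polynomial.hom_eval₂ P (RingHom.id _) (Pi.evalRingHom (fun _ => ℂ) y) z).trans h1
  refine ⟨φ z, ?_⟩
  rw [← hP, Polynomial.eval_map]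
  have h2 := congrArg (φ : (Y → ℂ) →+* K) hPz
  rw [Polynomial.eval, Polynomial.hom_eval₂, map_zero] at h2
  exact h2

theorem map_linAeval {R R' : Type} [CommRing R] [CommRing R'] [Algebra ℂ R] [Algebra ℂ R']
    (ψ : R →ₐ[ℂ] R') (ℓ : Fin r → Fin n → ℂ) (g : MvPolynomial (Fin r) R) :
    MvPolynomial.map (ψ : R →+* R') (linAeval R ℓ g) =
      linAeval R' ℓ (MvPolynomial.map (ψ : R →+* R') g) := by
  induction g using MvPolynomial.induction_on with
  | C a => simp [linAeval]
  | add g g' h h' => simp only [map_add, h, h']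
  | mul_X g s h => rw [map_mul, map_mul, h, map_mul, map_mul]; simp [linAeval]

omit [Algebra ℂ K] in
theorem mem_span_truncation (q : ℕ → MvPolynomial (Fin n) K) (k : ℕ) (f : MvPolynomial (Fin n) K) :
    f ∈ Ideal.span (truncation q k) ↔ ∃ h : ℕ → MvPolynomial (Fin n) K,
      f = ∑ i ∈ Finset.Icc 2 k, h i * q i := by
  have h1 : truncation q k = q '' (Finset.Icc 2 k : Finset ℕ) := by
    ext f
    simp only [truncation, Set.mem_ofPred_eq, Set.mem_image, Finset.coe_Icc, Set.mem_Icc]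
    exact ⟨fun ⟨i, h2, hk, hf⟩ => ⟨i, ⟨h2, hk⟩, hf.symm⟩, fun ⟨i, ⟨h2, hk⟩, hf⟩ => ⟨i, h2, hk, hf.symm⟩⟩
  rw [h1, Ideal.span, Submodule.mem_span_image_finset_iff_exists_fun]
  constructor
  · rintro ⟨c, rfl⟩
    refine ⟨fun i => if h : i ∈ Finset.Icc 2 k then c ⟨i, h⟩ else 0, ?_⟩
    rw [Finset.sum_subtype (Finset.Icc 2 k) (p := (· ∈ Finset.Icc 2 k)) (fun _ => Iff.rfl)]
    exact Finset.sum_congr rfl fun i _ => by dsimp only; rw [dif_pos i.2]; rfl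
  · rintro ⟨h, rfl⟩
    refine ⟨fun i => h i.1, ?_⟩
    rw [Finset.sum_subtype (Finset.Icc 2 k) (p := (· ∈ Finset.Icc 2 k)) (fun _ => Iff.rfl)]
    rfl

/-- Finiteness over linear forms at the generic point spreads out to some closed point. -/
theorem not_isFiniteOverLin_of_forall (φ : (Y → ℂ) →ₐ[ℂ] K) (hφ : Function.Surjective φ)
    (q : ℕ → MvPolynomial (Fin n) (Y → ℂ)) (k : ℕ)
    (h : ∀ y, ¬ IsFiniteOverLin (Ideal.span (truncation
      (fun i => MvPolynomial.map (Pi.evalAlgHom ℂ (fun _ : Y => ℂ) y : (Y → ℂ) →+* ℂ) (q i)) k)) r) :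
    ¬ IsFiniteOverLin (Ideal.span (truncation
      (fun i => MvPolynomial.map (φ : (Y → ℂ) →+* K) (q i)) k)) r := by
  classical
  rintro ⟨ℓ, hℓ⟩
  have hsurj : ∀ ν : Type, Function.Surjective (MvPolynomial.map (σ := ν) (φ : (Y → ℂ) →+* K)) :=
    fun ν => MvPolynomial.map_surjective _ hφ
  have hlift : ∀ i, ∃ (P : Polynomial (MvPolynomial (Fin r) (Y → ℂ)))
      (u : ℕ → MvPolynomial (Fin n) (Y → ℂ)), P.Monic ∧
      MvPolynomial.map (φ : (Y → ℂ) →+* K)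
        (Polynomial.eval₂ (linAeval (Y → ℂ) ℓ).toRingHom (X i) P -
          ∑ t ∈ Finset.Icc 2 k, u t * q t) = 0 := by
    intro i
    obtain ⟨P, hPm, hP⟩ := hℓ i
    rw [← Polynomial.hom_eval₂, Ideal.Quotient.eq_zero_iff_mem, mem_span_truncation] at hP
    obtain ⟨u, hu⟩ := hP
    obtain ⟨P', hP', -, hmon⟩ := Polynomial.lifts_and_natDegree_eq_and_monic
      (f := MvPolynomial.map (σ := Fin r) (φ : (Y → ℂ) →+* K))
      ((Polynomial.lifts_iff_coeff_lifts _).mpr fun k => hsurj _ _) hPm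
    choose u' hu' using fun t => hsurj (Fin n) (u t)
    refine ⟨P', u', hmon, ?_⟩
    rw [map_sub, Polynomial.hom_eval₂, map_sum, sub_eq_zero]
    simp only [map_mul, hu', ← hu]
    rw [← hP', Polynomial.eval₂_map]
    congr 1
    · exact RingHom.ext fun g => map_linAeval φ ℓ g
    · simp
  choose P u hPm hPu using hlift
  let δ : Fin n → MvPolynomial (Fin n) (Y → ℂ) := fun i =>
    Polynomial.eval₂ (linAeval (Y → ℂ) ℓ).toRingHom (X i) (P i) - ∑ t ∈ Finset.Icc 2 k, u i t * q t
  -- The lifted integrality certificates differ from true ones by finitely many coefficient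
  -- functions, all zero in `K`, so they become true at some point `y`. The complex forms `ℓ` do not
  -- change under specialisation.
  obtain ⟨y, hy⟩ := exists_common_zero φ
    (Finset.univ.biUnion fun i => (δ i).support.image fun m => coeff m (δ i)) (by
      intro s hs
      simp only [Finset.mem_biUnion, Finset.mem_image] at hs
      obtain ⟨i, -, m, -, rfl⟩ := hs
      have := congrArg (coeff m) (hPu i)
      rwa [coeff_map, coeff_zero] at this)
  refine h y ⟨ℓ, fun i => ?_⟩
  have hδ : MvPolynomial.map (Pi.evalAlgHom ℂ (fun _ : Y => ℂ) y : (Y → ℂ) →+* ℂ) (δ i) = 0 := by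
    ext m
    rw [coeff_map, coeff_zero]
    by_cases hm : m ∈ (δ i).support
    · exact hy _ (Finset.mem_biUnion.mpr ⟨i, Finset.mem_univ _, Finset.mem_image_of_mem _ hm⟩)
    · rw [notMem_support_iff.mp hm]; rfl
  refine ⟨(P i).map (MvPolynomial.map (Pi.evalAlgHom ℂ (fun _ : Y => ℂ) y : (Y → ℂ) →+* ℂ)),
    (hPm i).map _, ?_⟩
  rw [← Polynomial.hom_eval₂, Ideal.Quotient.eq_zero_iff_mem, mem_span_truncation]
  refine ⟨fun t => MvPolynomial.map (Pi.evalAlgHom ℂ (fun _ : Y => ℂ) y : (Y → ℂ) →+* ℂ) (u i t), ?_⟩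
  rw [map_sub, Polynomial.hom_eval₂, map_sum, sub_eq_zero] at hδ
  simp only [map_mul] at hδ
  rw [← hδ, Polynomial.eval₂_map]
  congr 1
  · exact RingHom.ext fun g => (map_linAeval (Pi.evalAlgHom ℂ (fun _ : Y => ℂ) y) ℓ g).symm
  · simp

end Specialisation

/-! ### Generic dimension count -/

section Count

variable {Y K σ : Type} [Field K] [Algebra ℂ K] [Fintype σ] {n : ℕ}

/-- Let `g y = G₀ y + ∑ x_s(y) G_s(y)` be a family of polynomials depending on parameters `Π`
and coordinates `x_s`, where `G_{e m}` is the monomial with exponent `m`. If the linear part of `g y`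
vanishes and the components of degrees `2, …, k` do not cut out a subscheme of the expected dimension
for any `y`, then the coordinates and parameters at a generic point are algebraic over
few of them. -/
theorem exists_small_generating_set (φ : (Y → ℂ) →ₐ[ℂ] K) (hφ : Function.Surjective φ)
    (x : σ → Y → ℂ) (g : Y → MvPolynomial (Fin n) ℂ) (G₀ : Y → MvPolynomial (Fin n) ℂ)
    (G : σ → Y → MvPolynomial (Fin n) ℂ) (hg : ∀ y, g y = G₀ y + ∑ s, C (x s y) * G s y)
    (δ : σ → ℕ) (hδ : ∀ s y, (G s y).IsHomogeneous (δ s)) (par : Finset (Y → ℂ))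
    (hG₀ : ∀ m, (fun y => coeff m (G₀ y)) ∈ Algebra.adjoin ℂ (par : Set (Y → ℂ)))
    (hG : ∀ s m, (fun y => coeff m (G s y)) ∈ Algebra.adjoin ℂ (par : Set (Y → ℂ)))
    (k : ℕ) (hk1 : 2 ≤ k) (hk : k ≤ n + 1)
    (e : (Fin n →₀ ℕ) → σ) (he : Set.InjOn e {m | 1 ≤ m.degree ∧ m.degree ≤ k})
    (heδ : ∀ m, 1 ≤ m.degree → m.degree ≤ k → δ (e m) = m.degree)
    (heG : ∀ m, 1 ≤ m.degree → m.degree ≤ k → ∀ y, G (e m) y = monomial m 1)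
    (Zr : Finset σ) (hZr : ∀ s ∈ Zr, x s = 0)
    (hZre : ∀ m, 1 ≤ m.degree → m.degree ≤ k → e m ∉ Zr)
    (hlin : ∀ y, homogeneousComponent 1 (g y) = 0)
    (hnot : ∀ y, ¬ IsFiniteOverLin (Ideal.span (truncation
      (fun i => homogeneousComponent i (g y)) k)) (n + 1 - k))
    (c : ℕ) (hc : ∀ j, 2 ≤ j → j ≤ k → c + par.card ≤ (mon (n + 2 - j) j).card + Zr.card + (mon n 1).card) :
    ∃ T : Finset K, T.card + c ≤ Fintype.card σ ∧
      ∀ F : IntermediateField ℂ K, IsRelAlgClosed F → (T : Set K) ⊆ F → ∀ s, φ (x s) ∈ F := by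
  classical
  have hK := isAlgClosed_of_surjective φ hφ
  let q : ℕ → MvPolynomial (Fin n) (Y → ℂ) := fun i =>
    ∑ m ∈ mon n i, monomial m fun y => coeff m (g y)
  have hqc : ∀ i m, coeff m (q i) = if m ∈ mon n i then fun y => coeff m (g y) else 0 := by
    intro i m
    simp only [q, coeff_sum, coeff_monomial]
    rw [Finset.sum_ite_eq' (mon n i) m]
  have hqh : ∀ i, (q i).IsHomogeneous i := fun i =>
    IsHomogeneous.sum _ _ _ fun m hm => isHomogeneous_monomial _ (mem_mon.mp hm)
  have hqy : ∀ y i, MvPolynomial.map (Pi.evalAlgHom ℂ (fun _ : Y => ℂ) y : (Y → ℂ) →+* ℂ) (q i) =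
      homogeneousComponent i (g y) := by
    intro y i
    ext m
    rw [coeff_map, hqc, coeff_homogeneousComponent]
    by_cases hm : m ∈ mon n i
    · rw [if_pos hm, if_pos (mem_mon.mp hm)]; rfl
    · rw [if_neg hm, if_neg (fun h => hm (mem_mon.mpr h))]; rfl
  have hnotK := not_isFiniteOverLin_of_forall φ hφ q k (fun y => by simp only [hqy]; exact hnot y)
  obtain ⟨j, hj2, hjk, D, hD, hDcard, hdet⟩ := exists_determined_component
    (fun i => MvPolynomial.map (φ : (Y → ℂ) →+* K) (q i)) (fun i => (hqh i).map _)
    (by omega) hk hnotK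
  have hqK : ∀ i m, coeff m (MvPolynomial.map (φ : (Y → ℂ) →+* K) (q i)) =
      if m ∈ mon n i then φ (fun y => coeff m (g y)) else 0 := by
    intro i m
    rw [coeff_map, hqc]
    split_ifs
    · rfl
    · exact map_zero _
  -- The coordinates that may be omitted: those that vanish identically, those recovered from the
  -- vanishing of the linear part, and those recovered from the linear conditions in degree `j`.
  set U : Finset σ := Zr ∪ (mon n 1).image e ∪ (mon n j \ D).image e with hU
  have hmem1 : ∀ m ∈ mon n 1, 1 ≤ m.degree ∧ m.degree ≤ k := fun m hm => by
    rw [mem_mon.mp hm]; omega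
  have hmemj : ∀ m ∈ mon n j, 1 ≤ m.degree ∧ m.degree ≤ k := fun m hm => by
    rw [mem_mon.mp hm]; omega
  have hUcard : U.card = Zr.card + (mon n 1).card + ((mon n j).card - D.card) := by
    rw [hU, Finset.card_union_of_disjoint, Finset.card_union_of_disjoint,
      Finset.card_image_of_injOn (he.mono fun m hm => hmem1 m hm),
      Finset.card_image_of_injOn (he.mono fun m hm => hmemj m (Finset.sdiff_subset hm)),
      Finset.card_sdiff_of_subset hD]
    · rw [Finset.disjoint_left]
      intro s hs hs'
      obtain ⟨m, hm, rfl⟩ := Finset.mem_image.mp hs'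
      exact hZre m (hmem1 m hm).1 (hmem1 m hm).2 hs
    · rw [Finset.disjoint_left]
      intro s hs hs'
      obtain ⟨m, hm, rfl⟩ := Finset.mem_image.mp hs'
      have hm := hmemj m (Finset.sdiff_subset hm)
      rcases Finset.mem_union.mp hs with h | h
      · exact hZre m hm.1 hm.2 h
      · obtain ⟨m', hm', heq⟩ := Finset.mem_image.mp h
        have h1 := he (hmem1 m' hm') hm heq
        have h2 := mem_mon.mp hm'
        have h3 := mem_mon.mp (Finset.sdiff_subset (Finset.mem_image.mp hs').choose_spec.1)
        have h4 := heδ m' (hmem1 m' hm').1 (hmem1 m' hm').2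
        have h5 := (Finset.mem_image.mp hs').choose_spec
        have h6 := he (hmemj _ (Finset.sdiff_subset h5.1)) hm h5.2
        rw [h6] at h3
        rw [h1] at h2
        omega
  refine ⟨par.image φ ∪ (Finset.univ \ U).image fun s => φ (x s), ?_, ?_⟩
  · have h1 := Finset.card_union_le (par.image φ) ((Finset.univ \ U).image fun s => φ (x s))
    have h2 : (par.image φ).card ≤ par.card := Finset.card_image_le
    have h3 : ((Finset.univ \ U).image fun s => φ (x s)).card ≤ (Finset.univ \ U).card :=
      Finset.card_image_le
    have h4 := Finset.card_sdiff_add_card_eq_card (Finset.subset_univ U)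
    rw [Finset.card_univ] at h4
    have h5 := hc j hj2 hjk
    have h6 := Finset.card_le_card hD
    omega
  · intro F hF hT
    have hpar : ∀ u ∈ Algebra.adjoin ℂ (par : Set (Y → ℂ)), φ u ∈ F := by
      have h1 : Algebra.adjoin ℂ (par : Set (Y → ℂ)) ≤ F.toSubalgebra.comap φ :=
        Algebra.adjoin_le fun u hu => hT (Finset.mem_coe.mpr (Finset.mem_union_left _
          (Finset.mem_image_of_mem _ hu)))
      exact fun u hu => h1 hu
    have hxT : ∀ s, s ∉ U → φ (x s) ∈ F := fun s hs => hT (Finset.mem_coe.mpr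
      (Finset.mem_union_right _ (Finset.mem_image.mpr
        ⟨s, Finset.mem_sdiff.mpr ⟨Finset.mem_univ _, hs⟩, rfl⟩)))
    have hxZ : ∀ s ∈ Zr, φ (x s) ∈ F := fun s hs => by
      rw [hZr s hs, map_zero]; exact F.zero_mem
    have hother : ∀ s, (∀ m ∈ mon n 1, s ≠ e m) → (∀ m ∈ mon n j, s ≠ e m) → φ (x s) ∈ F := by
      intro s h1 h2
      by_cases hs : s ∈ Zr
      · exact hxZ s hs
      · refine hxT s fun h => ?_
        rcases Finset.mem_union.mp h with h | h
        · rcases Finset.mem_union.mp h with h | h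
          · exact hs h
          · obtain ⟨m, hm, rfl⟩ := Finset.mem_image.mp h
            exact h1 m hm rfl
        · obtain ⟨m, hm, rfl⟩ := Finset.mem_image.mp h
          exact h2 m (Finset.sdiff_subset hm) rfl
    -- Homogeneity keeps the degrees apart. In the coefficient at `m`, the other monomial
    -- coordinates of degree `i` do not occur, and the remaining coordinates of that degree are
    -- already in `F`, multiplied by parameters. So knowing this coefficient and knowing `x (e m)`
    -- are equivalent.
    have hcoef : ∀ i, 1 ≤ i → i ≤ k → ∀ m ∈ mon n i,
        φ (fun y => coeff m (g y)) - φ (x (e m)) ∈ F := by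
      intro i hi1 hik m hm
      have hmd := mem_mon.mp hm
      have h1 : (fun y => coeff m (g y)) =
          (fun y => coeff m (G₀ y)) + ∑ s, x s * fun y => coeff m (G s y) := by
        ext y
        simp [hg, coeff_sum, coeff_C_mul]
      rw [h1, ← Finset.add_sum_erase _ _ (Finset.mem_univ (e m))]
      have h2 : (fun y => coeff m (G (e m) y)) = 1 := by
        ext y
        simp [heG m (by omega) (by omega)]
      rw [h2, mul_one, map_add, map_add, map_sum, ← add_assoc, add_right_comm,
        add_sub_cancel_right]
      refine add_mem (hpar _ (hG₀ m)) (sum_mem fun s hs => ?_)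
      by_cases hsi : δ s = i
      · by_cases hse : ∃ m' ∈ mon n i, s = e m'
        · obtain ⟨m', hm', rfl⟩ := hse
          have hm'd := mem_mon.mp hm'
          have hne : m' ≠ m := fun h => (Finset.mem_erase.mp hs).1 (by rw [h])
          have h3 : (fun y => coeff m (G (e m') y)) = 0 := by
            ext y
            rw [heG m' (by omega) (by omega), coeff_monomial, if_neg hne]
            rfl
          rw [h3, mul_zero, map_zero]
          exact F.zero_mem
        · push Not at hse
          rw [map_mul]
          have hlevel : ∀ i', 1 ≤ i' → i' ≤ k → ∀ m' ∈ mon n i', s ≠ e m' := by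
            rintro i' hi1' hik' m' hm' rfl
            have hm'd := mem_mon.mp hm'
            rw [heδ m' (by omega) (by omega)] at hsi
            exact hse m' (mem_mon.mpr hsi) rfl
          exact mul_mem (hother s (hlevel 1 le_rfl (by omega)) (hlevel j (by omega) hjk))
            (hpar _ (hG s m))
      · have h3 : (fun y => coeff m (G s y)) = 0 := by
          ext y
          exact (hδ s y).coeff_eq_zero (fun h => hsi (by rw [← h, hmd]))
        rw [h3, mul_zero, map_zero]
        exact F.zero_mem
    have hx1 : ∀ m ∈ mon n 1, φ (x (e m)) ∈ F := by
      intro m hm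
      have h1 := hcoef 1 le_rfl (by omega) m hm
      have h2 : (fun y => coeff m (g y)) = 0 := by
        ext y
        have := congrArg (coeff m) (hlin y)
        rwa [coeff_homogeneousComponent, if_pos (mem_mon.mp hm)] at this
      rw [h2, map_zero, zero_sub] at h1
      simpa using h1
    have hxD : ∀ m ∈ D, φ (x (e m)) ∈ F := by
      intro m hm
      by_cases hs : e m ∈ Zr
      · exact hxZ _ hs
      · refine hxT _ fun h => ?_
        have hmd := hmemj m (hD hm)
        rcases Finset.mem_union.mp h with h | h
        · rcases Finset.mem_union.mp h with h | h
          · exact hs h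
          · obtain ⟨m', hm', heq⟩ := Finset.mem_image.mp h
            have h1 := he (hmem1 m' hm') hmd heq
            have h2 := mem_mon.mp hm'
            have h3 := mem_mon.mp (hD hm)
            rw [h1] at h2
            omega
        · obtain ⟨m', hm', heq⟩ := Finset.mem_image.mp h
          have h1 := he (hmemj m' (Finset.sdiff_subset hm')) hmd heq
          rw [h1] at hm'
          exact (Finset.mem_sdiff.mp hm').2 hm
    have hxj : ∀ m ∈ mon n j, φ (x (e m)) ∈ F := by
      intro m hm
      have h1 := hdet F hF (fun i hi2 hij m => ?_) (fun m hm => ?_) m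
      · rw [hqK, if_pos hm] at h1
        have h2 := sub_mem h1 (hcoef j (by omega) hjk m hm)
        rwa [sub_sub_cancel] at h2
      · rw [hqK]
        split_ifs with hm
        · have h1 := hcoef i (by omega) (by omega) m hm
          have hmd := mem_mon.mp hm
          have h2 : φ (x (e m)) ∈ F := by
            have hne : ∀ i', 1 ≤ i' → i' ≤ k → i' ≠ i → ∀ m' ∈ mon n i', e m ≠ e m' := by
              intro i' hi1' hik' hii' m' hm' heq
              have hm'd := mem_mon.mp hm'
              have := he (show 1 ≤ m.degree ∧ m.degree ≤ k by omega)
                (show 1 ≤ m'.degree ∧ m'.degree ≤ k by omega) heq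
              rw [this] at hmd
              omega
            exact hother _ (hne 1 le_rfl (by omega) (by omega)) (hne j (by omega) hjk (by omega))
          have h3 := add_mem h1 h2
          rwa [sub_add_cancel] at h3
        · exact F.zero_mem
      · rw [hqK, if_pos (hD hm)]
        have h3 := add_mem (hcoef j (by omega) hjk m (hD hm)) (hxD m hm)
        rwa [sub_add_cancel] at h3
    intro s
    by_cases h1 : ∃ m ∈ mon n 1, s = e m
    · obtain ⟨m, hm, rfl⟩ := h1
      exact hx1 m hm
    by_cases h2 : ∃ m ∈ mon n j, s = e m
    · obtain ⟨m, hm, rfl⟩ := h2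
      exact hxj m hm
    push Not at h1 h2
    exact hother s h1 h2

end Count

/-! ### Regularity from finiteness over linear forms -/

section Regularity

variable {N n r : ℕ}

/-- Once the forms `ℓ` are themselves set to zero, integrality over them becomes integrality over
`ℂ`. The pair `Λ`, `ι` passes between the ambient space and the linear section on which finiteness
is known. -/
theorem isIntegral_of_isFiniteOverLin {J : Ideal (MvPolynomial (Fin N) ℂ)}
    {Q : Ideal (MvPolynomial (Fin n) ℂ)}
    (Λ : MvPolynomial (Fin N) ℂ →ₐ[ℂ] MvPolynomial (Fin n) ℂ)
    (ι : MvPolynomial (Fin n) ℂ →ₐ[ℂ] MvPolynomial (Fin N) ℂ)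
    (hι : ∀ g, g - ι (Λ g) ∈ J) (hQ : ∀ g ∈ Q, ι g ∈ J) {ℓ : Fin r → Fin n → ℂ}
    (hint : ∀ i, ((Ideal.Quotient.mk Q).comp (linAeval ℂ ℓ).toRingHom).IsIntegralElem
      (Ideal.Quotient.mk Q (X i)))
    (hℓ : ∀ s, ι (linAeval ℂ ℓ (X s)) ∈ J) (i : Fin N) :
    IsIntegral ℂ (Ideal.Quotient.mk J (X i)) := by
  let ψ : MvPolynomial (Fin n) ℂ →ₐ[ℂ] MvPolynomial (Fin N) ℂ ⧸ J := (Ideal.Quotient.mkₐ ℂ J).comp ι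
  have hψQ : ∀ g ∈ Q, ψ g = 0 := fun g hg => Ideal.Quotient.eq_zero_iff_mem.mpr (hQ g hg)
  have hX : ∀ s, IsIntegral ℂ (ψ (X s)) := by
    intro s
    have h1 := (hint s).map (Ideal.Quotient.lift Q (ψ : MvPolynomial (Fin n) ℂ →+* MvPolynomial (Fin N) ℂ ⧸ J) hψQ)
    have h2 : (Ideal.Quotient.lift Q (ψ : MvPolynomial (Fin n) ℂ →+* MvPolynomial (Fin N) ℂ ⧸ J) hψQ).comp
        ((Ideal.Quotient.mk Q).comp (linAeval ℂ ℓ).toRingHom) =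
        (algebraMap ℂ (MvPolynomial (Fin N) ℂ ⧸ J)).comp constantCoeff := by
      ext t
      · simp only [linAeval, AlgHom.toRingHom_eq_coe, RingHom.comp_apply, RingHom.coe_coe, algHom_C,
          algebraMap_eq, constantCoeff_C]
        exact ψ.commutes t
      · have : ψ (linAeval ℂ ℓ (X t)) = 0 := Ideal.Quotient.eq_zero_iff_mem.mpr (hℓ t)
        simp only [RingHom.comp_apply, constantCoeff_X, map_zero]
        exact this
    rw [h2] at h1
    obtain ⟨P, hP, hP'⟩ := h1
    refine ⟨P.map constantCoeff, hP.map _, ?_⟩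
    rw [Polynomial.eval₂_map]
    exact hP'
  have hall : ∀ g, IsIntegral ℂ (ψ g) := by
    intro g
    induction g using MvPolynomial.induction_on with
    | C a =>
      have : ψ (C a) = algebraMap ℂ _ a := ψ.commutes a
      rw [this]
      exact isIntegral_algebraMap
    | add g g' hg hg' => rw [map_add]; exact hg.add hg'
    | mul_X g s hg => rw [map_mul]; exact hg.mul (hX s)
  have h3 : Ideal.Quotient.mk J (X i) = ψ (Λ (X i)) :=
    Ideal.Quotient.eq.mpr (hι (X i))
  rw [h3]
  exact hall _

theorem constantCoeff_homogeneousComponent (f : MvPolynomial (Fin N) ℂ) {i : ℕ} (hi : i ≠ 0) :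
    constantCoeff (homogeneousComponent i f) = 0 := by
  rw [constantCoeff_eq, coeff_homogeneousComponent, if_neg]
  simpa using hi.symm

/-- The components of `f`, the auxiliary elements `u` and the `r` linear forms are together `N`
elements whose quotient is integral over `ℂ`. They form a system of parameters at the origin, and an
initial segment of it is regular. -/
theorem isKRegular_of_isFiniteOverLin (f : MvPolynomial (Fin N) ℂ) {μ k : ℕ} (hμ1 : 1 ≤ μ)
    (hμ2 : μ ≤ 2) (hμk : μ ≤ k) (hμ : ∀ i < μ, homogeneousComponent i f = 0)
    (Λ : MvPolynomial (Fin N) ℂ →ₐ[ℂ] MvPolynomial (Fin n) ℂ)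
    (ι : MvPolynomial (Fin n) ℂ →ₐ[ℂ] MvPolynomial (Fin N) ℂ)
    (hι0 : ∀ s, constantCoeff (ι (X s)) = 0) (u : List (MvPolynomial (Fin N) ℂ))
    (hu : ∀ p ∈ u, constantCoeff p = 0)
    (hι : ∀ g, g - ι (Λ g) ∈ Ideal.ofList
      ((List.range' μ (k + 1 - μ)).map (fun i => homogeneousComponent i f) ++ u))
    (hlen : k + 1 - μ + u.length + r = N)
    (hfin : IsFiniteOverLin (Ideal.span (truncation (fun i => Λ (homogeneousComponent i f)) k)) r) :
    IsKRegular f k := by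
  obtain ⟨ℓ, hℓ⟩ := hfin
  set L := (List.range' μ (k + 1 - μ)).map (fun i => homogeneousComponent i f) with hL
  set L' := u ++ List.ofFn fun s => ι (linAeval ℂ ℓ (X s)) with hL'
  have hLmem : ∀ i, μ ≤ i → i ≤ k → homogeneousComponent i f ∈ L := fun i h1 h2 =>
    List.mem_map_of_mem (List.mem_range'_1.mpr ⟨h1, by omega⟩)
  have hle : Ideal.ofList (L ++ u) ≤ Ideal.ofList (L ++ L') := by
    rw [hL', ← List.append_assoc, Ideal.ofList_append (L ++ u)]
    exact le_sup_left
  have hmem : ∀ p ∈ L ++ L', p ∈ Ideal.ofList (L ++ L') := fun p hp => Ideal.subset_span hp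
  have hreg := isRegular_of_isIntegral L L' (by simp [hL, hL', ← hlen, add_assoc]) (by
    intro p hp
    rcases List.mem_append.mp hp with hp | hp
    · obtain ⟨i, hi, rfl⟩ := List.mem_map.mp hp
      exact constantCoeff_homogeneousComponent f (by have := List.mem_range'_1.mp hi; omega)
    rcases List.mem_append.mp hp with hp | hp
    · exact hu p hp
    · obtain ⟨s, rfl⟩ := (List.mem_ofFn' _ _).mp hp
      dsimp only
      rw [linAeval_X, map_sum, map_sum]
      refine Finset.sum_eq_zero fun i _ => ?_
      rw [map_mul, map_mul, hι0, mul_zero])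
    (isIntegral_of_isFiniteOverLin Λ ι (fun g => hle (hι g)) (by
      intro g hg
      have h1 : Ideal.span (truncation (fun i => Λ (homogeneousComponent i f)) k) ≤
          (Ideal.ofList (L ++ L')).comap ι := by
        rw [Ideal.span_le]
        rintro _ ⟨i, hi2, hik, rfl⟩
        rw [SetLike.mem_coe, Ideal.mem_comap]
        have h2 := hmem _ (List.mem_append_left L' (hLmem i (by omega) hik))
        have h3 := sub_mem h2 (hle (hι (homogeneousComponent i f)))
        rwa [sub_sub_cancel] at h3
      exact h1 hg) hℓ (fun s => hmem _ (List.mem_append_right _ (List.mem_append_right _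
        ((List.mem_ofFn' _ _).mpr ⟨s, rfl⟩)))))
  rw [hL, List.map_map] at hreg
  refine ⟨μ, hμ1, hμk, hμ, ?_, hreg⟩
  -- The leading component is nonzero because zero is not a regular element of a nontrivial ring.
  intro h0
  have h1 := hreg.toIsWeaklyRegular
  rw [show k + 1 - μ = k - μ + 1 by omega, List.range'_succ, List.map_cons,
    RingTheory.Sequence.isWeaklyRegular_cons_iff] at h1
  have h2 := h1.1
  simp only [Function.comp_apply, h0, map_zero] at h2
  exact zero_ne_one (h2 (show (0 : LocalRingAtOrigin N) • (0 : LocalRingAtOrigin N) =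
    (0 : LocalRingAtOrigin N) • 1 by simp))

theorem homogeneousComponent_linSubst (P : Matrix (Fin N) (Fin n) ℂ) (f : MvPolynomial (Fin N) ℂ)
    (j : ℕ) : homogeneousComponent j (linSubst P f) = linSubst P (homogeneousComponent j f) := by
  have hhom : ∀ i, (linSubst P (homogeneousComponent i f)).IsHomogeneous i := by
    intro i
    have := (homogeneousComponent_isHomogeneous i f).aeval
      (fun i => ∑ j, C (P i j) * X j : Fin N → MvPolynomial (Fin n) ℂ)
      (n := 1) (fun s => IsHomogeneous.sum _ _ _ fun i _ => by
        simpa using (isHomogeneous_C (Fin n) (P s i)).mul (isHomogeneous_X ℂ i))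
    rwa [one_mul] at this
  conv_lhs => rw [← sum_homogeneousComponent f, map_sum, map_sum]
  rw [Finset.sum_congr rfl fun i _ => homogeneousComponent_of_mem (hhom i),
    Finset.sum_ite_eq]
  split_ifs with h
  · rfl
  · rw [homogeneousComponent_eq_zero, map_zero]
    simpa using h

/-- The matrix of the parametrization of a hyperplane by all coordinates but the `i`-th, which is
given by the linear form with coefficients `a`. -/
def elimMatrix (i : Fin (n + 1)) (a : Fin n → ℂ) : Matrix (Fin (n + 1)) (Fin n) ℂ :=
  Matrix.of (i.insertNth a fun s => Pi.single s 1)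

theorem elimMatrix_self (i : Fin (n + 1)) (a : Fin n → ℂ) : elimMatrix i a i = a := by
  ext j
  rw [elimMatrix, Matrix.of_apply, Fin.insertNth_apply_same]

theorem elimMatrix_succAbove (i : Fin (n + 1)) (a : Fin n → ℂ) (s : Fin n) :
    elimMatrix i a (i.succAbove s) = Pi.single s 1 := by
  ext j
  rw [elimMatrix, Matrix.of_apply, Fin.insertNth_apply_succAbove]

theorem linSubst_X (P : Matrix (Fin N) (Fin n) ℂ) (i : Fin N) :
    linSubst P (X i) = ∑ j, C (P i j) * X j := by
  simp [linSubst]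

theorem linSubst_elimMatrix_succAbove (i : Fin (n + 1)) (a : Fin n → ℂ) (s : Fin n) :
    linSubst (elimMatrix i a) (X (i.succAbove s)) = X s := by
  rw [linSubst_X, elimMatrix_succAbove, Finset.sum_eq_single s]
  · simp
  · intro b _ hb; simp [hb]
  · simp

theorem linSubst_elimMatrix_self (i : Fin (n + 1)) (a : Fin n → ℂ) :
    linSubst (elimMatrix i a) (X i) = ∑ s, C (a s) * X s := by
  rw [linSubst_X, elimMatrix_self]

theorem eq_sum_of_isHomogeneous_one {f : MvPolynomial (Fin N) ℂ} (hf : f.IsHomogeneous 1) :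
    f = ∑ i, C (coeff (Finsupp.single i 1) f) * X i := by
  ext m
  by_cases hm : m.degree = 1
  · obtain ⟨i, rfl⟩ := (Finsupp.sum_eq_one_iff m).mp (by rw [← hm, Finsupp.degree_apply]; rfl)
    rw [coeff_sum, Finset.sum_eq_single i]
    · simp [coeff_C_mul]
    · intro b _ hb
      rw [coeff_C_mul, coeff_X, if_neg, mul_zero]
      intro h
      exact hb (Finsupp.single_left_injective one_ne_zero h)
    · simp
  · have hs : (∑ i, C (coeff (Finsupp.single i 1) f) * X i : MvPolynomial (Fin N) ℂ).IsHomogeneous 1 :=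
      IsHomogeneous.sum _ _ _ fun i _ => by
        simpa using (isHomogeneous_C (Fin N) (coeff (Finsupp.single i 1) f)).mul (isHomogeneous_X ℂ i)
    rw [hf.coeff_eq_zero hm, hs.coeff_eq_zero hm]

/-- A nonzero linear form is proportional to one expressing a coordinate through the others. -/
theorem exists_elim {f : MvPolynomial (Fin (n + 1)) ℂ} (hf : f.IsHomogeneous 1) (hf0 : f ≠ 0) :
    ∃ (i : Fin (n + 1)) (a : Fin n → ℂ), linSubst (elimMatrix i a) f = 0 ∧
      ∃ b : ℂ, X i - rename i.succAbove (linSubst (elimMatrix i a) (X i)) = C b * f := by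
  have hex : ∃ i, coeff (Finsupp.single i 1) f ≠ 0 := by
    by_contra hcon
    push Not at hcon
    apply hf0
    rw [eq_sum_of_isHomogeneous_one hf]
    exact Finset.sum_eq_zero fun i _ => by rw [hcon i, C_0, zero_mul]
  obtain ⟨i, hi⟩ := hex
  set w := fun s => coeff (Finsupp.single s 1) f with hw
  let a : Fin n → ℂ := fun s => -(w i)⁻¹ * w (i.succAbove s)
  have hfs : f = C (w i) * X i + ∑ s, C (w (i.succAbove s)) * X (i.succAbove s) := by
    conv_lhs => rw [eq_sum_of_isHomogeneous_one hf, Fin.sum_univ_succAbove _ i]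
  refine ⟨i, a, ?_, (w i)⁻¹, ?_⟩
  · rw [hfs, map_add, map_mul, map_sum, linSubst_elimMatrix_self]
    simp only [map_mul, linSubst_elimMatrix_succAbove]
    simp only [linSubst, algHom_C, algebraMap_eq, a, Finset.mul_sum, ← Finset.sum_add_distrib]
    refine Finset.sum_eq_zero fun s _ => ?_
    rw [← mul_assoc, ← C_mul, ← mul_assoc, mul_neg, mul_inv_cancel₀ hi]
    simp
  · rw [linSubst_elimMatrix_self]
    conv_rhs => rw [hfs]
    rw [mul_add, ← mul_assoc, ← C_mul, inv_mul_cancel₀ hi, C_1, one_mul, sub_eq_add_neg]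
    congr 1
    rw [map_sum, ← Finset.sum_neg_distrib, Finset.mul_sum]
    refine Finset.sum_congr rfl fun s _ => ?_
    simp only [a, map_mul, rename_C, rename_X, map_neg]
    ring

theorem sub_rename_linSubst_mem (i : Fin (n + 1)) (a : Fin n → ℂ)
    {J : Ideal (MvPolynomial (Fin (n + 1)) ℂ)}
    (h : X i - rename i.succAbove (linSubst (elimMatrix i a) (X i)) ∈ J)
    (g : MvPolynomial (Fin (n + 1)) ℂ) :
    g - rename i.succAbove (linSubst (elimMatrix i a) g) ∈ J := by
  have h1 : (Ideal.Quotient.mkₐ ℂ J).comp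
      ((rename i.succAbove).comp (linSubst (elimMatrix i a))) = Ideal.Quotient.mkₐ ℂ J := by
    ext s
    refine Fin.succAboveCases i ?_ (fun s => ?_) s
    · exact (Ideal.Quotient.eq.mpr h).symm
    · simp [linSubst_elimMatrix_succAbove]
  exact Ideal.Quotient.eq.mp (AlgHom.congr_fun h1 g).symm

/-- Converts a failure of regularity into a dimension condition on a polynomial without linear part.
The hyperplane is the kernel of the linear part of `f`, or an arbitrary one if that part vanishes.
-/
theorem exists_not_isFiniteOverLin (f : MvPolynomial (Fin (n + 1)) ℂ) (h0 : constantCoeff f = 0)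
    {k : ℕ} (hk2 : 2 ≤ k) (hk : k ≤ n + 1) (hnot : ¬ IsKRegular f k) :
    ∃ (i : Fin (n + 1)) (a : Fin n → ℂ),
      homogeneousComponent 1 (linSubst (elimMatrix i a) f) = 0 ∧
      ¬ IsFiniteOverLin (Ideal.span (truncation
        (fun j => homogeneousComponent j (linSubst (elimMatrix i a) f)) k)) (n + 1 - k) := by
  have h00 : homogeneousComponent 0 f = 0 := by
    rw [homogeneousComponent_zero, ← constantCoeff_eq, h0, C_0]
  simp only [homogeneousComponent_linSubst]
  by_cases h1 : homogeneousComponent 1 f = 0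
  -- Here the sequence starts in degree 2, so the equation `X 0` of the hyperplane is adjoined to
  -- keep the number of elements equal to `n + 1`.
  · refine ⟨0, 0, by rw [h1, map_zero], fun hfin => hnot ?_⟩
    refine isKRegular_of_isFiniteOverLin f one_le_two le_rfl hk2 ?_ _ (rename (Fin.succAbove 0))
      (fun s => by simp) [X 0] (by simp) ?_ (by simp; omega) hfin
    · intro i hi
      interval_cases i
      · exact h00
      · exact h1
    · refine sub_rename_linSubst_mem 0 0 ?_
      rw [linSubst_elimMatrix_self]
      simp only [Pi.zero_apply, zero_mul, Finset.sum_const_zero, map_zero, sub_zero]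
      exact Ideal.subset_span (by simp)
  · obtain ⟨i, a, ha, b, hb⟩ := exists_elim (homogeneousComponent_isHomogeneous 1 f) h1
    refine ⟨i, a, ha, fun hfin => hnot ?_⟩
    refine isKRegular_of_isFiniteOverLin f le_rfl one_le_two (by omega) ?_ _ (rename i.succAbove)
      (fun s => by simp) [] (by simp) ?_ (by simp; omega) hfin
    · intro i hi
      interval_cases i
      exact h00
    · refine sub_rename_linSubst_mem i a ?_
      rw [hb]
      refine Ideal.mul_mem_left _ _ (Ideal.subset_span ?_)
      simp only [List.append_nil, List.mem_map]
      exact ⟨1, List.mem_range'_1.mpr (by omega), rfl⟩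

theorem not_isFiniteOverLin_of_not_isKRegular (f : MvPolynomial (Fin n) ℂ)
    (h0 : constantCoeff f = 0) (h1 : homogeneousComponent 1 f = 0)
    {k : ℕ} (hk2 : 2 ≤ k) (hk : k ≤ n + 1) (hnot : ¬ IsKRegular f k) :
    ¬ IsFiniteOverLin (Ideal.span (truncation
      (fun j => homogeneousComponent j f) k)) (n + 1 - k) := by
  have h00 : homogeneousComponent 0 f = 0 := by
    rw [homogeneousComponent_zero, ← constantCoeff_eq, h0, C_0]
  refine fun hfin => hnot (isKRegular_of_isFiniteOverLin f one_le_two le_rfl hk2 ?_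
    (AlgHom.id ℂ _) (AlgHom.id ℂ _) (fun s => by simp) [] (by simp) (fun g => by simp)
    (by simp; omega) hfin)
  intro i hi
  interval_cases i
  · exact h00
  · exact h1

end Regularity

/-! ### Coordinates on the parameter space -/

section CoordRing

variable {W : Type} [AddCommGroup W] [Module ℂ W]

/-- The coordinate ring of an affine subspace is the polynomial ring in affine coordinates. -/
theorem exists_algEquiv_coordRing (S : Set W) {σ : Type} (x : σ → Module.Dual ℂ W) (a : σ → ℂ)
    [Fintype σ] (b : W) (L : (σ → ℂ) →ₗ[ℂ] W) (hL : ∀ v, b + L v ∈ S)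
    (hx : ∀ v s, x s (b + L v) + a s = v s)
    (hS : ∀ w ∈ S, w = b + L fun s => x s w + a s) :
    ∃ e : MvPolynomial σ ℂ ≃ₐ[ℂ] coordRing S,
      ∀ s (w : S), (e (X s)).val w = x s w.val + a s := by
  classical
  have hmem : ∀ φ : Module.Dual ℂ W, (fun w : S => φ w.val) ∈ coordRing S := fun φ =>
    Algebra.subset_adjoin ⟨φ, rfl⟩
  let u : σ → coordRing S := fun s => ⟨fun w => x s w.val, hmem _⟩ + algebraMap ℂ _ (a s)
  have hu : ∀ s (w : S), (u s).val w = x s w.val + a s := fun s w => rfl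
  have hev : ∀ (p : MvPolynomial σ ℂ) (w : S),
      (aeval u p).val w = eval (fun s => x s w.val + a s) p := by
    intro p w
    let ev : coordRing S →ₐ[ℂ] ℂ := (Pi.evalAlgHom ℂ (fun _ : S => ℂ) w).comp (coordRing S).val
    have h1 : (ev.comp (aeval u)) = aeval fun s => x s w.val + a s := by
      ext s
      simp [ev, hu]
    have h2 := AlgHom.congr_fun h1 p
    rw [aeval_eq_eval] at h2
    exact h2
  have hinj : Function.Injective (aeval u : MvPolynomial σ ℂ →ₐ[ℂ] coordRing S) := by
    rw [injective_iff_map_eq_zero]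
    intro p hp
    refine MvPolynomial.funext fun v => ?_
    have h1 := hev p ⟨_, hL v⟩
    rw [hp] at h1
    simp only [hx] at h1
    rw [map_zero, ← h1]
    rfl
  have hsurj : Function.Surjective (aeval u : MvPolynomial σ ℂ →ₐ[ℂ] coordRing S) := by
    have h1 : coordRing S ≤ ((coordRing S).val.comp (aeval u)).range := by
      refine Algebra.adjoin_le ?_
      rintro _ ⟨φ, rfl⟩
      refine ⟨C (φ b) + ∑ s, C (φ (L (Pi.single s 1))) * X s, ?_⟩
      ext w
      have h2 := hev (C (φ b) + ∑ s, C (φ (L (Pi.single s 1))) * X s) w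
      refine h2.trans ?_
      change _ = φ w.val
      conv_rhs => rw [hS w.val w.2]
      have h3 : (fun s => x s w.val + a s) =
          ∑ s, (x s w.val + a s) • (Pi.single s 1 : σ → ℂ) := by
        ext s
        simp [Finset.sum_apply, Pi.single_apply]
      conv_rhs => rw [h3]
      simp only [map_add, map_sum, map_mul, eval_C, eval_X, map_smul, smul_eq_mul]
      congr 1
      exact Finset.sum_congr rfl fun _ _ => mul_comm _ _
    intro r
    obtain ⟨p, hp⟩ := h1 r.2
    exact ⟨p, Subtype.ext hp⟩
  have hbij : Function.Bijective (aeval u : MvPolynomial σ ℂ →ₐ[ℂ] coordRing S) := ⟨hinj, hsurj⟩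
  exact ⟨AlgEquiv.ofBijective _ hbij, fun s w =>
    (congrArg (fun r : coordRing S => r.val w) (aeval_X u s)).trans (hu s w)⟩

end CoordRing

/-! ### Homogeneous polynomials of degree `D` and polynomials of degree at most `D` in the chart. -/

section Dehomogenisation

variable {M : ℕ} (B : GL (Fin (M + 1)) ℂ)

/-- The restriction to the chart `x'_0 = 1`, where `x = B x'`. -/
def dehomogenise : MvPolynomial (Fin (M + 1)) ℂ →ₐ[ℂ] MvPolynomial (Fin M) ℂ :=
  aeval fun j : Fin (M + 1) => C (B.val j 0) + ∑ i : Fin M, C (B.val j i.succ) * X i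

theorem totalDegree_dehomogenise_le {A : MvPolynomial (Fin (M + 1)) ℂ} {D : ℕ}
    (hA : A.IsHomogeneous D) : (dehomogenise B A).totalDegree ≤ D := by
  have h1 : ∀ j, (C (B.val j 0) + ∑ i : Fin M, C (B.val j i.succ) * X i :
      MvPolynomial (Fin M) ℂ).totalDegree ≤ 1 := by
    intro j
    refine (totalDegree_add _ _).trans (max_le (by simp) ?_)
    refine totalDegree_finsetSum_le fun i _ => (totalDegree_mul _ _).trans ?_
    rw [totalDegree_C, totalDegree_X]
  rw [dehomogenise, aeval_def, eval₂_eq]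
  refine totalDegree_finsetSum_le fun m hm => ?_
  refine (totalDegree_mul _ _).trans ?_
  rw [algebraMap_eq, totalDegree_C, zero_add]
  refine (totalDegree_finsetProd _ _).trans ?_
  have hmD : m.degree = D := by
    have := hA (mem_support_iff.mp hm)
    rw [Finsupp.degree_eq_weight_one (R := ℕ)]
    exact this
  rw [← hmD, Finsupp.degree_apply]
  refine Finset.sum_le_sum fun i _ => (totalDegree_pow _ _).trans ?_
  exact (Nat.mul_le_mul_left _ (h1 i)).trans (by simp)

/-- The coordinates `x' = B⁻¹ x`. -/
def adaptedVar (j : Fin (M + 1)) : MvPolynomial (Fin (M + 1)) ℂ :=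
  ∑ k, C ((B⁻¹).val j k) * X k

theorem isHomogeneous_adaptedVar (j : Fin (M + 1)) : (adaptedVar B j).IsHomogeneous 1 :=
  IsHomogeneous.sum _ _ _ fun k _ => by
    simpa using (isHomogeneous_C (Fin (M + 1)) ((B⁻¹).val j k)).mul (isHomogeneous_X ℂ k)

theorem sum_inv_mul (j i : Fin (M + 1)) :
    ∑ k, (B⁻¹).val j k * B.val k i = (1 : Matrix (Fin (M + 1)) (Fin (M + 1)) ℂ) j i := by
  have h : (B⁻¹).val * B.val = 1 := B.inv_mul
  rw [← h, Matrix.mul_apply]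

theorem dehomogenise_adaptedVar (j : Fin (M + 1)) :
    dehomogenise B (adaptedVar B j) = (Fin.cons 1 X : Fin (M + 1) → MvPolynomial (Fin M) ℂ) j := by
  have h1 : dehomogenise B (adaptedVar B j) = ∑ i, C (∑ k, (B⁻¹).val j k * B.val k i) *
      (Fin.cons 1 X : Fin (M + 1) → MvPolynomial (Fin M) ℂ) i := by
    simp only [dehomogenise, adaptedVar, map_sum, map_mul, algHom_C, algebraMap_eq, aeval_X,
      Finset.sum_mul]
    rw [Finset.sum_comm]
    refine Finset.sum_congr rfl fun k _ => ?_
    rw [Fin.sum_univ_succ]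
    simp only [Fin.cons_zero, Fin.cons_succ, mul_one, mul_add, Finset.mul_sum, mul_assoc]
  rw [h1]
  simp only [sum_inv_mul, Matrix.one_apply]
  rw [Finset.sum_eq_single j]
  · simp
  · intro b _ hb; simp [hb.symm]
  · simp

theorem exists_dehomogenise_eq (g : MvPolynomial (Fin M) ℂ) {D : ℕ} (hg : g.totalDegree ≤ D) :
    ∃ A : MvPolynomial (Fin (M + 1)) ℂ, A.IsHomogeneous D ∧ dehomogenise B A = g := by
  refine ⟨∑ m ∈ g.support, C (coeff m g) * (adaptedVar B 0 ^ (D - m.degree) *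
    ∏ i, adaptedVar B (Fin.succ i) ^ m i), ?_, ?_⟩
  · refine IsHomogeneous.sum _ _ _ fun m hm => ?_
    have hm' : m.degree ≤ D := by
      refine le_trans ?_ hg
      have := le_totalDegree hm
      rwa [Finsupp.sum_fintype _ _ (fun _ => rfl), ← Finsupp.degree_eq_sum] at this
    have h1 := ((isHomogeneous_adaptedVar B 0).pow (D - m.degree)).mul
      (IsHomogeneous.prod Finset.univ (fun i => adaptedVar B (Fin.succ i) ^ m i) (fun i => 1 * m i)
        fun i _ => (isHomogeneous_adaptedVar B (Fin.succ i)).pow (m i))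
    have h2 := (isHomogeneous_C (Fin (M + 1)) (coeff m g)).mul h1
    have h3 : 0 + (1 * (D - m.degree) + ∑ i, 1 * m i) = D := by
      simp only [one_mul, ← Finsupp.degree_eq_sum]
      omega
    rwa [h3] at h2
  · simp only [map_sum, map_mul, map_pow, map_prod, dehomogenise_adaptedVar, Fin.cons_zero,
      Fin.cons_succ, one_pow, one_mul]
    conv_rhs => rw [g.as_sum]
    refine Finset.sum_congr rfl fun m _ => ?_
    rw [monomial_eq, Finsupp.prod_fintype _ _ (fun _ => pow_zero _), algHom_C]
    rfl

theorem eval_dehomogenise (A : MvPolynomial (Fin (M + 1)) ℂ) (z : Fin M → ℂ) :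
    eval z (dehomogenise B A) = eval (fun j => B.val j 0 + ∑ i, B.val j i.succ * z i) A := by
  have h : (aeval z).comp (dehomogenise B) =
      aeval (R := ℂ) (fun j => B.val j 0 + ∑ i, B.val j i.succ * z i) := by
    ext j
    simp [dehomogenise, aeval_eq_eval]
  have := AlgHom.congr_fun h A
  rwa [aeval_eq_eval, AlgHom.comp_apply, aeval_eq_eval] at this

theorem eq_zero_of_dehomogenise_eq_zero {A : MvPolynomial (Fin (M + 1)) ℂ} {D : ℕ}
    (hA : A.IsHomogeneous D) (h : dehomogenise B A = 0) : A = 0 := by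
  have hne : adaptedVar B 0 ≠ 0 := by
    intro h0
    have := dehomogenise_adaptedVar B 0
    rw [h0, map_zero, Fin.cons_zero] at this
    exact zero_ne_one this
  -- The form vanishes at every point with `x'_0 ≠ 0`, by rescaling into the chart; the extra factor
  -- takes care of `x'_0 = 0`.
  refine (mul_eq_zero.mp (?_ : A * adaptedVar B 0 = 0)).resolve_right hne
  refine MvPolynomial.funext fun x => ?_
  rw [map_mul, map_zero]
  by_cases hx : eval x (adaptedVar B 0) = 0
  · rw [hx, mul_zero]
  set w : Fin (M + 1) → ℂ := fun j => eval x (adaptedVar B j) with hw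
  have hBw : ∀ j, ∑ k, B.val j k * w k = x j := by
    intro j
    have h1 : B.val * (B⁻¹).val = 1 := B.mul_inv
    have h2 : w = (B⁻¹).val.mulVec x := by
      ext j
      simp [hw, adaptedVar, Matrix.mulVec, dotProduct]
    have h3 : B.val.mulVec w = x := by rw [h2, Matrix.mulVec_mulVec, h1, Matrix.one_mulVec]
    exact congrFun h3 j
  have hw0 : w 0 ≠ 0 := hx
  have h1 := eval_dehomogenise B A fun i => w i.succ / w 0
  rw [h, map_zero] at h1
  have h2 : x = w 0 • fun j => B.val j 0 + ∑ i, B.val j i.succ * (w (Fin.succ i) / w 0) := by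
    ext j
    rw [← hBw j, Fin.sum_univ_succ, Pi.smul_apply, smul_eq_mul, mul_add, Finset.mul_sum]
    congr 1
    · ring
    · refine Finset.sum_congr rfl fun i _ => ?_
      field_simp
  rw [h2, eval_smul_of_isHomogeneous hA, ← h1, mul_zero, zero_mul]

end Dehomogenisation

/-! ### Coefficients of the affine equation as affine coordinates on the parameter space. -/

section Coordinates

variable {M d l : ℕ}

/-- Polynomials in `y` of degree less than `d` with coefficient at `y^k` of degree
at most `(d - k) l`. -/
def HasDegreeBounds (d l : ℕ) (f : Polynomial (MvPolynomial (Fin M) ℂ)) : Prop :=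
  ∀ k, (d ≤ k → f.coeff k = 0) ∧ (f.coeff k).totalDegree ≤ (d - k) * l

/-- Under the translation `y ↦ y + β` the coefficient at `y^k` only receives contributions from
`y^j` with `j ≥ k`, and these have the smaller degree bound. -/
theorem HasDegreeBounds.taylor {f : Polynomial (MvPolynomial (Fin M) ℂ)}
    (hf : HasDegreeBounds d l f) (β : ℂ) : HasDegreeBounds d l (Polynomial.taylor (C β) f) := by
  have hdeg : f.natDegree < d ∨ f = 0 := by
    by_contra hcon
    push Not at hcon
    exact hcon.2 (Polynomial.leadingCoeff_eq_zero.mp ((hf f.natDegree).1 hcon.1))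
  have hnat : (Polynomial.taylor (C β) f).natDegree = f.natDegree := Polynomial.natDegree_taylor _ _
  intro k
  constructor
  · intro hk
    rcases hdeg with h | h
    · exact Polynomial.coeff_eq_zero_of_natDegree_lt (by omega)
    · rw [h, map_zero, Polynomial.coeff_zero]
  · rw [Polynomial.taylor_apply, Polynomial.comp_eq_sum_left, Polynomial.sum_def,
      Polynomial.finsetSum_coeff]
    refine totalDegree_finsetSum_le fun j _ => ?_
    rw [Polynomial.coeff_C_mul, Polynomial.coeff_X_add_C_pow]
    by_cases hkj : j < k
    · rw [Nat.choose_eq_zero_of_lt hkj]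
      simp
    · refine (totalDegree_mul _ _).trans ?_
      have h1 : (C β ^ (j - k) * (j.choose k : MvPolynomial (Fin M) ℂ)).totalDegree = 0 := by
        rw [← map_pow, ← map_natCast (C : ℂ →+* MvPolynomial (Fin M) ℂ), ← map_mul, totalDegree_C]
      rw [h1, add_zero]
      exact ((hf j).2).trans (Nat.mul_le_mul_right _ (by omega))

/-- The part of `F` of degree less than `d` in `ξ`, in the chart `x'_0 = 1`. -/
def lowerPart (B : GL (Fin (M + 1)) ℂ) (A : ParamSpace M d l) :
    Polynomial (MvPolynomial (Fin M) ℂ) :=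
  ∑ i : Fin d, Polynomial.C (dehomogenise B (A i)) * Polynomial.X ^ (d - (i.val + 1))

theorem coeff_sum_C_mul_X_pow {R : Type} [CommRing R] (a : Fin d → R) (i : Fin d) :
    (∑ i : Fin d, Polynomial.C (a i) * Polynomial.X ^ (d - (i.val + 1))).coeff
      (d - (i.val + 1)) = a i := by
  rw [Polynomial.finsetSum_coeff, Finset.sum_eq_single i]
  · simp
  · intro j _ hj
    rw [Polynomial.coeff_C_mul_X_pow, if_neg]
    intro h
    exact hj (Fin.ext (by omega))
  · simp

theorem hasDegreeBounds_sum (a : Fin d → MvPolynomial (Fin M) ℂ)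
    (ha : ∀ i, (a i).totalDegree ≤ (i.val + 1) * l) :
    HasDegreeBounds d l
      (∑ i : Fin d, Polynomial.C (a i) * Polynomial.X ^ (d - (i.val + 1))) := by
  intro k
  have h0 : d ≤ k → (∑ i : Fin d, Polynomial.C (a i) *
      Polynomial.X ^ (d - (i.val + 1))).coeff k = 0 := by
    intro hk
    rw [Polynomial.finsetSum_coeff]
    refine Finset.sum_eq_zero fun i _ => ?_
    rw [Polynomial.coeff_C_mul_X_pow, if_neg]
    omega
  refine ⟨h0, ?_⟩
  by_cases hk : d ≤ k
  · rw [h0 hk]; simp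
  · push Not at hk
    have h1 := coeff_sum_C_mul_X_pow a (⟨d - 1 - k, by omega⟩ : Fin d)
    have h2 : d - (d - 1 - k + 1) = k := by omega
    simp only [h2] at h1
    rw [h1]
    refine (ha _).trans (Nat.mul_le_mul_right _ ?_)
    simp only
    omega

theorem hasDegreeBounds_lowerPart (B : GL (Fin (M + 1)) ℂ) (A : ParamSpace M d l) :
    HasDegreeBounds d l (lowerPart B A) :=
  hasDegreeBounds_sum _ fun i => totalDegree_dehomogenise_le B (A i).2

theorem HasDegreeBounds.eq_sum {f : Polynomial (MvPolynomial (Fin M) ℂ)}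
    (hf : HasDegreeBounds d l f) :
    f = ∑ i : Fin d, Polynomial.C (f.coeff (d - (i.val + 1))) *
      Polynomial.X ^ (d - (i.val + 1)) := by
  ext1 k
  by_cases hk : d ≤ k
  · rw [(hf k).1 hk, Polynomial.finsetSum_coeff]
    refine (Finset.sum_eq_zero fun i _ => ?_).symm
    rw [Polynomial.coeff_C_mul_X_pow, if_neg]
    omega
  · push Not at hk
    have h1 := coeff_sum_C_mul_X_pow (fun i : Fin d => f.coeff (d - (i.val + 1)))
      (⟨d - 1 - k, by omega⟩ : Fin d)
    have h2 : d - (d - 1 - k + 1) = k := by omega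
    simp only [h2] at h1
    exact h1.symm

theorem affineEq_eq {o : WeightedProj M l} (c : AdaptedCoordinates o) (A : ParamSpace M d l) :
    affineEq c A = Polynomial.taylor (C c.β) (Polynomial.X ^ d) +
      Polynomial.taylor (C c.β) (lowerPart c.B A) := by
  rw [← map_add, Polynomial.taylor_apply, affineEq]
  congr 1
  simp only [toPoly, lowerPart, Polynomial.map_add, Polynomial.map_pow, Polynomial.map_X,
    Polynomial.map_sum, Polynomial.map_mul, Polynomial.map_C]
  rfl

/-- The coefficients `a_{i+1}` of `y^{d-1-i}` that are not forced to vanish: monomials of degree at most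
`(i+1) l`. -/
abbrev FullIndex (M d l : ℕ) : Type :=
  {p : Fin d × (Fin M →₀ ℕ) // p.2.degree ≤ (p.1.val + 1) * l}

instance : Finite (FullIndex M d l) := by
  have : Finite {m : Fin M →₀ ℕ | m.degree ≤ d * l} := (Finsupp.finite_of_degree_le (d * l))
  refine Finite.of_injective (β := Fin d × {m : Fin M →₀ ℕ | m.degree ≤ d * l})
    (fun p => (p.1.1, ⟨p.1.2, p.2.trans (Nat.mul_le_mul_right _ p.1.1.2)⟩)) ?_
  rintro ⟨⟨i, m⟩, h⟩ ⟨⟨i', m'⟩, h'⟩ heq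
  simp only [Prod.mk.injEq, Subtype.mk.injEq] at heq
  exact Subtype.ext (Prod.ext heq.1 heq.2)

/-- The linear parts of the coefficients of the affine equation. -/
def coeffMap (d : ℕ) {o : WeightedProj M l} (c : AdaptedCoordinates o) :
    ParamSpace M d l →ₗ[ℂ] (FullIndex M d l → ℂ) where
  toFun A s := coeff s.1.2 ((Polynomial.taylor (C c.β) (lowerPart c.B A)).coeff (d - (s.1.1.val + 1)))
  map_add' A A' := by
    have h : lowerPart c.B (A + A') = lowerPart c.B A + lowerPart c.B A' := by
      simp [lowerPart, add_mul, Finset.sum_add_distrib]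
    ext s
    simp [h]
  map_smul' t A := by
    have h : lowerPart c.B (t • A) = C (σ := Fin M) t • lowerPart c.B A := by
      simp [lowerPart, Finset.smul_sum, Polynomial.smul_eq_C_mul, smul_eq_C_mul, mul_assoc]
    ext s
    simp [h]

theorem coeffMap_injective {o : WeightedProj M l} (c : AdaptedCoordinates o) :
    Function.Injective (coeffMap d c) := by
  rw [injective_iff_map_eq_zero]
  intro A hA
  have hb := (hasDegreeBounds_lowerPart c.B A).taylor c.β
  have h0 : Polynomial.taylor (C c.β) (lowerPart c.B A) = 0 := by
    ext k m
    rw [Polynomial.coeff_zero, coeff_zero]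
    by_cases hk : d ≤ k
    · rw [(hb k).1 hk, coeff_zero]
    push Not at hk
    by_cases hm : m.degree ≤ (d - k) * l
    · have h1 := congrFun hA ⟨(⟨d - 1 - k, by omega⟩, m), by
        rw [show d - 1 - k + 1 = d - k by omega]; exact hm⟩
      have h2 : d - (d - 1 - k + 1) = k := by omega
      simpa [coeffMap, h2] using h1
    · exact coeff_eq_zero_of_totalDegree_lt (by
        have := (hb k).2
        rw [← Finsupp.degree_apply]
        omega)
  have h1 : lowerPart c.B A = 0 :=
    Polynomial.taylor_injective _ (by rw [h0, map_zero])
  ext1 i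
  refine Subtype.ext (eq_zero_of_dehomogenise_eq_zero c.B (A i).2 ?_)
  have h2 := coeff_sum_C_mul_X_pow (fun i => dehomogenise c.B (A i)) i
  rw [← h2]
  change (lowerPart c.B A).coeff _ = 0
  rw [h1, Polynomial.coeff_zero]

/-- The inverse assembles the prescribed coefficients into a polynomial in `y`, undoes the
translation by `β` and homogenises each coefficient. The degree bounds survive the translation,
which makes the last step possible. -/
theorem coeffMap_surjective {o : WeightedProj M l} (c : AdaptedCoordinates o) :
    Function.Surjective (coeffMap d c) := by
  classical
  intro v
  have := Fintype.ofFinite (FullIndex M d l)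
  let a : Fin d → MvPolynomial (Fin M) ℂ := fun i =>
    ∑ s : FullIndex M d l, if s.1.1 = i then monomial s.1.2 (v s) else 0
  have ha : ∀ i, (a i).totalDegree ≤ (i.val + 1) * l := by
    intro i
    refine totalDegree_finsetSum_le fun s _ => ?_
    split_ifs with h
    · refine (totalDegree_monomial_le _ _).trans ?_
      rw [← h]
      exact s.2
    · simp
  set f := ∑ i : Fin d, Polynomial.C (a i) * Polynomial.X ^ (d - (i.val + 1)) with hf
  have hg := (hasDegreeBounds_sum a ha).taylor (-c.β)
  set g := Polynomial.taylor (C (-c.β)) f with hgdef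
  have hlift : ∀ i : Fin d, ∃ A : homogeneousSubmodule (Fin (M + 1)) ℂ ((i.val + 1) * l),
      dehomogenise c.B A = g.coeff (d - (i.val + 1)) := by
    intro i
    obtain ⟨A, hA, hA'⟩ := exists_dehomogenise_eq c.B (g.coeff (d - (i.val + 1)))
      (D := (i.val + 1) * l) ((hg _).2.trans (Nat.mul_le_mul_right _ (by omega)))
    exact ⟨⟨A, hA⟩, hA'⟩
  choose A hA using hlift
  refine ⟨A, ?_⟩
  have h1 : lowerPart c.B A = g := by
    rw [hg.eq_sum]
    simp only [lowerPart, hA]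
  have h2 : Polynomial.taylor (C c.β) (lowerPart c.B A) = f := by
    rw [h1, hgdef, Polynomial.taylor_taylor, map_neg]
    simp
  ext s
  change coeff s.1.2 ((Polynomial.taylor (C c.β) (lowerPart c.B A)).coeff _) = v s
  rw [h2, hf, coeff_sum_C_mul_X_pow, coeff_sum, Finset.sum_eq_single s]
  · simp
  · intro t _ ht
    split_ifs with h
    · rw [coeff_monomial, if_neg fun h' => ht (Subtype.ext (Prod.ext h h'))]
    · simp
  · simp

/-- The coefficient of the affine equation with the given index. -/
def coordFun {o : WeightedProj M l} (c : AdaptedCoordinates o) (s : FullIndex M d l)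
    (A : ParamSpace M d l) : ℂ :=
  coeff s.1.2 ((affineEq c A).coeff (d - (s.1.1.val + 1)))

/-- The index of the constant term of the affine equation. -/
def IsConstIndex (s : FullIndex M d l) : Prop := s.1.1.val + 1 = d ∧ s.1.2 = 0

/-- The coefficients of the affine equation other than the constant term. -/
abbrev CoordIndex (M d l : ℕ) : Type := {s : FullIndex M d l // ¬ IsConstIndex s}

instance : Fintype (CoordIndex M d l) := Fintype.ofFinite _

theorem coordFun_eq {o : WeightedProj M l} (c : AdaptedCoordinates o) (s : FullIndex M d l)
    (A : ParamSpace M d l) :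
    coordFun c s A = coeffMap d c A s + coordFun c s (0 : ParamSpace M d l) := by
  have h : lowerPart c.B (0 : ParamSpace M d l) = 0 := by simp [lowerPart]
  simp only [coordFun, affineEq_eq, h, map_zero, add_zero, Polynomial.coeff_add, coeff_add]
  exact add_comm _ _

/-- Weighted homogeneity of degree `dl`: vanishing at a point can be tested on one representative.
-/
theorem toPoly_eval₂_smul (A : ParamSpace M d l) (t : ℂ) (x : Fin (M + 1) → ℂ) (ξ : ℂ) :
    (toPoly A).eval₂ (MvPolynomial.eval (t • x)) (t ^ l * ξ) =
      t ^ (d * l) * (toPoly A).eval₂ (MvPolynomial.eval x) ξ := by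
  simp only [toPoly, Polynomial.eval₂_add, Polynomial.eval₂_pow, Polynomial.eval₂_X,
    Polynomial.eval₂_finsetSum, Polynomial.eval₂_mul, Polynomial.eval₂_C, mul_add, Finset.mul_sum]
  congr 1
  · rw [mul_pow, ← pow_mul, mul_comm l d]
  · refine Finset.sum_congr rfl fun i _ => ?_
    rw [eval_smul_of_isHomogeneous (A i).2, mul_pow, ← pow_mul]
    have h : d * l = (i.val + 1) * l + l * (d - (i.val + 1)) := by
      obtain ⟨e, he⟩ : ∃ e, d = i.val + 1 + e := ⟨d - (i.val + 1), by have := i.2; omega⟩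
      rw [show d - (i.val + 1) = e by omega]
      conv_lhs => rw [he]
      ring
    rw [h, pow_add]
    ring

theorem constantCoeff_affineEq_coeff_zero {o : WeightedProj M l} (c : AdaptedCoordinates o)
    (A : ParamSpace M d l) : constantCoeff ((affineEq c A).coeff 0) =
      (toPoly A).eval₂ (MvPolynomial.eval fun i => c.B.val i 0) c.β := by
  rw [affineEq, Polynomial.coeff_zero_eq_eval_zero, Polynomial.eval_comp]
  simp only [Polynomial.eval_add, Polynomial.eval_X, Polynomial.eval_C, zero_add]
  rw [Polynomial.eval_map, Polynomial.hom_eval₂, constantCoeff_C]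
  congr 1
  ext j
  · simp
  · simp

theorem mem_vanishingAt_iff {o : WeightedProj M l} (c : AdaptedCoordinates o)
    (A : ParamSpace M d l) :
    A ∈ vanishingAt d o ↔ constantCoeff ((affineEq c A).coeff 0) = 0 := by
  rw [constantCoeff_affineEq_coeff_zero]
  constructor
  · intro h
    have h' : ∀ p : Rep M, WeightedProj.mk l p = o →
      (toPoly A).eval₂ (MvPolynomial.eval p.1.1) p.1.2 = 0 := h
    exact h' ⟨(fun i => c.B.val i 0, c.β), c.ne_zero⟩ c.mk_eq
  · intro h
    change ∀ p : Rep M, WeightedProj.mk l p = o →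
      (toPoly A).eval₂ (MvPolynomial.eval p.1.1) p.1.2 = 0
    intro p hp
    have h3 : (weightedSetoid M l).r ⟨(fun i => c.B.val i 0, c.β), c.ne_zero⟩ p :=
      Quotient.exact (s := weightedSetoid M l) (c.mk_eq.trans hp.symm)
    obtain ⟨t, h1, h2⟩ := h3
    rw [h1, h2]
    exact (toPoly_eval₂_smul A _ _ _).trans (by rw [h, mul_zero])

theorem coordFun_eq_zero_of_isConstIndex {o : WeightedProj M l} (c : AdaptedCoordinates o)
    {A : ParamSpace M d l} (hA : A ∈ vanishingAt d o) {s : FullIndex M d l} (hs : IsConstIndex s) :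
    coordFun c s A = 0 := by
  have h := (mem_vanishingAt_iff c A).mp hA
  rwa [coordFun, hs.1, hs.2, Nat.sub_self, ← constantCoeff_eq]

/-- The coefficients of the affine equation are affine coordinates on the space of
polynomials vanishing at the point. -/
theorem exists_algEquiv_coordRing_vanishingAt (hd : 1 ≤ d) {o : WeightedProj M l}
    (c : AdaptedCoordinates o) :
    ∃ e : MvPolynomial (CoordIndex M d l) ℂ ≃ₐ[ℂ] coordRing (vanishingAt d o),
      ∀ s (A : vanishingAt d o), (e (X s)).val A = coordFun c s.1 A.val := by
  classical
  let D : ParamSpace M d l ≃ₗ[ℂ] (FullIndex M d l → ℂ) :=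
    LinearEquiv.ofBijective (coeffMap d c) ⟨coeffMap_injective c, coeffMap_surjective c⟩
  have hD : ∀ A s, D A s + coordFun c s (0 : ParamSpace M d l) = coordFun c s A :=
    fun A s => (coordFun_eq c s A).symm
  let ex : (CoordIndex M d l → ℂ) →ₗ[ℂ] (FullIndex M d l → ℂ) :=
    { toFun := fun v s => if h : IsConstIndex s then 0 else v ⟨s, h⟩
      map_add' := fun v v' => by
        ext s
        by_cases h : IsConstIndex s <;> simp [h]
      map_smul' := fun t v => by
        ext s
        by_cases h : IsConstIndex s <;> simp [h] }
  -- The origin of the affine coordinates, that is, the polynomial whose affine equation is `y^d`.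
  let b : ParamSpace M d l := D.symm fun s => -coordFun c s (0 : ParamSpace M d l)
  let L : (CoordIndex M d l → ℂ) →ₗ[ℂ] ParamSpace M d l := D.symm.toLinearMap.comp ex
  have hDb : ∀ v s, coordFun c s (b + L v) = ex v s := by
    intro v s
    rw [← hD, map_add]
    simp [b, L]
  obtain ⟨e, he⟩ := exists_algEquiv_coordRing (vanishingAt d o)
    (fun s : CoordIndex M d l => (LinearMap.proj s.1).comp D.toLinearMap)
    (fun s => coordFun c s.1 (0 : ParamSpace M d l)) b L (by
      intro v
      rw [mem_vanishingAt_iff c]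
      have h1 := hDb v ⟨(⟨d - 1, by omega⟩, 0), by simp⟩
      have h2 : IsConstIndex (⟨(⟨d - 1, by omega⟩, 0), by simp⟩ : FullIndex M d l) :=
        ⟨by simp; omega, rfl⟩
      have h3 : d - (d - 1 + 1) = 0 := by omega
      simpa [ex, h2, coordFun, h3, constantCoeff_eq] using h1) (by
      intro v s
      have h1 := hDb v s.1
      rw [← hD] at h1
      refine h1.trans ?_
      simp [ex, s.2]) (by
      intro A hA
      have h1 : ∀ s, coordFun c s A = coordFun c s (b + L fun s => D A s.1 + coordFun c s.1 0) := by
        intro s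
        rw [hDb]
        by_cases hs : IsConstIndex s
        · simp [ex, hs, coordFun_eq_zero_of_isConstIndex c hA hs]
        · simp [ex, hs, hD]
      refine D.injective (funext fun s => ?_)
      have h2 := h1 s
      rw [← hD, ← hD (b + _)] at h2
      exact add_right_cancel h2)
  exact ⟨e, fun s A => (he s A).trans (hD _ _)⟩

theorem HasDegreeBounds.add {f g : Polynomial (MvPolynomial (Fin M) ℂ)}
    (hf : HasDegreeBounds d l f) (hg : HasDegreeBounds d l g) : HasDegreeBounds d l (f + g) := by
  refine fun k => ⟨fun hk => ?_, ?_⟩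
  · rw [Polynomial.coeff_add, (hf k).1 hk, (hg k).1 hk, add_zero]
  · rw [Polynomial.coeff_add]
    exact (totalDegree_add _ _).trans (max_le (hf k).2 (hg k).2)

theorem hasDegreeBounds_taylor_X_pow_sub (β : ℂ) :
    HasDegreeBounds (M := M) d l
      (Polynomial.taylor (C β) (Polynomial.X ^ d) - Polynomial.X ^ d) := by
  intro k
  rw [Polynomial.taylor_X_pow, Polynomial.coeff_sub, Polynomial.coeff_X_add_C_pow,
    Polynomial.coeff_X_pow]
  constructor
  · intro hk
    rcases hk.eq_or_lt with rfl | hk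
    · simp
    · rw [Nat.choose_eq_zero_of_lt hk, if_neg (by omega)]
      simp
  · have h1 : ∃ a : ℂ, C β ^ (d - k) * (d.choose k : MvPolynomial (Fin M) ℂ) -
        (if k = d then 1 else 0) = C a := by
      refine ⟨β ^ (d - k) * d.choose k - if k = d then 1 else 0, ?_⟩
      split_ifs <;> simp
    obtain ⟨a, ha⟩ := h1
    rw [ha, totalDegree_C]
    exact Nat.zero_le _

/-- The affine equation is determined by its coordinates. -/
theorem affineEq_eq_sum {o : WeightedProj M l} (c : AdaptedCoordinates o)
    {A : ParamSpace M d l} (hA : A ∈ vanishingAt d o) :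
    affineEq c A = Polynomial.X ^ d + ∑ s : CoordIndex M d l,
      Polynomial.C (monomial s.1.1.2 (coordFun c s.1 A)) *
        Polynomial.X ^ (d - (s.1.1.1.val + 1)) := by
  classical
  have hb : HasDegreeBounds d l (affineEq c A - Polynomial.X ^ d) := by
    rw [affineEq_eq, add_sub_right_comm]
    exact (hasDegreeBounds_taylor_X_pow_sub _).add ((hasDegreeBounds_lowerPart c.B A).taylor _)
  rw [← sub_eq_iff_eq_add']
  ext k m
  rw [Polynomial.finsetSum_coeff, coeff_sum]
  simp only [Polynomial.coeff_C_mul_X_pow]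
  by_cases hk : d ≤ k
  · rw [(hb k).1 hk, coeff_zero, Finset.sum_eq_zero fun s _ => ?_]
    rw [if_neg (by have := s.1.1.1.2; omega), coeff_zero]
  push Not at hk
  by_cases hs : ∃ s : CoordIndex M d l, k = d - (s.1.1.1.val + 1) ∧ s.1.1.2 = m
  · obtain ⟨s, hsk, hsm⟩ := hs
    rw [Finset.sum_eq_single s]
    · rw [if_pos hsk, hsm, coeff_monomial, if_pos rfl, coordFun, hsm, hsk, Polynomial.coeff_sub,
        Polynomial.coeff_X_pow, if_neg (by omega), sub_zero]
    · intro t _ ht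
      split_ifs with h
      · rw [coeff_monomial, if_neg]
        intro hm
        refine ht (Subtype.ext (Subtype.ext (Prod.ext (Fin.ext ?_) (hm.trans hsm.symm))))
        have := s.1.1.1.2
        have := t.1.1.1.2
        omega
      · exact coeff_zero _
    · simp
  · rw [Finset.sum_eq_zero]
    · rw [Polynomial.coeff_sub, Polynomial.coeff_X_pow, if_neg (by omega), sub_zero]
      have hkd : d - (d - 1 - k + 1) = k := by omega
      by_cases hm : m.degree ≤ (d - k) * l
      · let s : FullIndex M d l := ⟨(⟨d - 1 - k, by omega⟩, m), by
          simpa only [show d - 1 - k + 1 = d - k by omega] using hm⟩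
        by_cases hc : IsConstIndex s
        · have := coordFun_eq_zero_of_isConstIndex c hA hc
          simpa only [coordFun, s, hkd] using this
        · exact absurd ⟨⟨s, hc⟩, hkd.symm, rfl⟩ hs
      · refine coeff_eq_zero_of_totalDegree_lt ?_
        have h1 := (hb k).2
        rw [Polynomial.coeff_sub, Polynomial.coeff_X_pow, if_neg (by omega), sub_zero] at h1
        rw [← Finsupp.degree_apply]
        omega
    · intro t _
      split_ifs with h
      · rw [coeff_monomial, if_neg fun hm => hs ⟨t, h, hm⟩]
      · exact coeff_zero _

end Coordinates

/-! ### Codimension of the irregular loci -/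

section Family

variable {Y : Type} {n : ℕ}

/-- A family of polynomials whose coefficients, as functions of the parameter, lie in `S`. -/
def HasCoeffsIn (S : Subalgebra ℂ (Y → ℂ)) (u : Y → MvPolynomial (Fin n) ℂ) : Prop :=
  ∀ m, (fun y => coeff m (u y)) ∈ S

variable {S : Subalgebra ℂ (Y → ℂ)} {u v : Y → MvPolynomial (Fin n) ℂ}

theorem HasCoeffsIn.mul (hu : HasCoeffsIn S u) (hv : HasCoeffsIn S v) :
    HasCoeffsIn S fun y => u y * v y := by
  classical
  intro m
  have h : (fun y => coeff m (u y * v y)) = ∑ p ∈ Finset.HasAntidiagonal.antidiagonal m,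
      (fun y => coeff p.1 (u y)) * fun y => coeff p.2 (v y) := by
    ext y
    simp [coeff_mul]
  rw [h]
  exact sum_mem fun p _ => mul_mem (hu _) (hv _)

theorem hasCoeffsIn_const (f : MvPolynomial (Fin n) ℂ) : HasCoeffsIn S fun _ => f :=
  fun m => S.algebraMap_mem (coeff m f)

theorem HasCoeffsIn.pow (hu : HasCoeffsIn S u) (k : ℕ) : HasCoeffsIn S fun y => u y ^ k := by
  induction k with
  | zero => simpa using hasCoeffsIn_const 1
  | succ k ih => simpa only [pow_succ] using ih.mul hu

theorem hasCoeffsIn_sum {τ : Type} (I : Finset τ) {w : τ → Y → MvPolynomial (Fin n) ℂ}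
    (hw : ∀ i, HasCoeffsIn S (w i)) : HasCoeffsIn S fun y => ∑ i ∈ I, w i y := by
  intro m
  have h : (fun y => coeff m (∑ i ∈ I, w i y)) = ∑ i ∈ I, fun y => coeff m (w i y) := by
    ext y
    simp [coeff_sum]
  rw [h]
  exact sum_mem fun i _ => hw i m

theorem hasCoeffsIn_prod {τ : Type} (I : Finset τ) {w : τ → Y → MvPolynomial (Fin n) ℂ}
    (hw : ∀ i, HasCoeffsIn S (w i)) : HasCoeffsIn S fun y => ∏ i ∈ I, w i y := by
  classical
  induction I using Finset.induction_on with
  | empty => simpa using hasCoeffsIn_const 1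
  | insert a I ha ih =>
    simp only [Finset.prod_insert ha]
    exact (hw a).mul ih

theorem hasCoeffsIn_linear {w : Fin n → Y → ℂ} (hw : ∀ s, w s ∈ S) :
    HasCoeffsIn S fun y => ∑ s, C (w s y) * X s :=
  hasCoeffsIn_sum _ fun s m => by
    have h : (fun y => coeff m (C (w s y) * X s)) =
        w s * fun _ => coeff m (X s : MvPolynomial (Fin n) ℂ) := by
      ext y
      simp [coeff_C_mul]
    rw [h]
    exact mul_mem (hw s) (S.algebraMap_mem (coeff m (X s : MvPolynomial (Fin n) ℂ)))

end Family

/-! ### The dimension count applied to a graph `y = h(z)` restricted to a linear section. -/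

section Pieces

variable {M d l n : ℕ}

theorem linSubst_linSubst {N m : ℕ} (P : Matrix (Fin N) (Fin m) ℂ) (P' : Matrix (Fin m) (Fin n) ℂ)
    (f : MvPolynomial (Fin N) ℂ) : linSubst P' (linSubst P f) = linSubst (P * P') f := by
  have h : (linSubst P').comp (linSubst P) = linSubst (P * P') := by
    ext1 i
    rw [AlgHom.comp_apply, linSubst_X, linSubst_X, map_sum]
    simp only [map_mul, linSubst_X, Matrix.mul_apply, map_sum, Finset.sum_mul]
    rw [Finset.sum_comm]
    refine Finset.sum_congr rfl fun j _ => ?_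
    rw [linSubst, algHom_C, algebraMap_eq, Finset.mul_sum]
    exact Finset.sum_congr rfl fun s _ => (mul_assoc _ _ _).symm
  exact AlgHom.congr_fun h f

theorem linSubst_isHomogeneous {N : ℕ} (P : Matrix (Fin N) (Fin n) ℂ) {f : MvPolynomial (Fin N) ℂ}
    {j : ℕ} (hf : f.IsHomogeneous j) : (linSubst P f).IsHomogeneous j := by
  have := homogeneousComponent_linSubst P f j
  rw [homogeneousComponent_of_mem (show f ∈ homogeneousSubmodule _ _ j from hf), if_pos rfl] at this
  rw [← this]
  exact homogeneousComponent_isHomogeneous _ _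

theorem degree_mapDomain (m : Fin n →₀ ℕ) (ι : Fin n → Fin M) :
    (m.mapDomain ι).degree = m.degree := by
  rw [Finsupp.degree_apply, Finsupp.degree_apply]
  exact Finsupp.sum_mapDomain_index (h := fun _ k => k) (fun _ => rfl) fun _ _ _ => rfl

/-- The index of the coefficient of `a_d` at the monomial with exponent `m` in the variables
selected by `ι`. -/
def lastIndex (hd : 2 ≤ d) (ι : Fin n → Fin M) (m : Fin n →₀ ℕ) : CoordIndex M d l :=
  if h : m.degree ≤ d * l ∧ m ≠ 0 then
    ⟨⟨(⟨d - 1, by omega⟩, m.mapDomain ι), by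
      simp only [degree_mapDomain]
      rw [show d - 1 + 1 = d by omega]
      exact h.1⟩, fun hc => h.2 (by
        have h1 := degree_mapDomain m ι
        have h2 : m.mapDomain ι = 0 := hc.2
        rw [h2, map_zero] at h1
        exact (Finsupp.degree_eq_zero_iff m).mp h1.symm)⟩
  -- A default value, the constant term of `a_1`; it is an admissible index because `d ≥ 2`, and the
  -- count only concerns exponents of degree between 1 and `k ≤ dl`.
  else ⟨⟨(⟨0, by omega⟩, 0), by simp⟩, fun hc => by
    have := hc.1
    simp only at this
    omega⟩

theorem lastIndex_eq (hd : 2 ≤ d) (ι : Fin n → Fin M) {m : Fin n →₀ ℕ} (h1 : 1 ≤ m.degree)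
    (h2 : m.degree ≤ d * l) : (lastIndex (l := l) hd ι m).1.1 =
      (⟨d - 1, by omega⟩, m.mapDomain ι) := by
  have h : m.degree ≤ d * l ∧ m ≠ 0 := ⟨h2, fun h0 => by rw [h0, map_zero] at h1; omega⟩
  rw [lastIndex, dif_pos h]

/-- The section `N y` is the identity on the variables selected by `ι`, so the coefficients of `a_d`
at monomials in these variables contribute single monomials after restriction and can be solved for.
All other coefficients enter through products of entries of `N y` and of powers of the restricted
`h`, hence through the parameters. -/
theorem exists_small_set_of_linSubst {Y K : Type} [Field K] [Algebra ℂ K]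
    (φ : (Y → ℂ) →ₐ[ℂ] K) (hφ : Function.Surjective φ) (hd : 2 ≤ d)
    {o : WeightedProj M l} (co : AdaptedCoordinates o) (A : Y → ParamSpace M d l)
    (hA : ∀ y, A y ∈ vanishingAt d o) (ι : Fin n → Fin M) (hι : Function.Injective ι)
    (N : Y → Matrix (Fin M) (Fin n) ℂ) (hN : ∀ y s, N y (ι s) = Pi.single s 1)
    (h : Y → MvPolynomial (Fin M) ℂ) (hh : ∀ y, (h y).IsHomogeneous 1) (par : Finset (Y → ℂ))
    (hparN : ∀ i s, (fun y => N y i s) ∈ Algebra.adjoin ℂ (par : Set (Y → ℂ)))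
    (hparh : ∀ s, (fun y => coeff (Finsupp.single s 1) (linSubst (N y) (h y))) ∈
      Algebra.adjoin ℂ (par : Set (Y → ℂ)))
    {k : ℕ} (hk2 : 2 ≤ k) (hk : k ≤ n + 1) (hkd : k ≤ d * l)
    (Zr : Finset (CoordIndex M d l)) (hZr : ∀ s ∈ Zr, ∀ y, coordFun co s.1 (A y) = 0)
    (hZre : ∀ s ∈ Zr, s.1.1.1.val + 1 ≠ d)
    (hlin : ∀ y, homogeneousComponent 1 (linSubst (N y) ((affineEq co (A y)).eval (h y))) = 0)
    (hnot : ∀ y, ¬ IsFiniteOverLin (Ideal.span (truncation (fun i => homogeneousComponent i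
      (linSubst (N y) ((affineEq co (A y)).eval (h y)))) k)) (n + 1 - k))
    {c : ℕ} (hc : ∀ j, 2 ≤ j → j ≤ k →
      c + par.card ≤ (mon (n + 2 - j) j).card + Zr.card + (mon n 1).card) :
    ∃ T : Finset K, T.card + c ≤ Fintype.card (CoordIndex M d l) ∧
      ∀ F : IntermediateField ℂ K, IsRelAlgClosed F → (T : Set K) ⊆ F →
        ∀ s : CoordIndex M d l, φ (fun y => coordFun co s.1 (A y)) ∈ F := by
  classical
  set S := Algebra.adjoin ℂ (par : Set (Y → ℂ)) with hS
  have hlN : ∀ i, HasCoeffsIn S fun y => linSubst (N y) (X i) := fun i => by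
    simp only [linSubst_X]
    exact hasCoeffsIn_linear (w := fun s y => N y i s) fun s => hparN i s
  have hlh : HasCoeffsIn S fun y => linSubst (N y) (h y) := by
    have h1 : (fun y => linSubst (N y) (h y)) = fun y =>
        ∑ s, C (coeff (Finsupp.single s 1) (linSubst (N y) (h y))) * X s := by
      funext y
      exact eq_sum_of_isHomogeneous_one (f := linSubst (N y) (h y))
        (linSubst_isHomogeneous (N y) (hh y))
    rw [h1]
    exact hasCoeffsIn_linear (w := fun s y => coeff (Finsupp.single s 1) (linSubst (N y) (h y))) hparh
  have hmon : ∀ (P : Matrix (Fin M) (Fin n) ℂ) (m : Fin M →₀ ℕ),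
      linSubst P (monomial m 1) = ∏ i, linSubst P (X i) ^ m i := by
    intro P m
    rw [monomial_eq, C_1, one_mul, Finsupp.prod_fintype _ _ (fun _ => pow_zero _), map_prod]
    simp only [map_pow]
  have hXι : ∀ y s, linSubst (N y) (X (ι s)) = X s := by
    intro y s
    rw [linSubst_X, hN, Finset.sum_eq_single s]
    · simp
    · intro b _ hb; simp [hb]
    · simp
  refine exists_small_generating_set φ hφ (fun s y => coordFun co s.1 (A y)) _
    (fun y => linSubst (N y) (h y) ^ d)
    (fun s y => linSubst (N y) (monomial s.1.1.2 1) *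
      linSubst (N y) (h y) ^ (d - (s.1.1.1.val + 1))) ?_
    (fun s => s.1.1.2.degree + (d - (s.1.1.1.val + 1))) ?_ par (hlh.pow d) ?_ k hk2 hk
    (lastIndex hd ι) ?_ ?_ ?_ Zr (fun s hs => funext (hZr s hs)) ?_ hlin hnot c hc
  · intro y
    rw [affineEq_eq_sum co (hA y), Polynomial.eval_add, map_add, Polynomial.eval_pow,
      Polynomial.eval_X, map_pow, Polynomial.eval_finsetSum, map_sum]
    congr 1
    refine Finset.sum_congr rfl fun s _ => ?_
    rw [Polynomial.eval_mul, Polynomial.eval_C, Polynomial.eval_pow, Polynomial.eval_X, map_mul,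
      map_pow, ← mul_assoc]
    congr 1
    rw [← mul_one (coordFun co s.1 (A y)), ← smul_eq_mul, ← smul_monomial, map_smul, smul_eq_C_mul,
      smul_eq_mul, mul_one]
  · intro s y
    have h1 := (linSubst_isHomogeneous (N y) (hh y)).pow (d - (s.1.1.1.val + 1))
    rw [one_mul] at h1
    exact (linSubst_isHomogeneous (N y) (isHomogeneous_monomial 1 rfl)).mul h1
  · intro s
    refine HasCoeffsIn.mul ?_ (hlh.pow _)
    simp only [hmon]
    exact hasCoeffsIn_prod _ fun i => (hlN i).pow _
  · intro m hm m' hm' heq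
    have h1 := lastIndex_eq (l := l) hd ι hm.1 (hm.2.trans hkd)
    have h2 := lastIndex_eq (l := l) hd ι hm'.1 (hm'.2.trans hkd)
    rw [heq, h2] at h1
    exact (Finsupp.mapDomain_injective hι (congrArg Prod.snd h1)).symm
  · intro m hm1 hmk
    rw [lastIndex_eq hd ι hm1 (hmk.trans hkd), degree_mapDomain]
    simp only
    omega
  · intro m hm1 hmk y
    rw [lastIndex_eq hd ι hm1 (hmk.trans hkd)]
    simp only
    rw [show d - (d - 1 + 1) = 0 by omega, pow_zero, mul_one]
    have h1 : (monomial (m.mapDomain ι) 1 : MvPolynomial (Fin M) ℂ) = rename ι (monomial m 1) :=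
      (rename_monomial _ _ _).symm
    have h2 : (linSubst (N y)).comp (rename ι) = AlgHom.id ℂ _ := by
      ext1 s
      rw [AlgHom.comp_apply, rename_X, hXι]
      rfl
    rw [h1]
    exact AlgHom.congr_fun h2 _
  · intro m hm1 hmk hmem
    apply hZre _ hmem
    rw [lastIndex_eq hd ι hm1 (hmk.trans hkd)]
    simp only
    omega

end Pieces

/-! ### Numbers of monomials. -/

section Binomial

theorem card_mon (n j : ℕ) : (mon n j).card = (n + j - 1).choose j := by
  rw [mon, Finset.card_finsuppAntidiag_nat_eq_choose, Finset.card_univ, Fintype.card_fin]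

theorem le_choose_of_lt {N i : ℕ} (hi1 : 1 ≤ i) (hi : i < N) : N ≤ N.choose i := by
  induction N generalizing i with
  | zero => omega
  | succ N ih =>
    obtain ⟨i, rfl⟩ : ∃ i', i = i' + 1 := ⟨i - 1, by omega⟩
    rw [Nat.choose_succ_succ']
    have h1 : 1 ≤ N.choose i := Nat.choose_pos (by omega)
    rcases Nat.lt_or_ge (i + 1) N with h | h
    · have := ih (by omega) h
      omega
    · obtain rfl : N = i + 1 := by omega
      rw [Nat.choose_self, Nat.choose_succ_self_right]

theorem choose_two_le_choose {N j : ℕ} (hj2 : 2 ≤ j) (hj : j + 2 ≤ N) :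
    N.choose 2 ≤ N.choose j := by
  induction N with
  | zero => omega
  | succ N ih =>
    rcases Nat.lt_or_ge (j + 1) N with h | h
    · obtain ⟨j, rfl⟩ : ∃ j', j = j' + 1 := ⟨j - 1, by omega⟩
      have h0 : (N + 1).choose 2 = N.choose 1 + N.choose 2 := Nat.choose_succ_succ' N 1
      rw [h0, Nat.choose_succ_succ' N j]
      have h1 := ih (by omega)
      have h2 := le_choose_of_lt (N := N) (i := j) (by omega) (by omega)
      rw [Nat.choose_one_right]
      omega
    · obtain rfl : N = j + 1 := by omega
      rw [← Nat.choose_symm (show j ≤ j + 1 + 1 by omega), show j + 1 + 1 - j = 2 by omega]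

/-- The number of monomials is `C(n+1, j)`, and in the range `2 ≤ j ≤ n - 1` a binomial coefficient
is smallest at the ends. -/
theorem choose_two_le_card_mon {n j : ℕ} (hj2 : 2 ≤ j) (hj : j + 1 ≤ n) :
    (n + 1) * n / 2 ≤ (mon (n + 2 - j) j).card := by
  rw [card_mon, show n + 2 - j + j - 1 = n + 1 by omega]
  have := choose_two_le_choose (N := n + 1) hj2 (by omega)
  rwa [Nat.choose_two_right, Nat.add_sub_cancel] at this

theorem card_mon_one (n : ℕ) : (mon n 1).card = n := by
  rw [card_mon, Nat.add_sub_cancel, Nat.choose_one_right]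

end Binomial

/-! ### Reduction of the codimension to finitely many loci. -/

section Height

variable {M d l : ℕ}

/-- The locus enters only as a set of points: it need not be closed or constructible. -/
theorem le_height_idealOf (hd : 1 ≤ d) {o : WeightedProj M l} (co : AdaptedCoordinates o)
    (S : Set (ParamSpace M d l)) (hS : S ⊆ vanishingAt d o) (c : ℕ)
    (h : ∀ (K : Type) [Field K] [Algebra ℂ K] (φ : (S → ℂ) →ₐ[ℂ] K), Function.Surjective φ →
      ∃ T : Finset K, T.card + c ≤ Fintype.card (CoordIndex M d l) ∧
        ∀ F : IntermediateField ℂ K, IsRelAlgClosed F → (T : Set K) ⊆ F →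
          ∀ s : CoordIndex M d l, φ (fun A => coordFun co s.1 A.val) ∈ F) :
    (c : ℕ∞) ≤ (idealOf (vanishingAt d o) S).height := by
  obtain ⟨e, he⟩ := exists_algEquiv_coordRing_vanishingAt hd co
  refine le_height_of_generic e S (fun A => (Pi.evalAlgHom ℂ (fun _ : vanishingAt d o => ℂ)
    ⟨A.val, hS A.2⟩).comp (coordRing (vanishingAt d o)).val) _ ?_ c ?_
  · intro a ha A hA
    exact ha ⟨A.val, hA⟩
  · intro K _ _ φ hφ
    obtain ⟨T, hT, hTF⟩ := h K φ hφ
    refine ⟨T, hT, fun F hF hTs s => ?_⟩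
    have h1 := hTF F hF hTs s
    have h2 : (fun A : S => ((Pi.evalAlgHom ℂ (fun _ : vanishingAt d o => ℂ)
        ⟨A.val, hS A.2⟩).comp (coordRing (vanishingAt d o)).val) (e (X s))) =
        fun A : S => coordFun co s.1 A.val := funext fun A => he s ⟨A.val, hS A.2⟩
    rw [h2]
    exact h1

theorem idealOf_zariskiClosure {W : Type} [AddCommGroup W] [Module ℂ W] (V S : Set W) :
    idealOf V (zariskiClosure V S) = idealOf V S := by
  ext f
  constructor
  · intro hf x hx
    exact hf x ⟨x.2, fun g hg => hg x hx⟩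
  · rintro hf x ⟨_, hx⟩
    exact hx f hf

theorem le_height_of_iInf_le {R Ω : Type} [CommRing R] [Finite Ω] (J : Ω → Ideal R) (I : Ideal R)
    (hI : ⨅ ω, J ω ≤ I) (c : ℕ∞) (h : ∀ ω, c ≤ (J ω).height) : c ≤ I.height := by
  classical
  have := Fintype.ofFinite Ω
  rw [Ideal.height_eq_inf_minimalPrimes]
  refine le_iInf₂ fun P hP => ?_
  have h1 : Finset.univ.inf J ≤ P := by
    rw [Finset.inf_univ_eq_iInf]
    exact hI.trans hP.1.2
  obtain ⟨ω, -, hω⟩ := hP.1.1.inf_le'.mp h1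
  exact (h ω).trans (Ideal.height_mono hω)

theorem le_codim_zariskiClosure {W Ω : Type} [AddCommGroup W] [Module ℂ W] [Finite Ω]
    (V S : Set W) (p : Ω → Set W) (hp : S ⊆ ⋃ ω, p ω) (c : ℕ∞)
    (h : ∀ ω, c ≤ (idealOf V (p ω)).height) : c ≤ codim V (zariskiClosure V S) := by
  rw [codim, idealOf_zariskiClosure V S]
  refine le_height_of_iInf_le (fun ω => idealOf V (p ω)) _ ?_ c h
  intro f hf x hx
  obtain ⟨ω, hω⟩ := Set.mem_iUnion.mp (hp hx)
  exact (Ideal.mem_iInf.mp hf ω) x hω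

end Height

/-! ### Loci of polynomials with non-regular sections. -/

section RegularityLoci

variable {d l n k c : ℕ}

/-- The locus of polynomials with a non-regular section by a graph `y = h(z)` and a hyperplane. -/
def graphLocus (d k : ℕ) {o : WeightedProj (n + 1) l} (co : AdaptedCoordinates o)
    (i : Fin (n + 1)) : Set (ParamSpace (n + 1) d l) :=
  {A | A ∈ vanishingAt d o ∧ ∃ h : MvPolynomial (Fin (n + 1)) ℂ, h.IsHomogeneous 1 ∧
    ∃ a : Fin n → ℂ,
      homogeneousComponent 1 (linSubst (elimMatrix i a) ((affineEq co A).eval h)) = 0 ∧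
      ¬ IsFiniteOverLin (Ideal.span (truncation (fun j => homogeneousComponent j
        (linSubst (elimMatrix i a) ((affineEq co A).eval h))) k)) (n + 1 - k)}

/-- There are at least `(n+1)n/2` conditions from some component and `n` from the linear part,
against `n` parameters for the hyperplane and `n` for `h`. -/
theorem le_height_graphLocus (hd : 2 ≤ d) {o : WeightedProj (n + 1) l} (co : AdaptedCoordinates o)
    (i : Fin (n + 1)) (hk2 : 2 ≤ k) (hk : k + 1 ≤ n) (hkd : k ≤ d * l)
    (hc : c + n ≤ (n + 1) * n / 2) :
    (c : ℕ∞) ≤ (idealOf (vanishingAt d o) (graphLocus d k co i)).height := by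
  classical
  refine le_height_idealOf (by omega) co _ (fun A hA => hA.1) c fun K _ _ φ hφ => ?_
  -- An arbitrary pointwise choice suffices, since the parameters only have to be functions on the
  -- locus.
  choose h hh a hlin hnot using fun A : graphLocus d k co i => A.2.2
  let p₁ : Fin n → graphLocus d k co i → ℂ := fun s A => a A s
  -- Only the restriction of `h` to the hyperplane matters, so `h` costs `n` parameters and not `n +
  -- 1`.
  let p₂ : Fin n → graphLocus d k co i → ℂ := fun s A =>
    coeff (Finsupp.single s 1) (linSubst (elimMatrix i (a A)) (h A))
  refine exists_small_set_of_linSubst φ hφ hd co (fun A => A.val) (fun A => A.2.1) i.succAbove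
    Fin.succAbove_right_injective (fun A => elimMatrix i (a A))
    (fun A s => elimMatrix_succAbove _ _ _) h hh
    (Finset.univ.image p₁ ∪ Finset.univ.image p₂) ?_ ?_ hk2 (by omega) hkd ∅ (by simp) (by simp)
    hlin hnot ?_
  · intro i' s
    refine Fin.succAboveCases i ?_ (fun t => ?_) i'
    · simp only [elimMatrix_self]
      exact Algebra.subset_adjoin (by simp [p₁])
    · simp only [elimMatrix_succAbove]
      exact Subalgebra.algebraMap_mem _ ((Pi.single t 1 : Fin n → ℂ) s)
  · intro s
    exact Algebra.subset_adjoin (by simp [p₂])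
  · intro j hj2 hjk
    have h1 := choose_two_le_card_mon (n := n) hj2 (by omega)
    have h2 := Finset.card_union_le (Finset.univ.image p₁) (Finset.univ.image p₂)
    have h3 : (Finset.univ.image p₁).card ≤ n := Finset.card_image_le.trans (by simp)
    have h4 : (Finset.univ.image p₂).card ≤ n := Finset.card_image_le.trans (by simp)
    rw [card_mon_one, Finset.card_empty]
    omega

/-- The locus of polynomials with a non-regular section by `y = 0` and two hyperplanes. -/
def hyperplaneLocus (d k : ℕ) {o : WeightedProj (n + 2) l} (co : AdaptedCoordinates o)
    (i : Fin (n + 2)) (i' : Fin (n + 1)) : Set (ParamSpace (n + 2) d l) :=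
  {A | A ∈ vanishingAt d o ∧ ∃ (a : Fin (n + 1) → ℂ) (b : Fin n → ℂ),
      homogeneousComponent 1 (linSubst (elimMatrix i a * elimMatrix i' b)
        ((affineEq co A).eval 0)) = 0 ∧
      ¬ IsFiniteOverLin (Ideal.span (truncation (fun j => homogeneousComponent j
        (linSubst (elimMatrix i a * elimMatrix i' b) ((affineEq co A).eval 0))) k)) (n + 1 - k)}

theorem elimMatrix_mul_succAbove {m : ℕ} (i : Fin (n + 1)) (a : Fin n → ℂ)
    (P : Matrix (Fin n) (Fin m) ℂ) (s : Fin n) :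
    (elimMatrix i a * P) (i.succAbove s) = P s := by
  ext t
  rw [Matrix.mul_apply, elimMatrix_succAbove, Finset.sum_eq_single s]
  · simp
  · intro b _ hb; simp [hb]
  · simp

theorem le_height_hyperplaneLocus (hd : 2 ≤ d) {o : WeightedProj (n + 2) l}
    (co : AdaptedCoordinates o) (i : Fin (n + 2)) (i' : Fin (n + 1)) (hk2 : 2 ≤ k) (hk : k + 1 ≤ n)
    (hkd : k ≤ d * l) (hc : c + n ≤ (n + 1) * n / 2) :
    (c : ℕ∞) ≤ (idealOf (vanishingAt d o) (hyperplaneLocus d k co i i')).height := by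
  classical
  refine le_height_idealOf (by omega) co _ (fun A hA => hA.1) c fun K _ _ φ hφ => ?_
  choose a b hlin hnot using fun A : hyperplaneLocus d k co i i' => A.2.2
  -- The row of the product is used in place of `a`, which has `n + 1` entries. The other rows of
  -- the product are `b` and unit vectors, so `2 n` parameters describe the codimension two section.
  let p₁ : Fin n → hyperplaneLocus d k co i i' → ℂ := fun s A =>
    (elimMatrix i (a A) * elimMatrix i' (b A)) i s
  let p₂ : Fin n → hyperplaneLocus d k co i i' → ℂ := fun s A => b A s
  refine exists_small_set_of_linSubst φ hφ hd co (fun A => A.val) (fun A => A.2.1)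
    (i.succAbove ∘ i'.succAbove)
    (Fin.succAbove_right_injective.comp Fin.succAbove_right_injective)
    (fun A => elimMatrix i (a A) * elimMatrix i' (b A))
    (fun A s => ?_) (fun _ => 0) (fun _ => isHomogeneous_zero _ _ _)
    (Finset.univ.image p₁ ∪ Finset.univ.image p₂) ?_ ?_ hk2 (by omega) hkd ∅ (by simp) (by simp)
    hlin hnot ?_
  · rw [Function.comp_apply, elimMatrix_mul_succAbove, elimMatrix_succAbove]
  · intro i₀ s
    refine Fin.succAboveCases i ?_ (fun t => ?_) i₀
    · exact Algebra.subset_adjoin (by simp [p₁])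
    · simp only [elimMatrix_mul_succAbove]
      refine Fin.succAboveCases i' ?_ (fun t => ?_) t
      · simp only [elimMatrix_self]
        exact Algebra.subset_adjoin (by simp [p₂])
      · simp only [elimMatrix_succAbove]
        exact Subalgebra.algebraMap_mem _ ((Pi.single t 1 : Fin n → ℂ) s)
  · intro s
    simp only [map_zero, coeff_zero]
    exact Subalgebra.zero_mem _
  · intro j hj2 hjk
    have h1 := choose_two_le_card_mon (n := n) hj2 (by omega)
    have h2 := Finset.card_union_le (Finset.univ.image p₁) (Finset.univ.image p₂)
    have h3 : (Finset.univ.image p₁).card ≤ n := Finset.card_image_le.trans (by simp)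
    have h4 : (Finset.univ.image p₂).card ≤ n := Finset.card_image_le.trans (by simp)
    rw [card_mon_one, Finset.card_empty]
    omega

theorem linSubst_one (f : MvPolynomial (Fin n) ℂ) : linSubst 1 f = f := by
  have h : linSubst (1 : Matrix (Fin n) (Fin n) ℂ) = AlgHom.id ℂ _ := by
    ext1 i
    rw [linSubst_X, Finset.sum_eq_single i]
    · simp
    · intro b _ hb; simp [hb.symm]
    · simp
  rw [h]
  rfl

/-- The polynomials singular at the point. -/
def singularLocus (d : ℕ) {o : WeightedProj n l} (co : AdaptedCoordinates o) :
    Set (ParamSpace n d l) :=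
  {A | A ∈ vanishingAt d o ∧ ¬ IsNonsingularAt d (affineEq co A)}

theorem coeff_eq_zero_of_mem_singularLocus (hd : 2 ≤ d) {o : WeightedProj n l}
    {co : AdaptedCoordinates o} {A : ParamSpace n d l} (hA : A ∈ singularLocus d co) :
    coeff 0 ((affineEq co A).coeff 1) = 0 ∧
      homogeneousComponent 1 ((affineEq co A).coeff 0) = 0 := by
  have h := hA.2
  simp only [IsNonsingularAt, coeffPart, not_or, not_not, Nat.sub_self,
    show d - (d - 1) = 1 by omega] at h
  refine ⟨?_, h.2⟩
  have h1 := congrArg (coeff 0) h.1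
  rwa [coeff_homogeneousComponent, if_pos (map_zero _), coeff_zero] at h1

/-- The index of the coefficient `a_{d-1,0}` of `y`. -/
def yIndex (hd : 2 ≤ d) : CoordIndex n d l :=
  ⟨⟨(⟨d - 2, by omega⟩, 0), by simp⟩, fun hc => by
    have h : d - 2 + 1 = d := hc.1
    omega⟩

theorem coordFun_yIndex (hd : 2 ≤ d) {o : WeightedProj n l}
    {co : AdaptedCoordinates o} {A : ParamSpace n d l} (hA : A ∈ singularLocus d co) :
    coordFun co (yIndex hd).1 A = 0 := by
  have h := (coeff_eq_zero_of_mem_singularLocus hd hA).1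
  rw [coordFun]
  simpa only [yIndex, show d - (d - 2 + 1) = 1 by omega] using h

/-- The locus of polynomials singular at the point whose section by `y = 0` is non-regular. -/
def singularSectionLocus (d k : ℕ) {o : WeightedProj n l} (co : AdaptedCoordinates o) :
    Set (ParamSpace n d l) :=
  {A | A ∈ singularLocus d co ∧ ¬ IsFiniteOverLin (Ideal.span (truncation (fun j =>
    homogeneousComponent j ((affineEq co A).eval 0)) k)) (n + 1 - k)}

/-- At a singular point neither a hyperplane nor a graph has to be chosen, so there are no
parameters, and the vanishing coefficient of `y` adds one more condition. -/
theorem le_height_singularSectionLocus (hd : 2 ≤ d) {o : WeightedProj n l}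
    (co : AdaptedCoordinates o) (hk2 : 2 ≤ k) (hk : k + 1 ≤ n)
    (hkd : k ≤ d * l) (hc : c ≤ (n + 1) * n / 2 + n + 1) :
    (c : ℕ∞) ≤ (idealOf (vanishingAt d o) (singularSectionLocus d k co)).height := by
  classical
  refine le_height_idealOf (by omega) co _ (fun A hA => hA.1.1) c fun K _ _ φ hφ => ?_
  refine exists_small_set_of_linSubst φ hφ hd co (fun A => A.val) (fun A => A.2.1.1) id
    Function.injective_id (fun _ => 1)
    (fun A s => ?_) (fun _ => 0) (fun _ => isHomogeneous_zero _ _ _) ∅ ?_ ?_ hk2 (by omega) hkd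
    {yIndex hd} ?_ ?_ ?_ ?_ ?_
  · ext t
    rw [id, Matrix.one_apply, Pi.single_apply]
    simp only [eq_comm]
  · intro i s
    exact Subalgebra.algebraMap_mem _ ((1 : Matrix (Fin n) (Fin n) ℂ) i s)
  · intro s
    simp only [map_zero, coeff_zero]
    exact Subalgebra.zero_mem _
  · intro s hs A
    rw [Finset.mem_singleton.mp hs]
    exact coordFun_yIndex hd A.2.1
  · intro s hs
    rw [Finset.mem_singleton.mp hs]
    simp only [yIndex]
    omega
  · intro A
    rw [linSubst_one, ← Polynomial.coeff_zero_eq_eval_zero]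
    exact (coeff_eq_zero_of_mem_singularLocus hd A.2.1).2
  · intro A
    simp only [linSubst_one]
    exact A.2.2
  · intro j hj2 hjk
    have h1 := choose_two_le_card_mon (n := n) hj2 (by omega)
    rw [card_mon_one, Finset.card_empty, Finset.card_singleton]
    omega

end RegularityLoci

/-! ### Quadratic forms of small rank -/

section Rank

/-- A basis of the row space can be chosen among the rows. Fixing the index set makes the rank
condition a finite union of loci. -/
theorem exists_finset_rows {κ : Type} [Fintype κ] (B : Matrix κ κ ℂ) :
    ∃ I : Finset κ, I.card ≤ B.rank ∧
      ∃ γ : κ → κ → ℂ, ∀ a b, B a b = ∑ t ∈ I, γ a t * B t b := by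
  classical
  obtain ⟨ν, e, he, hspan, hli⟩ := exists_linearIndependent' ℂ (fun a => B a)
  have : Finite ν := Finite.of_injective e he
  have := Fintype.ofFinite ν
  refine ⟨Finset.univ.image e, ?_, ?_⟩
  · rw [Finset.card_image_of_injective _ he, Finset.card_univ, Matrix.rank_eq_finrank_span_row]
    change _ ≤ Module.finrank ℂ (Submodule.span ℂ (Set.range fun a => B a))
    rw [← hspan, finrank_span_eq_card hli]
  · have hmem : ∀ a, ∃ γ : κ → ℂ, ∀ b, B a b = ∑ t ∈ Finset.univ.image e, γ t * B t b := by
      intro a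
      have h1 : B a ∈ Submodule.span ℂ (Set.range ((fun a => B a) ∘ e)) := by
        rw [hspan]
        exact Submodule.subset_span ⟨a, rfl⟩
      obtain ⟨μ, hμ⟩ := (Submodule.mem_span_range_iff_exists_fun ℂ).mp h1
      refine ⟨fun t => ∑ j, if e j = t then μ j else 0, fun b => ?_⟩
      rw [← hμ, Finset.sum_image he.injOn, Finset.sum_apply]
      refine Finset.sum_congr rfl fun j _ => ?_
      have h2 : (∑ j', if e j' = e j then μ j' else 0) = μ j := by
        rw [Finset.sum_eq_single j]
        · simp
        · intro j' _ hj'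
          rw [if_neg fun h => hj' (he h)]
        · simp
      change μ j * B (e j) b = (∑ j', if e j' = e j then μ j' else 0) * B (e j) b
      rw [h2]
    choose γ hγ using hmem
    exact ⟨γ, hγ⟩

/-- A symmetric matrix is determined by rows spanning the row space. -/
theorem mem_of_rows_mem {K κ : Type} [Field K] [Algebra ℂ K] (F : IntermediateField ℂ K)
    (B : κ → κ → K) (hB : ∀ a b, B a b = B b a) (I : Finset κ) (γ : κ → κ → K)
    (hγ : ∀ a b, B a b = ∑ t ∈ I, γ a t * B t b) (hF : ∀ t ∈ I, ∀ b, B t b ∈ F) (a b : κ) :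
    B a b ∈ F := by
  -- The coefficients `γ` need not lie in `F`. By symmetry the entries in the columns of `I` do, so
  -- there `γ a t` may be replaced by its image under an `F`-linear retraction; a second use of
  -- symmetry extends the new expression to all columns.
  obtain ⟨π, hπ⟩ := (Algebra.linearMap F K).exists_leftInverse_of_injective
    (LinearMap.ker_eq_bot.mpr (algebraMap F K).injective)
  have hπF : ∀ u ∈ F, ((π u : F) : K) = u := by
    intro u hu
    have := congrArg (algebraMap F K) (LinearMap.congr_fun hπ ⟨u, hu⟩)
    exact this
  have hπmul : ∀ u, ∀ v ∈ F, ((π (u * v) : F) : K) = (π u : K) * v := by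
    intro u v hv
    have h1 : u * v = (⟨v, hv⟩ : F) • u := by rw [Algebra.smul_def]; exact mul_comm _ _
    rw [h1, map_smul, smul_eq_mul]
    exact mul_comm _ _
  have h1 : ∀ s ∈ I, B a s = ∑ t ∈ I, (π (γ a t) : K) * B t s := by
    intro s hs
    have h2 : B a s ∈ F := by rw [hB]; exact hF s hs a
    rw [← hπF _ h2, hγ a s, map_sum, AddSubmonoidClass.coe_finsetSum]
    exact Finset.sum_congr rfl fun t ht => hπmul _ _ (hF t ht s)
  have h3 : B a b = ∑ t ∈ I, (π (γ a t) : K) * B t b :=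
    calc B a b = ∑ s ∈ I, γ b s * B a s := by
          rw [hB, hγ]
          exact Finset.sum_congr rfl fun s _ => by rw [hB s a]
      _ = ∑ s ∈ I, γ b s * ∑ t ∈ I, (π (γ a t) : K) * B t s :=
          Finset.sum_congr rfl fun s hs => by rw [h1 s hs]
      _ = ∑ t ∈ I, (π (γ a t) : K) * ∑ s ∈ I, γ b s * B s t := by
          simp only [Finset.mul_sum]
          rw [Finset.sum_comm]
          refine Finset.sum_congr rfl fun t _ => Finset.sum_congr rfl fun s _ => ?_
          rw [hB t s]
          ring
      _ = ∑ t ∈ I, (π (γ a t) : K) * B t b :=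
          Finset.sum_congr rfl fun t _ => by rw [← hγ b t, hB b t]
  rw [h3]
  exact sum_mem fun t ht => mul_mem (π (γ a t)).2 (hF t ht b)

end Rank

/-! ### The polar matrix of the quadratic part in terms of coefficients. -/

section Polar

variable {M d l : ℕ}

theorem exists_eq_single_add_single {κ : Type} {m : κ →₀ ℕ} (hm : m.degree = 2) :
    ∃ p q, m = Finsupp.single p 1 + Finsupp.single q 1 := by
  classical
  have h0 : m ≠ 0 := by rintro rfl; simp at hm
  obtain ⟨p, hp⟩ := Finsupp.ne_iff.mp h0
  have hle : Finsupp.single p 1 ≤ m := by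
    rw [Finsupp.single_le_iff]
    exact Nat.one_le_iff_ne_zero.mpr hp
  obtain ⟨m', rfl⟩ := exists_add_of_le hle
  have h1 : m'.degree = 1 := by
    rw [map_add, Finsupp.degree_single] at hm
    omega
  obtain ⟨q, rfl⟩ := (Finsupp.sum_eq_one_iff m').mp (by rw [← h1, Finsupp.degree_apply]; rfl)
  exact ⟨p, q, rfl⟩

theorem polar_eq_coeff {κ : Type} [DecidableEq κ] {Q : MvPolynomial κ ℂ} (hQ : Q.IsHomogeneous 2)
    (i j : κ) :
    eval (Pi.single i 1 + Pi.single j 1 : κ → ℂ) Q - eval (Pi.single i 1) Q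
        - eval (Pi.single j 1) Q =
      (if i = j then 2 else 1) * coeff (Finsupp.single i 1 + Finsupp.single j 1) Q := by
  have hmon : ∀ (p q : κ) (v : κ → ℂ),
      eval v (monomial (Finsupp.single p 1 + Finsupp.single q 1) 1) = v p * v q := by
    intro p q v
    have : (monomial (Finsupp.single p 1 + Finsupp.single q 1) 1 : MvPolynomial κ ℂ) =
        X p * X q := by rw [X, X, monomial_mul, one_mul]
    rw [this, map_mul, eval_X, eval_X]
  have key : ∀ m ∈ Q.support, eval (Pi.single i 1 + Pi.single j 1 : κ → ℂ) (monomial m 1)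
      - eval (Pi.single i 1) (monomial m 1) - eval (Pi.single j 1) (monomial m 1) =
      (if i = j then 2 else 1) *
        coeff (Finsupp.single i 1 + Finsupp.single j 1) (monomial m (1 : ℂ)) := by
    intro m hm
    have hmd : m.degree = 2 := by
      have := hQ (mem_support_iff.mp hm)
      rw [Finsupp.degree_eq_weight_one (R := ℕ)]
      exact this
    obtain ⟨p, q, rfl⟩ := exists_eq_single_add_single hmd
    rw [hmon, hmon, hmon, coeff_monomial]
    have heq : (Finsupp.single p 1 + Finsupp.single q 1 = Finsupp.single i 1 + Finsupp.single j 1) ↔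
        (p = i ∧ q = j) ∨ (p = j ∧ q = i) := by
      rw [Finsupp.single_add_single_eq_single_add_single one_ne_zero one_ne_zero]
      simp
    simp only [heq, Pi.add_apply, Pi.single_apply]
    by_cases h1 : p = i <;> by_cases h2 : q = j <;> by_cases h3 : p = j <;> by_cases h4 : q = i <;>
      by_cases h5 : i = j <;> simp_all <;> norm_num
  conv_lhs => rw [Q.as_sum]
  conv_rhs => rw [Q.as_sum]
  simp only [map_sum, coeff_sum, Finset.mul_sum, ← Finset.sum_sub_distrib]
  refine Finset.sum_congr rfl fun m hm => ?_
  have h1 : (monomial m (coeff m Q) : MvPolynomial κ ℂ) = C (coeff m Q) * monomial m 1 := by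
    rw [C_mul_monomial, mul_one]
  rw [h1, map_mul, map_mul, map_mul, eval_C, eval_C, eval_C, coeff_C_mul, ← mul_sub, ← mul_sub,
    key m hm]
  ring

theorem coeff_rename_some_mul_X_pow (p : MvPolynomial (Fin M) ℂ) (k : ℕ)
    (m : Option (Fin M) →₀ ℕ) :
    coeff m (rename some p * X none ^ k) = if m none = k then coeff m.some p else 0 := by
  classical
  induction p using MvPolynomial.induction_on' with
  | monomial u a =>
    have h1 : (rename some (monomial u a) * X none ^ k : MvPolynomial (Option (Fin M)) ℂ) =
        monomial (u.mapDomain some + Finsupp.single none k) a := by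
      rw [rename_monomial, X_pow_eq_monomial, monomial_mul, mul_one]
    have h2 : u.mapDomain some + Finsupp.single none k = m ↔ m none = k ∧ u = m.some := by
      constructor
      · rintro rfl
        constructor
        · rw [Finsupp.add_apply, Finsupp.mapDomain_of_notMem_range _ _ (by simp), zero_add,
            Finsupp.single_eq_same]
        · ext t
          rw [Finsupp.some_apply, Finsupp.add_apply,
            Finsupp.mapDomain_apply (Option.some_injective _)]
          simp
      · rintro ⟨hk, rfl⟩
        ext t
        cases t with
        | none =>
          rw [Finsupp.add_apply, Finsupp.mapDomain_of_notMem_range _ _ (by simp), zero_add,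
            Finsupp.single_eq_same, hk]
        | some t =>
          rw [Finsupp.add_apply, Finsupp.mapDomain_apply (Option.some_injective _)]
          simp
    rw [h1, coeff_monomial, coeff_monomial]
    simp only [h2]
    by_cases h3 : m none = k <;> simp [h3]
  | add p q hp hq =>
    rw [map_add, add_mul, coeff_add, hp, hq, coeff_add]
    split_ifs <;> simp

theorem degree_option (m : Option (Fin M) →₀ ℕ) : m.degree = m none + m.some.degree := by
  rw [Finsupp.degree_eq_sum, Finsupp.degree_eq_sum, Fintype.sum_option]
  rfl

theorem coeff_quadraticPart (hd : 2 ≤ d) (f : Polynomial (MvPolynomial (Fin M) ℂ))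
    (m : Option (Fin M) →₀ ℕ) :
    coeff m (quadraticPart d f) = if m.degree = 2 then coeff m.some (f.coeff (m none)) else 0 := by
  have h1 := coeff_rename_some_mul_X_pow (coeffPart d f (d - 2) 0) 2 m
  have h2 := coeff_rename_some_mul_X_pow (coeffPart d f (d - 1) 1) 1 m
  have h3 := coeff_rename_some_mul_X_pow (coeffPart d f d 2) 0 m
  rw [pow_one] at h2
  rw [pow_zero, mul_one] at h3
  rw [quadraticPart, coeff_add, coeff_add, h1, h2, h3]
  simp only [coeffPart, coeff_homogeneousComponent, show d - (d - 2) = 2 by omega,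
    show d - (d - 1) = 1 by omega, Nat.sub_self, degree_option]
  rcases Nat.lt_or_ge 2 (m none) with h | h
  · simp [show m none ≠ 2 by omega, show m none ≠ 1 by omega, show m none ≠ 0 by omega,
      show m none + m.some.degree ≠ 2 by omega]
  · interval_cases hn : m none <;> simp
    exact if_congr (by omega) rfl rfl

theorem isHomogeneous_quadraticPart (hd : 2 ≤ d) (f : Polynomial (MvPolynomial (Fin M) ℂ)) :
    (quadraticPart d f).IsHomogeneous 2 := by
  intro m hm
  rw [coeff_quadraticPart hd] at hm
  have h : m.degree = 2 := by
    by_contra hcon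
    rw [if_neg hcon] at hm
    exact hm rfl
  rw [Finsupp.degree_eq_weight_one (R := ℕ)] at h
  exact h

end Polar

/-! ### Codimension of the locus of singular points with a quadratic form of small rank. -/

section RankLocus

variable {M d l : ℕ}

/-- The index of the coefficient of the quadratic part with exponent `m`. -/
def quadIndex (hd : 3 ≤ d) (hl : 2 ≤ l) (m : Option (Fin M) →₀ ℕ) : CoordIndex M d l :=
  if h : m.degree = 2 then
    ⟨⟨(⟨d - 1 - m none, by omega⟩, m.some), by
      rw [degree_option] at h
      have h1 : 1 * l ≤ (d - 1 - m none + 1) * l := Nat.mul_le_mul_right _ (by omega)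
      simp only
      omega⟩, fun hc => by
        rw [degree_option] at h
        have h1 : d - 1 - m none + 1 = d := hc.1
        have h2 : m.some = 0 := hc.2
        rw [h2, map_zero] at h
        omega⟩
  else yIndex (by omega)

theorem quadIndex_eq (hd : 3 ≤ d) (hl : 2 ≤ l) {m : Option (Fin M) →₀ ℕ} (hm : m.degree = 2) :
    (quadIndex hd hl m).1.1 = (⟨d - 1 - m none, by omega⟩, m.some) := by
  rw [quadIndex, dif_pos hm]

theorem quadIndex_injOn (hd : 3 ≤ d) (hl : 2 ≤ l) :
    Set.InjOn (quadIndex (M := M) hd hl) {m | m.degree = 2} := by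
  intro m hm m' hm' heq
  have h1 := quadIndex_eq hd hl hm
  have h2 := quadIndex_eq hd hl hm'
  rw [heq, h2, Prod.mk.injEq, Fin.mk.injEq] at h1
  have h3 := degree_option m
  have h4 := degree_option m'
  have h5 : m.degree = 2 := hm
  have h6 : m'.degree = 2 := hm'
  ext t
  cases t with
  | none => omega
  | some t => exact (DFunLike.congr_fun h1.2 t).symm

theorem coordFun_quadIndex (hd : 3 ≤ d) (hl : 2 ≤ l) {o : WeightedProj M l}
    (co : AdaptedCoordinates o) (A : ParamSpace M d l) {m : Option (Fin M) →₀ ℕ}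
    (hm : m.degree = 2) :
    coordFun co (quadIndex hd hl m).1 A = coeff m (quadraticPart d (affineEq co A)) := by
  have h3 := degree_option m
  rw [coordFun, quadIndex_eq hd hl hm, coeff_quadraticPart (by omega), if_pos hm]
  simp only
  rw [show d - (d - 1 - m none + 1) = m none by omega]

/-- The entries of the polar matrix of the quadratic part. -/
def polarEntry {o : WeightedProj M l} (co : AdaptedCoordinates o) (A : ParamSpace M d l)
    (a b : Option (Fin M)) : ℂ :=
  (if a = b then 2 else 1) *
    coeff (Finsupp.single a 1 + Finsupp.single b 1) (quadraticPart d (affineEq co A))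

theorem polarEntry_comm {o : WeightedProj M l} (co : AdaptedCoordinates o) (A : ParamSpace M d l)
    (a b : Option (Fin M)) : polarEntry co A a b = polarEntry co A b a := by
  rw [polarEntry, polarEntry, add_comm]
  simp only [eq_comm]

/-- The locus of polynomials singular at the point for which the rows of the polar matrix of the
quadratic part are spanned by those with index in `I`. -/
def rankLocus (d : ℕ) {o : WeightedProj M l} (co : AdaptedCoordinates o)
    (I : Finset (Option (Fin M))) : Set (ParamSpace M d l) :=
  {A | A ∈ singularLocus d co ∧ ∃ γ : Option (Fin M) → Option (Fin M) → ℂ,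
    ∀ a b, polarEntry co A a b = ∑ t ∈ I, γ a t * polarEntry co A t b}

theorem exists_mem_rankLocus (hd : 2 ≤ d) {o : WeightedProj M l} {co : AdaptedCoordinates o}
    {A : ParamSpace M d l} (hA : A ∈ singularLocus d co) :
    ∃ I : Finset (Option (Fin M)), I.card ≤ quadRank (quadraticPart d (affineEq co A)) ∧
      A ∈ rankLocus d co I := by
  obtain ⟨I, hI, γ, hγ⟩ := exists_finset_rows (Matrix.of fun i j : Option (Fin M) =>
    eval (Pi.single i 1 + Pi.single j 1 : Option (Fin M) → ℂ) (quadraticPart d (affineEq co A))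
      - eval (Pi.single i 1) (quadraticPart d (affineEq co A))
      - eval (Pi.single j 1) (quadraticPart d (affineEq co A)))
  refine ⟨I, hI, hA, γ, fun a b => ?_⟩
  have h1 := hγ a b
  simp only [Matrix.of_apply, polar_eq_coeff (isHomogeneous_quadraticPart hd _)] at h1
  exact h1

theorem degree_single_add_single {κ : Type} (a b : κ) :
    (Finsupp.single a 1 + Finsupp.single b 1 : κ →₀ ℕ).degree = 2 := by
  rw [map_add, Finsupp.degree_single, Finsupp.degree_single]

/-- The entries of the polar matrix with both indices outside `I` are determined by the rows in `I`.
There are at least `C(M+2-r, 2)` of them up to symmetry, and the `M + 1` coefficients of the linear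
part vanish in addition. -/
theorem le_height_rankLocus (hd : 3 ≤ d) (hl : 2 ≤ l) {o : WeightedProj M l}
    (co : AdaptedCoordinates o) (I : Finset (Option (Fin M))) {r c : ℕ} (hI : I.card ≤ r)
    (hr : r ≤ M + 1) (hc : c ≤ (M + 2 - r).choose 2 + M + 1) :
    (c : ℕ∞) ≤ (idealOf (vanishingAt d o) (rankLocus d co I)).height := by
  classical
  refine le_height_idealOf (by omega) co _ (fun A hA => hA.1.1) c fun K _ _ φ hφ => ?_
  choose γ hγ using fun A : rankLocus d co I => A.2.2
  have hdl : 1 ≤ d * l := Nat.mul_pos (by omega) (by omega)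
  let x : CoordIndex M d l → rankLocus d co I → ℂ := fun s A => coordFun co s.1 A.val
  let lin : Fin M → CoordIndex M d l := fun i =>
    lastIndex (show 2 ≤ d by omega) id (Finsupp.single i 1)
  have hlin : ∀ i, (lin i).1.1 = (⟨d - 1, by omega⟩, Finsupp.single i 1) := by
    intro i
    have := lastIndex_eq (l := l) (show 2 ≤ d by omega) (id : Fin M → Fin M)
      (m := Finsupp.single i 1) (by simp) (by simpa using hdl)
    rwa [Finsupp.mapDomain_id] at this
  have hlininj : Function.Injective lin := by
    intro i i' heq
    have h1 := hlin i
    rw [heq, hlin, Prod.mk.injEq] at h1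
    exact (Finsupp.single_left_injective one_ne_zero h1.2).symm
  have hlin0 : ∀ i, x (lin i) = 0 := by
    intro i
    ext A
    have h1 := congrArg (coeff (Finsupp.single i 1))
      (coeff_eq_zero_of_mem_singularLocus (by omega) A.2.1).2
    rw [coeff_homogeneousComponent, if_pos (by simp), coeff_zero] at h1
    change coordFun co (lin i).1 A.val = 0
    rw [coordFun, hlin]
    simpa only [show d - (d - 1 + 1) = 0 by omega] using h1
  have hy0 : x (yIndex (by omega)) = 0 := funext fun A => coordFun_yIndex (by omega) A.2.1
  set Zr : Finset (CoordIndex M d l) := insert (yIndex (by omega)) (Finset.univ.image lin) with hZr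
  have hZrcard : Zr.card = M + 1 := by
    rw [hZr, Finset.card_insert_of_notMem, Finset.card_image_of_injective _ hlininj,
      Finset.card_univ, Fintype.card_fin]
    intro hmem
    obtain ⟨i, _, hi⟩ := Finset.mem_image.mp hmem
    have h1 := hlin i
    rw [hi, Prod.mk.injEq] at h1
    have h2 := congrArg Fin.val h1.1
    simp only [yIndex] at h2
    omega
  have hZr0 : ∀ s ∈ Zr, x s = 0 := by
    intro s hs
    rcases Finset.mem_insert.mp hs with rfl | hs
    · exact hy0
    · obtain ⟨i, _, rfl⟩ := Finset.mem_image.mp hs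
      exact hlin0 i
  -- Unordered pairs of indices outside `I`, repetitions allowed, as quadratic exponents in the
  -- variables `z, y`.
  set J := (Finset.univ \ I).finsuppAntidiag 2 with hJ
  have hJdeg : ∀ m ∈ J, m.degree = 2 := by
    intro m hm
    rw [hJ, Finset.mem_finsuppAntidiag] at hm
    rw [Finsupp.degree_apply, ← hm.1]
    exact Finset.sum_subset hm.2 fun t _ ht => Finsupp.notMem_support_iff.mp ht
  have hdisj : Disjoint Zr (J.image (quadIndex hd hl)) := by
    rw [Finset.disjoint_left]
    intro s hs hs'
    obtain ⟨m, hm, rfl⟩ := Finset.mem_image.mp hs'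
    have h1 := quadIndex_eq hd hl (hJdeg m hm)
    have h2 := degree_option m
    have h3 := hJdeg m hm
    rcases Finset.mem_insert.mp hs with h | h
    · rw [h] at h1
      have h4 := congrArg (fun p => p.1.val) h1
      have h5 := congrArg (fun p => p.2.degree) h1
      simp only [yIndex, map_zero] at h4 h5
      omega
    · obtain ⟨i, _, hi⟩ := Finset.mem_image.mp h
      rw [← hi, hlin] at h1
      have h4 := congrArg (fun p => p.1.val) h1
      have h5 := congrArg (fun p => p.2.degree) h1
      simp only [Finsupp.degree_single] at h4 h5
      omega
  have hJcard : (M + 2 - r).choose 2 ≤ (J.image (quadIndex hd hl)).card := by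
    rw [Finset.card_image_of_injOn ((quadIndex_injOn hd hl).mono fun m hm => hJdeg m hm), hJ,
      Finset.card_finsuppAntidiag_nat_eq_choose, Finset.card_univ_sdiff, Fintype.card_option,
      Fintype.card_fin]
    exact Nat.choose_le_choose _ (by omega)
  refine ⟨(Finset.univ \ (Zr ∪ J.image (quadIndex hd hl))).image fun s => φ (x s), ?_, ?_⟩
  · have h1 : ((Finset.univ \ (Zr ∪ J.image (quadIndex hd hl))).image fun s => φ (x s)).card ≤
      (Finset.univ \ (Zr ∪ J.image (quadIndex hd hl))).card := Finset.card_image_le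
    have h2 := Finset.card_sdiff_add_card_eq_card
      (Finset.subset_univ (Zr ∪ J.image (quadIndex hd hl)))
    rw [Finset.card_univ, Finset.card_union_of_disjoint hdisj] at h2
    omega
  · intro F hF hT
    have hxT : ∀ s, s ∉ J.image (quadIndex hd hl) → φ (x s) ∈ F := by
      intro s hs
      by_cases hsZ : s ∈ Zr
      · rw [hZr0 s hsZ, map_zero]
        exact F.zero_mem
      · refine hT (Finset.mem_coe.mpr (Finset.mem_image.mpr ⟨s, ?_, rfl⟩))
        rw [Finset.mem_sdiff, Finset.mem_union, not_or]
        exact ⟨Finset.mem_univ _, hsZ, hs⟩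
    let B : Option (Fin M) → Option (Fin M) → K := fun a b =>
      φ fun A => polarEntry co A.val a b
    have hent : ∀ a b, (fun A : rankLocus d co I => polarEntry co A.val a b) =
        (if a = b then 2 else 1 : ℂ) •
          x (quadIndex hd hl (Finsupp.single a 1 + Finsupp.single b 1)) := by
      intro a b
      ext A
      simp only [Pi.smul_apply, x, coordFun_quadIndex hd hl co A.val (degree_single_add_single a b)]
      rfl
    have hBx : ∀ a b, B a b = (if a = b then 2 else 1 : ℂ) •
        φ (x (quadIndex hd hl (Finsupp.single a 1 + Finsupp.single b 1))) := by
      intro a b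
      simp only [B, hent, map_smul]
    have hBF := mem_of_rows_mem F B
      (fun a b => by
        simp only [B]
        congr 1
        ext A
        exact polarEntry_comm co A.val a b) I (fun a t => φ fun A => γ A a t)
      (fun a b => by
        simp only [B, ← map_mul, ← map_sum]
        congr 1
        ext A
        rw [hγ A a b]
        simp)
      (fun t ht b => by
        rw [hBx]
        refine F.smul_mem (hxT _ fun hmem => ?_)
        obtain ⟨m, hm, heq⟩ := Finset.mem_image.mp hmem
        have h1 := quadIndex_injOn hd hl (hJdeg m hm) (degree_single_add_single t b) heq
        rw [h1, hJ, Finset.mem_finsuppAntidiag] at hm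
        have h2 := hm.2 (show t ∈ _ by simp)
        exact (Finset.mem_sdiff.mp h2).2 ht)
    intro s
    by_cases hs : s ∈ J.image (quadIndex hd hl)
    · obtain ⟨m, hm, rfl⟩ := Finset.mem_image.mp hs
      obtain ⟨a, b, rfl⟩ := exists_eq_single_add_single (hJdeg m hm)
      have h1 := hBF a b
      rw [hBx] at h1
      have h2 : (if a = b then 2 else 1 : ℂ) ≠ 0 := by split_ifs <;> norm_num
      have h3 := F.smul_mem h1 (x := (if a = b then 2 else 1 : ℂ)⁻¹)
      rwa [inv_smul_smul₀ h2] at h3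
    · exact hxT s hs

end RankLocus

/-! ### The covering by the four kinds of loci and the numerical conclusion. -/

section Main

variable {d l n : ℕ}

theorem constantCoeff_eval {M : ℕ} (f : Polynomial (MvPolynomial (Fin M) ℂ))
    {h : MvPolynomial (Fin M) ℂ} (hh : h.IsHomogeneous 1) :
    constantCoeff (f.eval h) = constantCoeff (f.coeff 0) := by
  have h0 : constantCoeff h = 0 := by
    rw [constantCoeff_eq]
    exact hh.coeff_eq_zero (by simp)
  have h1 := Polynomial.hom_eval₂ f (RingHom.id _) (constantCoeff (R := ℂ)) h
  have h2 := Polynomial.hom_eval₂ f (RingHom.id _) (constantCoeff (R := ℂ)) 0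
  rw [map_zero] at h2
  rw [h0] at h1
  rw [Polynomial.coeff_zero_eq_eval_zero]
  exact h1.trans h2.symm

theorem constantCoeff_linSubst {M m : ℕ} (P : Matrix (Fin M) (Fin m) ℂ)
    (f : MvPolynomial (Fin M) ℂ) : constantCoeff (linSubst P f) = constantCoeff f := by
  have h : (constantCoeff (R := ℂ)).comp (linSubst P).toRingHom = constantCoeff := by
    ext i
    · simp [linSubst]
    · simp [linSubst]
  exact congrArg (fun φ : MvPolynomial (Fin M) ℂ →+* ℂ => φ f) h

theorem rank_elimMatrix (i : Fin (n + 1)) (a : Fin n → ℂ) : (elimMatrix i a).rank = n := by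
  refine le_antisymm (by simpa using (elimMatrix i a).rank_le_width) ?_
  have h1 : (Matrix.of fun s j => if j = i.succAbove s then (1 : ℂ) else 0 :
      Matrix (Fin n) (Fin (n + 1)) ℂ) * elimMatrix i a = 1 := by
    ext s t
    rw [Matrix.mul_apply, Finset.sum_eq_single (i.succAbove s)]
    · rw [elimMatrix_succAbove]
      simp [Matrix.one_apply, Pi.single_apply, eq_comm]
    · intro b _ hb
      simp [hb]
    · simp
  have h2 := Matrix.rank_mul_le_right (Matrix.of fun s j => if j = i.succAbove s then (1 : ℂ) else 0 :
      Matrix (Fin n) (Fin (n + 1)) ℂ) (elimMatrix i a)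
  rwa [h1, Matrix.rank_one, Fintype.card_fin] at h2

/-- Each way of violating the regularity condition leads to one kind of locus. When (R1.2) fails,
the first hyperplane is `h = 0` and the second is supplied by the linear part of the restriction. -/
theorem exists_mem_locus_of_not_isRegularAt {k₁ k₂ : ℕ} (hk₁ : ⌈(3 * d * l : ℚ) / 8⌉₊ = k₁)
    (hk₂ : ⌈(d * l : ℚ) / 2⌉₊ = k₂) (hd : 2 ≤ d) (h₁2 : 2 ≤ k₁) (h₁ : k₁ ≤ n + 1) (h₂2 : 2 ≤ k₂)
    (h₂ : k₂ ≤ n + 3) {o : WeightedProj (n + 2) l} (co : AdaptedCoordinates o)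
    {A : ParamSpace (n + 2) d l} (hA : A ∈ vanishingAt d o)
    (hnot : ¬ IsRegularAt d l (affineEq co A)) :
    (∃ i, A ∈ graphLocus d k₁ co i) ∨ (∃ i i', A ∈ hyperplaneLocus d k₁ co i i') ∨
      A ∈ singularSectionLocus d k₂ co ∨ ∃ I, I.card ≤ 6 ∧ A ∈ rankLocus d co I := by
  have h0 := (mem_vanishingAt_iff co A).mp hA
  have hc : ∀ h : MvPolynomial (Fin (n + 2)) ℂ, h.IsHomogeneous 1 →
      constantCoeff ((affineEq co A).eval h) = 0 := fun h hh => by rw [constantCoeff_eval _ hh, h0]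
  by_cases hns : IsNonsingularAt d (affineEq co A)
  · by_cases hR1 : CondR1 d l (affineEq co A)
    · have hR12 : ¬ CondR12 d l (affineEq co A) := fun hR12 =>
        hnot ⟨fun _ => ⟨hR1, fun _ => hR12⟩, fun h => absurd hns h⟩
      simp only [CondR12, not_forall] at hR12
      obtain ⟨h, hh, hind, hreg⟩ := hR12
      obtain ⟨i, a, ha, -⟩ := exists_elim hh (hind.ne_zero 0)
      have hreg' : ¬ IsKRegular (linSubst (elimMatrix i a) ((affineEq co A).eval 0)) k₁ := by
        intro hreg'
        refine hreg ⟨elimMatrix i a, rank_elimMatrix i a, ha, ?_⟩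
        rw [hk₁]
        exact hreg'
      obtain ⟨i', b, hlin, hfin⟩ := exists_not_isFiniteOverLin _ (by
        rw [constantCoeff_linSubst, hc 0 (isHomogeneous_zero _ _ _)]) h₁2 (by omega) hreg'
      simp only [linSubst_linSubst] at hlin hfin
      exact Or.inr (Or.inl ⟨i, i', hA, a, b, hlin, hfin⟩)
    · simp only [CondR1, not_forall] at hR1
      obtain ⟨h, hh, hreg⟩ := hR1
      rw [hk₁] at hreg
      obtain ⟨i, a, hlin, hfin⟩ := exists_not_isFiniteOverLin _ (hc h hh) h₁2 (by omega) hreg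
      exact Or.inl ⟨i, hA, h, hh, a, hlin, hfin⟩
  · have hR2 : ¬ CondR2 d l (affineEq co A) := fun hR2 =>
      hnot ⟨fun h => absurd h hns, fun _ => hR2⟩
    have hsing : A ∈ singularLocus d co := ⟨hA, hns⟩
    refine Or.inr (Or.inr ?_)
    rw [CondR2, not_and_or, hk₂] at hR2
    rcases hR2 with hrank | hreg
    · obtain ⟨I, hI, hAI⟩ := exists_mem_rankLocus hd hsing
      exact Or.inr ⟨I, by omega, hAI⟩
    · refine Or.inl ⟨hsing, ?_⟩
      refine not_isFiniteOverLin_of_not_isKRegular _ (hc 0 (isHomogeneous_zero _ _ _)) ?_ h₂2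
        (by omega) hreg
      rw [← Polynomial.coeff_zero_eq_eval_zero]
      exact (coeff_eq_zero_of_mem_singularLocus hd hsing).2

end Main

end FiniteCover

end

theorem proposition2p1 (d l M : ℕ) (hd : 5 ≤ d) (hl : 2 ≤ l) (hdl : (d, l) ≠ (5, 2))
    (hM : M = (d - 1) * l) (o : FiniteCover.WeightedProj M l) (ho : o ≠ FiniteCover.oStar M l)
    (c : FiniteCover.AdaptedCoordinates o) :
    (((M - 4) * (M - 5) / 2 + M + 1 : ℕ) : ℕ∞) ≤
      FiniteCover.codim (FiniteCover.vanishingAt d o) (FiniteCover.nonRegularAt d c) := by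
  obtain ⟨d, rfl⟩ : ∃ d', d = d' + 1 := ⟨d - 1, by omega⟩
  rw [Nat.add_sub_cancel] at hM
  have h1 : 4 * l ≤ M := hM ▸ Nat.mul_le_mul_right l (by omega)
  have h2 : (d + 1) * l = M + l := by rw [hM, Nat.succ_mul]
  -- This shape of `M` lets the loci be applied with `n = M - 1`, `M - 2` and `M`, without truncated
  -- subtraction.
  obtain ⟨e, rfl⟩ : ∃ e, M = e + 6 + 2 := ⟨M - 8, by omega⟩
  have h2q : ((d + 1 : ℕ) : ℚ) * l = e + 8 + l := by
    rw [← Nat.cast_mul, h2]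
    push_cast
    ring
  have h1q : 4 * (l : ℚ) ≤ e + 8 := by exact_mod_cast h1
  have hlq : (2 : ℚ) ≤ l := by exact_mod_cast hl
  have heq : (0 : ℚ) ≤ e := by positivity
  set k₁ := ⌈(3 * (d + 1 : ℕ) * l : ℚ) / 8⌉₊ with hk₁
  set k₂ := ⌈((d + 1 : ℕ) * l : ℚ) / 2⌉₊ with hk₂
  -- From `dl = M + l` and `4 l ≤ M` one gets `3dl/8 ≤ 15M/32`, below the bound `M - 3` required by
  -- the section of codimension two.
  have hk₁u : k₁ + 1 ≤ e + 6 := by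
    have : k₁ ≤ e + 5 := by
      rw [hk₁, Nat.ceil_le, mul_assoc, h2q]
      push_cast
      linarith
    omega
  have hk₁l : 2 ≤ k₁ := by
    have : 1 < k₁ := by
      rw [hk₁, Nat.lt_ceil, mul_assoc, h2q]
      push_cast
      linarith
    omega
  -- Similarly `dl/2 ≤ 5M/8`, and the singular case requires at most `M - 1`.
  have hk₂u : k₂ + 1 ≤ e + 6 + 2 := by
    have : k₂ ≤ e + 7 := by
      rw [hk₂, Nat.ceil_le, h2q]
      push_cast
      linarith
    omega
  have hk₂l : 2 ≤ k₂ := by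
    have : 1 < k₂ := by
      rw [hk₂, Nat.lt_ceil, h2q]
      push_cast
      linarith
    omega
  have hX : (e + 6 + 2 - 4) * (e + 6 + 2 - 5) = e * e + 7 * e + 12 := by
    rw [show e + 6 + 2 - 4 = e + 4 by omega, show e + 6 + 2 - 5 = e + 3 by omega]
    ring
  have hX₁ : (e + 6 + 1 + 1) * (e + 6 + 1) = e * e + 15 * e + 56 := by ring
  have hX₂ : (e + 6 + 1) * (e + 6) = e * e + 13 * e + 42 := by ring
  have hX₃ : (e + 6 + 2 + 1) * (e + 6 + 2) = e * e + 17 * e + 72 := by ring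
  have hX₄ : (e + 6 + 2 + 2 - 6).choose 2 = (e * e + 7 * e + 12) / 2 := by
    rw [show e + 6 + 2 + 2 - 6 = e + 4 by omega, Nat.choose_two_right,
      show e + 4 - 1 = e + 3 by omega, show (e + 4) * (e + 3) = e * e + 7 * e + 12 by ring]
  rw [hX]
  let p : Fin (e + 6 + 2) ⊕ (Fin (e + 6 + 2) × Fin (e + 6 + 1)) ⊕ Unit ⊕
      {I : Finset (Option (Fin (e + 6 + 2))) // I.card ≤ 6} →
      Set (FiniteCover.ParamSpace (e + 6 + 2) (d + 1) l) :=
    Sum.elim (FiniteCover.graphLocus (d + 1) k₁ c) (Sum.elim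
      (fun i => FiniteCover.hyperplaneLocus (d + 1) k₁ c i.1 i.2) (Sum.elim
        (fun _ => FiniteCover.singularSectionLocus (d + 1) k₂ c)
        (fun I => FiniteCover.rankLocus (d + 1) c I.1)))
  refine FiniteCover.le_codim_zariskiClosure _ _ p ?_ _ ?_
  · rintro A ⟨hA, hreg⟩
    have hnot : ¬ FiniteCover.IsRegularAt (d + 1) l (FiniteCover.affineEq c A) :=
      fun h => hreg ⟨hA, h⟩
    rw [Set.mem_iUnion]
    rcases FiniteCover.exists_mem_locus_of_not_isRegularAt hk₁.symm hk₂.symm (by omega) hk₁l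
      (by omega) hk₂l (by omega) c hA hnot with ⟨i, h⟩ | ⟨i, i', h⟩ | h | ⟨I, hI, h⟩
    · exact ⟨Sum.inl i, h⟩
    · exact ⟨Sum.inr (Sum.inl (i, i')), h⟩
    · exact ⟨Sum.inr (Sum.inr (Sum.inl ())), h⟩
    · exact ⟨Sum.inr (Sum.inr (Sum.inr ⟨I, hI⟩)), h⟩
  · rintro (i | ⟨i, i'⟩ | - | ⟨I, hI⟩)
    · exact FiniteCover.le_height_graphLocus (by omega) c i hk₁l (by omega) (by omega)
        (by rw [hX₁]; omega)
    · exact FiniteCover.le_height_hyperplaneLocus (by omega) c i i' hk₁l hk₁u (by omega)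
        (by rw [hX₂]; omega)
    · exact FiniteCover.le_height_singularSectionLocus (by omega) c hk₂l hk₂u (by omega)
        (by rw [hX₃]; omega)
    -- For rank at most 6 the bound is attained with equality: `C(M-4, 2) + M + 1`.
    · exact FiniteCover.le_height_rankLocus (by omega) hl c I hI (by omega) (by rw [hX₄])
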